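/- Let $N\ge 2$ and let $B_1$ be the open unit ball of $\mathbb{R}^N$. Assume: - (K) $K:[0,1)\to(0,\infty)$ is continuous; - (f1) $f:(0,\infty)\to(0,\infty)$ is nondecreasing and locally Lipschitz continuous; - (f2) $\int^{\infty}F(\tau)^{-\frac{N-1}{2N-1}}\,d\tau=\infty$, where $F(\tau)=\int_0^\tau f(s)\,ds$. Let $p\in C^1(0,\infty)$ be positive with $p'<0$ on $(0,\infty)$, $\lim_{t\to0^+}p(t)=\infty$ and $\int_{0^+}P(\tau)^{\frac{N-1}{N}}\,d\tau=\infty$, where $P(\tau)=\int_\tau^1 p(s)\,ds$ (write $p\in\mathcal P_\infty$), and assume that there are constants $c,d>0$ such that $c\,p(1-r)\le K(r)\le d\,p(1-r)$ for all $r<1$ close to $1$. For a fixed $a>0$ put $$G(t)=\int_a^t\Big(\tfrac{2N-1}{N-1}F(\tau)\Big)^{-\frac{N-1}{2N-1}}d\tau,\qquad g=G^{-1}:[0,\infty)\to[a,\infty),\qquad H=-\frac{G\,G''}{(G')^2},$$ and assume that $\lim_{\tau\to\infty}H(\tau)$ exists (as a finite number). Then the boundary blow-up problem $$\det{}^{\frac1{N-1}}\big(\Delta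 z\,I-D^2z\big)=K(|x|)f(z)\ \text{ in }B_1,\qquad z(x)\to\infty\ \text{ as }\operatorname{dist}(x,\partial B_1)\to0,$$ has infinitely many radial solutions $z\in C^2(B_1)$, $z>0$, that are $(N-1)$-convex, i.e. $\Delta z\,I-D^2z$ is positive definite in $B_1$. More precisely, for $q\in\mathcal P_\infty$ with $Q(\tau)=\int_\tau^1 q(s)\,ds$ and for $k>0$ put $$\varphi_q(t)=\int_t^1\Big(\tfrac{N}{N-1}Q(\tau)\Big)^{\frac{N-1}{N}}d\tau,\qquad w_{q,k}(r)=g\Big(k\,\varphi_q\big(\tfrac{1-r^2}{2}\big)^{\frac{N}{2N-1}}\Big),$$ and for $u\in C^2[0,1)$ with $u>0$, $u'(0)=0$ and $u'\ge0$ put $$L[u](r)=\Big(\tfrac{N-1}{r}u'(r)\Big)^{\frac1{N-1}}\Big[u''(r)+\tfrac{N-2}{r}u'(r)\Big],\quad 0<r<1.$$ There are $\varepsilon,M,k_1,k_2>0$ such that, with $p_1(t)=\varepsilon p(2t)$, $p_2(t)=Mp(t)$, the functions $w_1=w_{p_1,k_1}$ and $w_2=w_{p_2,k_2}$ are positive and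 of class $C^2[0,1)$ with $w_i'(0)=0$ and $w_i'\ge0$, satisfy $L[w_1]\le K f(w_1)$ and $L[w_2]\ge K f(w_2)$ on $(0,1)$ and $w_1(0)<w_2(0)$, and for every $k\in(w_1(0),w_2(0))$ the initial value problem $$L[u](r)=K(r)f(u(r)),\ 0<r<1,\qquad u(0)=k,\quad u'(0)=0,$$ has a unique solution $u_k\in C^2[0,1)$ with $u_k>0$ and $u_k'\ge0$; it satisfies $w_1<u_k<w_2$ on $[0,1)$, and $z(x)=u_k(|x|)$ is a radial $(N-1)$-convex solution of the boundary blow-up problem. -/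

import Mathlib

open Set Filter Topology MeasureTheory
open scoped Laplacian

namespace BlowUp

noncomputable section

/-- Condition (K) : `K : [0,1) → (0,∞)` is continuous. -/
def CondK (K : ℝ → ℝ) : Prop :=
  ContinuousOn K (Ico 0 1) ∧ ∀ r ∈ Ico (0 : ℝ) 1, 0 < K r

/-- Condition (f₁) : `f : (0,∞) → (0,∞)` is nondecreasing and locally Lipschitz. -/
def CondF1 (f : ℝ → ℝ) : Prop :=
  (∀ t, 0 < t → 0 < f t) ∧ MonotoneOn f (Ioi 0) ∧ LocallyLipschitzOn (Ioi 0) f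

/-- `F(τ) = ∫₀^τ f`. -/
def primF (f : ℝ → ℝ) (τ : ℝ) : ℝ := ∫ s in (0 : ℝ)..τ, f s

/-- Condition (f₂), the Keller–Osserman type condition
`∫^∞ F(τ)^{-(N-1)/(2N-1)} dτ = ∞`. -/
def CondF2 (N : ℕ) (f : ℝ → ℝ) : Prop :=
  ∃ b : ℝ, 0 < b ∧
    Tendsto (fun t : ℝ => ∫ τ in b..t, primF f τ ^ (-(((N : ℝ) - 1) / (2 * N - 1))))
      atTop atTop

/-- `G(t) = ∫_a^t ((2N-1)/(N-1) F(τ))^{-(N-1)/(2N-1)} dτ`. -/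
def funG (N : ℕ) (f : ℝ → ℝ) (a t : ℝ) : ℝ :=
  ∫ τ in a..t,
    ((2 * (N : ℝ) - 1) / (N - 1) * primF f τ) ^ (-(((N : ℝ) - 1) / (2 * N - 1)))

/-- `g : [0,∞) → [a,∞)`, the inverse function of `G`. -/
def fung (N : ℕ) (f : ℝ → ℝ) (a : ℝ) : ℝ → ℝ :=
  Function.invFunOn (funG N f a) (Ici a)

/-- `H = - G G'' / (G')²`. -/
def funH (N : ℕ) (f : ℝ → ℝ) (a τ : ℝ) : ℝ :=
  -(funG N f a τ * deriv (deriv (funG N f a)) τ) / deriv (funG N f a) τ ^ 2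

/-- `P(τ) = ∫_τ^1 p`. -/
def funP (p : ℝ → ℝ) (τ : ℝ) : ℝ := ∫ s in τ..1, p s

/-- The class `𝒫_∞` : `p ∈ C¹(0,∞)`, `p > 0`, `p' < 0`, `p(0⁺) = ∞`
and `∫_{0⁺} P(τ)^{(N-1)/N} dτ = ∞`. -/
def ClassP (N : ℕ) (p : ℝ → ℝ) : Prop :=
  ContDiffOn ℝ 1 p (Ioi 0) ∧ (∀ t, 0 < t → 0 < p t) ∧ (∀ t, 0 < t → deriv p t < 0) ∧
    Tendsto p (𝓝[>] 0) atTop ∧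
    Tendsto (fun δ : ℝ => ∫ τ in δ..1, funP p τ ^ (((N : ℝ) - 1) / N)) (𝓝[>] 0) atTop

/-- `φ(t) = ∫_t^1 (N/(N-1) P(τ))^{(N-1)/N} dτ`. -/
def funPhi (N : ℕ) (p : ℝ → ℝ) (t : ℝ) : ℝ :=
  ∫ τ in t..1, ((N : ℝ) / (N - 1) * funP p τ) ^ (((N : ℝ) - 1) / N)

/-- `w(r) = g(k φ((1-r²)/2)^{N/(2N-1)})`. -/
def barrier (N : ℕ) (f : ℝ → ℝ) (a : ℝ) (p : ℝ → ℝ) (k r : ℝ) : ℝ :=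
  fung N f a (k * funPhi N p ((1 - r ^ 2) / 2) ^ ((N : ℝ) / (2 * N - 1)))

/-- The radial form of the operator,
`((N-1)/r u'(r))^{1/(N-1)} (u''(r) + (N-2)/r u'(r))`. -/
def radialOp (N : ℕ) (u : ℝ → ℝ) (r : ℝ) : ℝ :=
  (((N : ℝ) - 1) / r * deriv u r) ^ (1 / ((N : ℝ) - 1)) *
    (deriv (deriv u) r + ((N : ℝ) - 2) / r * deriv u r)

/-- `u ∈ C²[0,1)` with `u'(0) = 0` and `u' ≥ 0` (so that the fractional power in
`radialOp` is the root of a nonnegative number), and `u > 0`. -/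
def Admissible (u : ℝ → ℝ) : Prop :=
  ContDiffOn ℝ 2 u (Ico 0 1) ∧ derivWithin u (Ico 0 1) 0 = 0 ∧
    (∀ r ∈ Ioo (0 : ℝ) 1, 0 ≤ deriv u r) ∧ ∀ r ∈ Ico (0 : ℝ) 1, 0 < u r

/-- `u` solves the initial value problem on the whole of `[0,1)`, with `u(0) = k`, `u'(0) = 0`. -/
def SolvesIVP (N : ℕ) (K f : ℝ → ℝ) (k : ℝ) (u : ℝ → ℝ) : Prop :=
  Admissible u ∧ u 0 = k ∧ ∀ r ∈ Ioo (0 : ℝ) 1, radialOp N u r = K r * f (u r)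

/-- `w` is a sub-solution : `radialOp w ≤ K f(w)` on `(0,1)`. -/
def IsSub (N : ℕ) (K f : ℝ → ℝ) (w : ℝ → ℝ) : Prop :=
  Admissible w ∧ ∀ r ∈ Ioo (0 : ℝ) 1, radialOp N w r ≤ K r * f (w r)

/-- `w` is a super-solution in the sense that `radialOp w ≥ K f(w)` on `(0,1)`. -/
def IsSuper (N : ℕ) (K f : ℝ → ℝ) (w : ℝ → ℝ) : Prop :=
  Admissible w ∧ ∀ r ∈ Ioo (0 : ℝ) 1, K r * f (w r) ≤ radialOp N w r

/-- The open unit ball of `ℝ^N`. -/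
def unitBall (N : ℕ) : Set (EuclideanSpace ℝ (Fin N)) := Metric.ball 0 1

/-- The Hessian matrix `D²z(x)`. -/
def hessian {N : ℕ} (z : EuclideanSpace ℝ (Fin N) → ℝ) (x : EuclideanSpace ℝ (Fin N)) :
    Matrix (Fin N) (Fin N) ℝ :=
  Matrix.of fun i j =>
    iteratedFDeriv ℝ 2 z x ![EuclideanSpace.single i 1, EuclideanSpace.single j 1]

/-- The matrix `Δz(x) I - D²z(x)`. -/
def maMatrix {N : ℕ} (z : EuclideanSpace ℝ (Fin N) → ℝ) (x : EuclideanSpace ℝ (Fin N)) :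
    Matrix (Fin N) (Fin N) ℝ :=
  (Δ z) x • (1 : Matrix (Fin N) (Fin N) ℝ) - hessian z x

/-- `z` is a radial `(N-1)`-convex (classical) solution `z : B₁ → (0,∞)` of
`det^{1/(N-1)}(Δz I - D²z) = K(|x|) f(z)` in the unit ball with
`z(x) → ∞` as `dist(x, ∂B₁) → 0`. Only the values of `z` on the ball matter. -/
structure IsRadialConvexSolution (N : ℕ) (K f : ℝ → ℝ)
    (z : EuclideanSpace ℝ (Fin N) → ℝ) : Prop where
  contDiffOn : ContDiffOn ℝ 2 z (unitBall N)
  pos : ∀ x ∈ unitBall N, 0 < z x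
  radial : ∃ u : ℝ → ℝ, ∀ x ∈ unitBall N, z x = u ‖x‖
  convex : ∀ x ∈ unitBall N, (maMatrix z x).PosDef
  equation : ∀ x ∈ unitBall N,
    (maMatrix z x).det ^ (1 / ((N : ℝ) - 1)) = K ‖x‖ * f (z x)
  blowUp : ∀ M : ℝ, ∃ δ > 0, ∀ x ∈ unitBall N,
    Metric.infDist x (frontier (unitBall N)) < δ → M < z x

/-- The set of all radial `(N-1)`-convex solutions, as functions on the unit ball. -/
def radialConvexSolutions (N : ℕ) (K f : ℝ → ℝ) : Set (unitBall N → ℝ) :=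
  (unitBall N).domRestrict '' {z | IsRadialConvexSolution N K f z}

end

end BlowUp

open BlowUp

noncomputable section RadialMean

/-! ### Weighted radial means and the integral form of the radial equation -/

section Primitive

variable {g : ℝ → ℝ}

/-! Write `n = N - 1`. For admissible `u`, the derivative of `(n r^(n-1) u')^((n+1)/n)` is `(n+1)
r^n L[u]`. Hence, for continuous positive `h`, the problem `L[u] = h`, `u'(0) = 0` integrates to `u'
= r X^(n/(n+1)) / n`, where `X` is the mean of `h` over `[0,r]` with weight `s^n` (`radMean`,
`radSol`). The same identity turns differential inequalities into integral ones (`le_radSol`,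
`radSol_le`). So the initial value problem is the fixed point equation of `T u = radSol n k (K
f(u))`, and `T` is monotone because `f` is. A sub-solution `w₁` and a super-solution `w₂` satisfy
`w₁ ≤ T w₁` and `T w₂ ≤ w₂` as soon as `w₁(0) < k < w₂(0)`; iterating `T` from `w₁` gives a solution
on all of `[0,1)` (`exists_fixedPoint`). It is unique because on `[0,R]` the sources are bounded
below by a positive constant, where the fractional power is Lipschitz (`fixedPoint_unique`). For
`z(x) = u(|x|)` with `u' = r b`, the matrix `Δz I - D²z` is a multiple of the identity plus a
rank-one matrix, with eigenvalues `n b + r b'` (`n` times) and `n b`; this gives convexity and the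
equation (`exists_unique_solution`). The barriers are `w = g(s)` with `s = k φ^((n+1)/(2n+1))`. The
exponents are such that `L[w]` equals a constant times `k^(2+1/n) q f(w) B` (`radialOp_barrier`),
where the bracket `B` depends only on `r`, `(φ')²/(φ φ'')`, `-φ'/φ''` and `ρ = 1/H(g(s))`.
Monotonicity of the weight bounds the two quotients of `φ`, monotonicity of `f` gives `ρ ≤ (n+1)/n +
O(1/s)`, and finiteness of the limit of `H` keeps `ρ` away from zero for large `s`. Thus `k² B =
O(k)` for small `k`, which gives sub-solutions, while `B` is bounded below for large `k`, which
gives super-solutions. The sub-solution blows up because the integral of `P^((N-1)/N)` diverges, so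
everything above it does too. Different values at the centre give different solutions. -/

lemma intervalIntegrable_of_continuousOn_Ico (hg : ContinuousOn g (Ico 0 1)) {s t : ℝ}
    (hs : s ∈ Ico (0 : ℝ) 1) (ht : t ∈ Ico (0 : ℝ) 1) : IntervalIntegrable g volume s t :=
  (hg.mono (ordConnected_Ico.uIcc_subset hs ht)).intervalIntegrable

/-- Only integrability is assumed, because in `exists_fixedPoint` the integrand is built from a
monotone limit whose continuity is not yet known. -/
lemma continuousOn_primitive_Ico
    (hg : ∀ t ∈ Ico (0 : ℝ) 1, IntervalIntegrable g volume 0 t) :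
    ContinuousOn (fun t => ∫ s in (0 : ℝ)..t, g s) (Ico 0 1) := by
  intro t ht
  obtain ⟨R, htR, hR⟩ := exists_between ht.2
  have hR0 : 0 ≤ R := ht.1.trans htR.le
  have h := intervalIntegral.continuousOn_primitive_interval (μ := volume) (a := (0 : ℝ)) (b := R)
    (f := g) (by rw [← intervalIntegrable_iff']; exact hg R ⟨hR0, hR⟩)
  rw [uIcc_of_le hR0] at h
  refine (h t ⟨ht.1, htR.le⟩).mono_of_mem_nhdsWithin ?_
  exact mem_nhdsWithin.2 ⟨Iio R, isOpen_Iio, htR, fun x hx => ⟨hx.2.1, hx.1.le⟩⟩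

lemma hasDerivAt_primitive_Ico (hg : ContinuousOn g (Ico 0 1)) {t : ℝ}
    (ht : t ∈ Ioo (0 : ℝ) 1) : HasDerivAt (fun t => ∫ s in (0 : ℝ)..t, g s) (g t) t :=
  intervalIntegral.integral_hasDerivAt_right
    (intervalIntegrable_of_continuousOn_Ico hg ⟨le_rfl, one_pos⟩ ⟨ht.1.le, ht.2⟩)
    ((hg.mono Ioo_subset_Ico_self).stronglyMeasurableAtFilter isOpen_Ioo t ht)
    (hg.continuousAt (Ico_mem_nhds ht.1 ht.2))

end Primitive

/-- The mean `(n+1) ∫₀¹ θⁿ h(tθ) dθ = (n+1) t^{-(n+1)} ∫₀ᵗ sⁿ h(s) ds`. -/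
def radMean (n : ℕ) (h : ℝ → ℝ) (t : ℝ) : ℝ :=
  ((n : ℝ) + 1) * ∫ θ in (0 : ℝ)..1, θ ^ n * h (t * θ)

/-- The quotient `u'(t)/t` for the solution of the radial equation with right-hand side `h`. -/
def radSlope (n : ℕ) (h : ℝ → ℝ) (t : ℝ) : ℝ :=
  radMean n h t ^ ((n : ℝ) / (n + 1)) / n

/-- The derivative of `radSlope`. -/
def radSlopeDeriv (n : ℕ) (h : ℝ → ℝ) (t : ℝ) : ℝ :=
  radMean n h t ^ ((n : ℝ) / (n + 1) - 1) * (h t - radMean n h t) / t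

/-- The solution of the radial equation with right-hand side `h` and initial value `k`. -/
def radSol (n : ℕ) (k : ℝ) (h : ℝ → ℝ) (r : ℝ) : ℝ :=
  k + ∫ t in (0 : ℝ)..r, t * radSlope n h t

variable {n : ℕ} {h h₁ h₂ : ℝ → ℝ} {k r t : ℝ}

lemma mul_mem_Ico_of_mem_Icc {θ : ℝ} (ht : t ∈ Ico (0 : ℝ) 1) (hθ : θ ∈ Icc (0 : ℝ) 1) :
    t * θ ∈ Ico (0 : ℝ) 1 :=
  ⟨mul_nonneg ht.1 hθ.1, (mul_le_of_le_one_right ht.1 hθ.2).trans_lt ht.2⟩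

lemma continuousOn_radMean_integrand (hh : ContinuousOn h (Ico 0 1)) (ht : t ∈ Ico (0 : ℝ) 1) :
    ContinuousOn (fun θ => θ ^ n * h (t * θ)) (Icc 0 1) :=
  (continuousOn_pow n).mul (hh.comp (by fun_prop) fun _ hθ => mul_mem_Ico_of_mem_Icc ht hθ)

lemma intervalIntegrable_radMean (hh : ContinuousOn h (Ico 0 1)) (ht : t ∈ Ico (0 : ℝ) 1) :
    IntervalIntegrable (fun θ => θ ^ n * h (t * θ)) volume 0 1 :=
  ContinuousOn.intervalIntegrable
    (by rw [uIcc_of_le zero_le_one]; exact continuousOn_radMean_integrand hh ht)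

/-- The form of the mean rescaled to `[0,1]` makes sense at the origin, so no limit has to be taken
there. -/
lemma radMean_zero : radMean n h 0 = h 0 := by
  have : ((n : ℝ) + 1) ≠ 0 := by positivity
  simp [radMean]
  field_simp

lemma radMean_mono (ht : t ∈ Ico (0 : ℝ) 1)
    (i₁ : IntervalIntegrable (fun θ => θ ^ n * h₁ (t * θ)) volume 0 1)
    (i₂ : IntervalIntegrable (fun θ => θ ^ n * h₂ (t * θ)) volume 0 1)
    (hle : ∀ s ∈ Icc (0 : ℝ) t, h₁ s ≤ h₂ s) : radMean n h₁ t ≤ radMean n h₂ t := by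
  refine mul_le_mul_of_nonneg_left
    (intervalIntegral.integral_mono_on zero_le_one i₁ i₂ fun θ hθ => ?_) (by positivity)
  exact mul_le_mul_of_nonneg_left
    (hle _ ⟨mul_nonneg ht.1 hθ.1, mul_le_of_le_one_right ht.1 hθ.2⟩) (pow_nonneg hθ.1 n)

lemma radMean_pos (hh : ContinuousOn h (Ico 0 1)) (hpos : ∀ s ∈ Ico (0 : ℝ) 1, 0 < h s)
    (ht : t ∈ Ico (0 : ℝ) 1) : 0 < radMean n h t := by
  refine mul_pos (by positivity) (intervalIntegral.intervalIntegral_pos_of_pos_on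
    (intervalIntegrable_radMean hh ht) (fun θ hθ => ?_) one_pos)
  exact mul_pos (pow_pos hθ.1 n) (hpos _ (mul_mem_Ico_of_mem_Icc ht ⟨hθ.1.le, hθ.2.le⟩))

lemma continuousOn_radMean (hh : ContinuousOn h (Ico 0 1)) :
    ContinuousOn (radMean n h) (Ico 0 1) := by
  refine continuousOn_const.mul fun t ht => ?_
  -- `h` may be unbounded near `1`, so domination is arranged on `[0,R]` with `t < R < 1`.
  obtain ⟨R, htR, hR⟩ := exists_between ht.2
  have hsub : Icc 0 R ⊆ Ico (0 : ℝ) 1 := fun x hx => ⟨hx.1, hx.2.trans_lt hR⟩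
  obtain ⟨C, hC⟩ := isCompact_Icc.exists_bound_of_continuousOn (hh.mono hsub)
  have hev : ∀ᶠ x in 𝓝[Ico 0 1] t, x ∈ Icc 0 R :=
    mem_nhdsWithin.2 ⟨Iio R, isOpen_Iio, htR, fun x hx => ⟨hx.2.1, hx.1.le⟩⟩
  refine intervalIntegral.continuousWithinAt_of_dominated_interval (bound := fun _ => C)
    ?_ ?_ (by simp) ?_
  · filter_upwards [self_mem_nhdsWithin] with x hx
    rw [uIoc_of_le zero_le_one]
    exact (intervalIntegrable_radMean hh hx).aestronglyMeasurable
  · filter_upwards [hev] with x hx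
    refine ae_of_all _ fun θ hθ => ?_
    rw [uIoc_of_le zero_le_one] at hθ
    rw [norm_mul, norm_pow, Real.norm_of_nonneg hθ.1.le]
    have h1 := hC (x * θ) ⟨mul_nonneg hx.1 hθ.1.le,
      (mul_le_of_le_one_right hx.1 hθ.2).trans hx.2⟩
    exact (mul_le_of_le_one_left (norm_nonneg _) (pow_le_one₀ hθ.1.le hθ.2)).trans h1
  · refine ae_of_all _ fun θ hθ => ?_
    rw [uIoc_of_le zero_le_one] at hθ
    have hθ' : θ ∈ Icc (0 : ℝ) 1 := ⟨hθ.1.le, hθ.2⟩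
    have hc : ContinuousOn (fun x => h (x * θ)) (Ico 0 1) :=
      hh.comp (by fun_prop) fun x hx => mul_mem_Ico_of_mem_Icc hx hθ'
    exact continuousWithinAt_const.mul (hc t ht)

/-- Substitution `s = tθ`. This form can be differentiated in `t` and compared with `radEnergy`. -/
lemma radMean_mul_pow (ht : 0 < t) :
    t ^ (n + 1) * radMean n h t = ((n : ℝ) + 1) * ∫ s in (0 : ℝ)..t, s ^ n * h s := by
  have key := intervalIntegral.integral_comp_mul_left (a := 0) (b := 1)
    (fun s => s ^ n * h s) ht.ne'
  simp only [mul_zero, mul_one, smul_eq_mul] at key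
  have : ∫ θ in (0 : ℝ)..1, (t * θ) ^ n * h (t * θ)
      = t ^ n * ∫ θ in (0 : ℝ)..1, θ ^ n * h (t * θ) := by
    rw [← intervalIntegral.integral_const_mul]
    congr 1; ext θ; rw [mul_pow]; ring
  rw [this] at key
  have h2 : ∫ s in (0 : ℝ)..t, s ^ n * h s
      = t * (t ^ n * ∫ θ in (0 : ℝ)..1, θ ^ n * h (t * θ)) := by
    rw [key]; field_simp
  rw [h2, radMean]; ring

lemma hasDerivAt_radMean (hh : ContinuousOn h (Ico 0 1)) (ht : t ∈ Ioo (0 : ℝ) 1) :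
    HasDerivAt (radMean n h) (((n : ℝ) + 1) * (h t - radMean n h t) / t) t := by
  have ht0 : t ≠ 0 := ht.1.ne'
  have hJ := hasDerivAt_primitive_Ico (g := fun s => s ^ n * h s)
    ((continuousOn_pow n).mul hh) ht
  have hq := (hJ.const_mul ((n : ℝ) + 1)).div (hasDerivAt_pow (n + 1) t) (pow_ne_zero _ ht0)
  have he : radMean n h =ᶠ[𝓝 t]
      fun x => (((n : ℝ) + 1) * ∫ s in (0 : ℝ)..x, s ^ n * h s) / x ^ (n + 1) := by
    filter_upwards [lt_mem_nhds ht.1] with x hx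
    rw [← radMean_mul_pow hx]; field_simp
  refine (hq.congr_of_eventuallyEq he).congr_deriv ?_
  rw [← radMean_mul_pow ht.1]
  simp only [Nat.add_sub_cancel, Nat.cast_add, Nat.cast_one]
  field_simp
  ring

lemma radSlope_pos (hn : 1 ≤ n) (hh : ContinuousOn h (Ico 0 1))
    (hpos : ∀ s ∈ Ico (0 : ℝ) 1, 0 < h s) (ht : t ∈ Ico (0 : ℝ) 1) : 0 < radSlope n h t :=
  div_pos (Real.rpow_pos_of_pos (radMean_pos hh hpos ht) _) (by exact_mod_cast hn)

lemma radSlope_le_radSlope (h₀ : 0 ≤ radMean n h₁ t) (hle : radMean n h₁ t ≤ radMean n h₂ t) :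
    radSlope n h₁ t ≤ radSlope n h₂ t := by
  unfold radSlope
  gcongr

lemma continuousOn_radSlope (hh : ContinuousOn h (Ico 0 1)) :
    ContinuousOn (radSlope n h) (Ico 0 1) :=
  ((continuousOn_radMean hh).rpow_const fun _ _ => Or.inr (by positivity)).div_const _

lemma hasDerivAt_radSlope (hn : 1 ≤ n) (hh : ContinuousOn h (Ico 0 1))
    (hpos : ∀ s ∈ Ico (0 : ℝ) 1, 0 < h s) (ht : t ∈ Ioo (0 : ℝ) 1) :
    HasDerivAt (radSlope n h) (radSlopeDeriv n h t) t := by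
  have hX := radMean_pos (n := n) hh hpos ⟨ht.1.le, ht.2⟩
  have hn0 : (n : ℝ) ≠ 0 := by positivity
  have ht0 : t ≠ 0 := ht.1.ne'
  refine (((hasDerivAt_radMean hh ht).rpow_const (p := (n : ℝ) / (n + 1))
    (Or.inl hX.ne')).div_const (n : ℝ)).congr_deriv ?_
  rw [radSlopeDeriv]
  have : (n : ℝ) + 1 ≠ 0 := by positivity
  field_simp

lemma continuousOn_radSol_integrand (hh : ContinuousOn h (Ico 0 1)) :
    ContinuousOn (fun t => t * radSlope n h t) (Ico 0 1) :=
  continuousOn_id.mul (continuousOn_radSlope hh)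

lemma radSol_zero : radSol n k h 0 = k := by simp [radSol]

lemma continuousOn_radSol (hh : ContinuousOn h (Ico 0 1)) :
    ContinuousOn (radSol n k h) (Ico 0 1) :=
  continuousOn_const.add (continuousOn_primitive_Ico fun _ ht =>
    intervalIntegrable_of_continuousOn_Ico (continuousOn_radSol_integrand hh)
      ⟨le_rfl, one_pos⟩ ht)

lemma hasDerivAt_radSol (hh : ContinuousOn h (Ico 0 1)) (hr : r ∈ Ioo (0 : ℝ) 1) :
    HasDerivAt (radSol n k h) (r * radSlope n h r) r :=
  (hasDerivAt_primitive_Ico (continuousOn_radSol_integrand hh) hr).const_add k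

lemma radSol_mono (h₁c : ContinuousOn h₁ (Ico 0 1)) (h₂c : ContinuousOn h₂ (Ico 0 1))
    (hpos : ∀ s ∈ Ico (0 : ℝ) 1, 0 < h₁ s) (hle : ∀ s ∈ Ico (0 : ℝ) 1, h₁ s ≤ h₂ s)
    (hr : r ∈ Ico (0 : ℝ) 1) : radSol n k h₁ r ≤ radSol n k h₂ r := by
  have h0 : (0 : ℝ) ∈ Ico (0 : ℝ) 1 := ⟨le_rfl, one_pos⟩
  refine add_le_add_right (intervalIntegral.integral_mono_on hr.1
    (intervalIntegrable_of_continuousOn_Ico (continuousOn_radSol_integrand h₁c) h0 hr)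
    (intervalIntegrable_of_continuousOn_Ico (continuousOn_radSol_integrand h₂c) h0 hr)
    fun t ht => ?_) k
  have ht' : t ∈ Ico (0 : ℝ) 1 := ⟨ht.1, ht.2.trans_lt hr.2⟩
  exact mul_le_mul_of_nonneg_left (radSlope_le_radSlope (radMean_pos h₁c hpos ht').le
    (radMean_mono ht' (intervalIntegrable_radMean h₁c ht') (intervalIntegrable_radMean h₂c ht')
      fun s hs => hle s ⟨hs.1, hs.2.trans_lt ht'.2⟩)) ht.1

/-- In `u'' + (n-1) u'/r` the terms without `y = h` cancel, since `X^β = X^(β-1) X` with `β =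
n/(n+1)`; one product is left. -/
lemma radOp_algebra {X : ℝ} (hX : 0 < X) (y : ℝ) :
    X ^ ((n : ℝ) / (n + 1)) + X ^ ((n : ℝ) / (n + 1) - 1) * (y - X)
      = X ^ ((n : ℝ) / (n + 1) - 1) * y := by
  have : X ^ ((n : ℝ) / (n + 1) - 1) * X = X ^ ((n : ℝ) / (n + 1)) := by
    rw [← Real.rpow_add_one hX.ne']; ring_nf
  rw [← this]; ring

/-- `radSol` solves the radial equation. -/
lemma radialOp_radSol (hn : 1 ≤ n) (hh : ContinuousOn h (Ico 0 1))
    (hpos : ∀ s ∈ Ico (0 : ℝ) 1, 0 < h s) (hr : r ∈ Ioo (0 : ℝ) 1) :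
    radialOp (n + 1) (radSol n k h) r = h r := by
  have hX := radMean_pos (n := n) hh hpos ⟨hr.1.le, hr.2⟩
  have hr0 : r ≠ 0 := hr.1.ne'
  have hn0 : (n : ℝ) ≠ 0 := by positivity
  have hn1 : (n : ℝ) + 1 ≠ 0 := by positivity
  have d1 : deriv (radSol n k h) r = r * radSlope n h r := (hasDerivAt_radSol hh hr).deriv
  have d2 : deriv (deriv (radSol n k h)) r
      = radSlope n h r + r * radSlopeDeriv n h r := by
    have he : deriv (radSol n k h) =ᶠ[𝓝 r] fun t => t * radSlope n h t := by
      filter_upwards [Ioo_mem_nhds hr.1 hr.2] with t ht using (hasDerivAt_radSol hh ht).deriv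
    have := ((hasDerivAt_id' r).mul (hasDerivAt_radSlope hn hh hpos hr)).congr_of_eventuallyEq he
    rw [this.deriv, one_mul]
  rw [radialOp, d1, d2]
  have e1 : ((((n + 1 : ℕ) : ℝ) - 1) / r * (r * radSlope n h r))
      = radMean n h r ^ ((n : ℝ) / (n + 1)) := by
    rw [radSlope]; push_cast; field_simp; ring
  have e2 : radSlope n h r
        + r * radSlopeDeriv n h r
        + ((((n + 1 : ℕ) : ℝ) - 2) / r) * (r * radSlope n h r)
      = radMean n h r ^ ((n : ℝ) / (n + 1) - 1) * h r := by
    rw [← radOp_algebra hX (h r), radSlope, radSlopeDeriv]; push_cast; field_simp; ring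
  rw [e1, e2, ← Real.rpow_mul hX.le, ← mul_assoc, ← Real.rpow_add hX]
  -- With `β = n/(n+1)`, the first factor of the operator contributes the exponent `β/n` and the
  -- second `β - 1`. They cancel, so only `h r` survives.
  have e3 : (n : ℝ) / (n + 1) * (1 / (((n + 1 : ℕ) : ℝ) - 1)) + ((n : ℝ) / (n + 1) - 1) = 0 := by
    push_cast
    rw [add_sub_cancel_right]
    field_simp; ring
  rw [e3, Real.rpow_zero, one_mul]

end RadialMean

section Comparison

/-! ### Comparison of admissible functions with the integral form -/

variable {n : ℕ} {h w : ℝ → ℝ} {k r t : ℝ}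

lemma BlowUp.Admissible.continuousOn (hw : Admissible w) : ContinuousOn w (Ico 0 1) :=
  hw.1.continuousOn

lemma BlowUp.Admissible.contDiffOn_Ioo (hw : Admissible w) : ContDiffOn ℝ 2 w (Ioo 0 1) :=
  hw.1.mono Ioo_subset_Ico_self

lemma BlowUp.Admissible.hasDerivAt (hw : Admissible w) (hr : r ∈ Ioo (0 : ℝ) 1) :
    HasDerivAt w (deriv w r) r :=
  ((hw.contDiffOn_Ioo.differentiableOn (by norm_num) r hr).differentiableAt
    (isOpen_Ioo.mem_nhds hr)).hasDerivAt

lemma BlowUp.Admissible.hasDerivAt_deriv (hw : Admissible w) (hr : r ∈ Ioo (0 : ℝ) 1) :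
    HasDerivAt (deriv w) (deriv (deriv w) r) r := by
  have h1 : ContDiffOn ℝ (1 + 1) w (Ioo 0 1) := by
    rw [one_add_one_eq_two]; exact hw.contDiffOn_Ioo
  have h2 := ((contDiffOn_succ_iff_deriv_of_isOpen isOpen_Ioo).1 h1).2.2
  exact ((h2.differentiableOn (by norm_num) r hr).differentiableAt
    (isOpen_Ioo.mem_nhds hr)).hasDerivAt

lemma derivWithin_Ico_eq_deriv (hr : r ∈ Ioo (0 : ℝ) 1) :
    derivWithin w (Ico 0 1) r = deriv w r :=
  derivWithin_of_mem_nhds (Ico_mem_nhds hr.1 hr.2)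

/-- The quantity `(n r^(n-1) w'(r))^((n+1)/n)`, whose derivative is
`(n+1) rⁿ` times the radial operator (here `n = j + 1`). -/
noncomputable def radEnergy (j : ℕ) (w : ℝ → ℝ) (r : ℝ) : ℝ :=
  (((j : ℝ) + 1) * r ^ j * derivWithin w (Ico 0 1) r) ^ (((j : ℝ) + 2) / (j + 1))

lemma radEnergy_zero (j : ℕ) (hw : Admissible w) : radEnergy j w 0 = 0 := by
  rw [radEnergy, hw.2.1, mul_zero, Real.zero_rpow (by positivity)]

/-- Continuity up to `r = 0` is the reason for `derivWithin`: the two-sided derivative at `0` would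
involve values at negative arguments. -/
lemma continuousOn_radEnergy (j : ℕ) (hw : Admissible w) :
    ContinuousOn (radEnergy j w) (Ico 0 1) := by
  have := hw.1.continuousOn_derivWithin (uniqueDiffOn_Ico 0 1) (by norm_num)
  exact ContinuousOn.rpow_const (by fun_prop) fun _ _ => Or.inr (by positivity)

lemma hasDerivAt_radEnergy (j : ℕ) (hw : Admissible w) (hr : r ∈ Ioo (0 : ℝ) 1) :
    HasDerivAt (radEnergy j w) (((j : ℝ) + 2) * (r ^ (j + 1) * radialOp (j + 2) w r)) r := by
  have he : radEnergy j w =ᶠ[𝓝 r]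
      fun x => (((j : ℝ) + 1) * x ^ j * deriv w x) ^ (((j : ℝ) + 2) / (j + 1)) := by
    filter_upwards [Ioo_mem_nhds hr.1 hr.2] with x hx
    rw [radEnergy, derivWithin_Ico_eq_deriv hx]
  have hr0 : r ≠ 0 := hr.1.ne'
  have hj1 : (j : ℝ) + 1 ≠ 0 := by positivity
  -- The exponent `(j+2)/(j+1)` is at least `1`, so the power is differentiable even where `deriv w
  -- r = 0`.
  have hd := ((((hasDerivAt_pow j r).const_mul ((j : ℝ) + 1)).mul
    (hw.hasDerivAt_deriv hr)).rpow_const (p := ((j : ℝ) + 2) / (j + 1))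
    (Or.inr (by rw [le_div_iff₀ (by positivity)]; linarith)))
  refine (hd.congr_of_eventuallyEq he).congr_deriv ?_
  have hw' := hw.2.2.1 r hr
  have hr1 := hr.1
  have e1 : ((j : ℝ) + 2) / (j + 1) - 1 = 1 / (j + 1) := by field_simp; ring
  have e2 : ((j : ℝ) + 1) * r ^ j * deriv w r
      = r ^ (j + 1) * (((j : ℝ) + 1) / r * deriv w r) := by
    field_simp; ring
  have e3 : (r ^ (j + 1)) ^ (1 / ((j : ℝ) + 1)) = r := by
    rw [← Real.rpow_natCast, ← Real.rpow_mul hr.1.le]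
    push_cast
    rw [mul_one_div_cancel hj1, Real.rpow_one]
  -- For `j = 0` the truncated exponent `j - 1` is harmless because of the factor `j`.
  have e4 : (j : ℝ) * r ^ (j - 1) = j * r ^ j / r := by
    rcases j with _ | j
    · simp
    · simp only [Nat.add_sub_cancel]; field_simp; ring
  simp only [Pi.mul_apply]
  rw [e1, e2, Real.mul_rpow (by positivity) (by positivity), e3,
    radialOp, e4]
  have e5 : (((j + 2 : ℕ) : ℝ) - 1) = j + 1 := by push_cast; ring
  have e6 : (((j + 2 : ℕ) : ℝ) - 2) = j := by push_cast; ring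
  rw [e5, e6]
  field_simp
  ring

lemma radEnergy_sub_primitive_hasDerivAt (j : ℕ) (hw : Admissible w)
    (hh : ContinuousOn h (Ico 0 1)) (hr : r ∈ Ioo (0 : ℝ) 1) :
    HasDerivAt (fun x => radEnergy j w x - ((j : ℝ) + 2) * ∫ s in (0 : ℝ)..x, s ^ (j + 1) * h s)
      (((j : ℝ) + 2) * (r ^ (j + 1) * (radialOp (j + 2) w r - h r))) r :=
  ((hasDerivAt_radEnergy j hw hr).sub ((hasDerivAt_primitive_Ico
    (g := fun s => s ^ (j + 1) * h s) ((continuousOn_pow _).mul hh) hr).const_mul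
      ((j : ℝ) + 2))).congr_deriv (by ring)

lemma radEnergy_sub_primitive_continuousOn (j : ℕ) (hw : Admissible w)
    (hh : ContinuousOn h (Ico 0 1)) : ContinuousOn
      (fun x => radEnergy j w x - ((j : ℝ) + 2) * ∫ s in (0 : ℝ)..x, s ^ (j + 1) * h s)
      (Ico 0 1) :=
  (continuousOn_radEnergy j hw).sub (continuousOn_const.mul
    (continuousOn_primitive_Ico fun _ ht => intervalIntegrable_of_continuousOn_Ico
      ((continuousOn_pow _).mul hh) ⟨le_rfl, one_pos⟩ ht))

/-- The energy minus the primitive of `(j+2) s^(j+1) h` vanishes at `0`, and its derivative has the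
sign of `radialOp w - h`. -/
lemma radEnergy_le (j : ℕ) (hw : Admissible w) (hh : ContinuousOn h (Ico 0 1))
    (hle : ∀ s ∈ Ioo (0 : ℝ) 1, radialOp (j + 2) w s ≤ h s) (hr : r ∈ Ioo (0 : ℝ) 1) :
    radEnergy j w r ≤ r ^ (j + 2) * radMean (j + 1) h r := by
  have hanti := antitoneOn_of_deriv_nonpos (convex_Ico 0 1)
    (radEnergy_sub_primitive_continuousOn j hw hh)
    (fun x hx => (radEnergy_sub_primitive_hasDerivAt j hw hh
      (by rwa [interior_Ico] at hx)).differentiableAt.differentiableWithinAt)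
    (fun x hx => by
      rw [interior_Ico] at hx
      rw [(radEnergy_sub_primitive_hasDerivAt j hw hh hx).deriv]
      exact mul_nonpos_of_nonneg_of_nonpos (by positivity)
        (mul_nonpos_of_nonneg_of_nonpos (pow_nonneg hx.1.le _) (sub_nonpos.2 (hle x hx))))
  have := hanti ⟨le_rfl, one_pos⟩ ⟨hr.1.le, hr.2⟩ hr.1.le
  simp only [radEnergy_zero j hw, intervalIntegral.integral_same, mul_zero, sub_zero] at this
  rw [radMean_mul_pow hr.1]
  push_cast
  rw [add_assoc, one_add_one_eq_two]
  linarith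

lemma le_radEnergy (j : ℕ) (hw : Admissible w) (hh : ContinuousOn h (Ico 0 1))
    (hle : ∀ s ∈ Ioo (0 : ℝ) 1, h s ≤ radialOp (j + 2) w s) (hr : r ∈ Ioo (0 : ℝ) 1) :
    r ^ (j + 2) * radMean (j + 1) h r ≤ radEnergy j w r := by
  have hmono := monotoneOn_of_deriv_nonneg (convex_Ico 0 1)
    (radEnergy_sub_primitive_continuousOn j hw hh)
    (fun x hx => (radEnergy_sub_primitive_hasDerivAt j hw hh
      (by rwa [interior_Ico] at hx)).differentiableAt.differentiableWithinAt)
    (fun x hx => by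
      rw [interior_Ico] at hx
      rw [(radEnergy_sub_primitive_hasDerivAt j hw hh hx).deriv]
      exact mul_nonneg (by positivity)
        (mul_nonneg (pow_nonneg hx.1.le _) (sub_nonneg.2 (hle x hx))))
  have := hmono ⟨le_rfl, one_pos⟩ ⟨hr.1.le, hr.2⟩ hr.1.le
  simp only [radEnergy_zero j hw, intervalIntegral.integral_same, mul_zero, sub_zero] at this
  rw [radMean_mul_pow hr.1]
  push_cast
  rw [add_assoc, one_add_one_eq_two]
  linarith

lemma radEnergy_rpow (j : ℕ) (hw : Admissible w) (hr : r ∈ Ioo (0 : ℝ) 1) :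
    radEnergy j w r ^ (((j : ℝ) + 1) / (j + 2)) = ((j : ℝ) + 1) * r ^ j * deriv w r := by
  have hw' := hw.2.2.1 r hr
  have := hr.1
  rw [radEnergy, derivWithin_Ico_eq_deriv hr, ← Real.rpow_mul (by positivity),
    show ((j : ℝ) + 2) / (j + 1) * ((j + 1) / (j + 2)) = 1 by field_simp, Real.rpow_one]

/-- Undoes the power in `radEnergy` on the side of the mean; together with `radEnergy_rpow` it turns
energy inequalities into inequalities for `w'`. -/
lemma pow_mul_radMean_rpow (j : ℕ) (hr : 0 < r) (hX : 0 ≤ radMean (j + 1) h r) :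
    (r ^ (j + 2) * radMean (j + 1) h r) ^ (((j : ℝ) + 1) / (j + 2))
      = ((j : ℝ) + 1) * r ^ j * (r * radSlope (j + 1) h r) := by
  rw [Real.mul_rpow (by positivity) hX, ← Real.rpow_natCast, ← Real.rpow_mul hr.le, radSlope]
  push_cast
  rw [show ((j : ℝ) + 2) * ((j + 1) / (j + 2)) = ((j + 1 : ℕ) : ℝ) by push_cast; field_simp,
    Real.rpow_natCast, add_assoc, one_add_one_eq_two]
  field_simp; ring

lemma deriv_le_mul_radSlope (j : ℕ) (hw : Admissible w) (hh : ContinuousOn h (Ico 0 1))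
    (hpos : ∀ s ∈ Ico (0 : ℝ) 1, 0 < h s)
    (hle : ∀ s ∈ Ioo (0 : ℝ) 1, radialOp (j + 2) w s ≤ h s) (hr : r ∈ Ioo (0 : ℝ) 1) :
    deriv w r ≤ r * radSlope (j + 1) h r := by
  have hX := radMean_pos (n := j + 1) hh hpos ⟨hr.1.le, hr.2⟩
  have hw' := hw.2.2.1 r hr
  have hr0 := hr.1
  have hE : 0 ≤ radEnergy j w r := by
    rw [radEnergy, derivWithin_Ico_eq_deriv hr]; positivity
  have := Real.rpow_le_rpow hE (radEnergy_le j hw hh hle hr)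
    (z := ((j : ℝ) + 1) / (j + 2)) (by positivity)
  rw [radEnergy_rpow j hw hr, pow_mul_radMean_rpow j hr.1 hX.le] at this
  exact le_of_mul_le_mul_left this (by positivity)

lemma mul_radSlope_le_deriv (j : ℕ) (hw : Admissible w) (hh : ContinuousOn h (Ico 0 1))
    (hpos : ∀ s ∈ Ico (0 : ℝ) 1, 0 < h s)
    (hle : ∀ s ∈ Ioo (0 : ℝ) 1, h s ≤ radialOp (j + 2) w s) (hr : r ∈ Ioo (0 : ℝ) 1) :
    r * radSlope (j + 1) h r ≤ deriv w r := by
  have hX := radMean_pos (n := j + 1) hh hpos ⟨hr.1.le, hr.2⟩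
  have hr0 := hr.1
  have := Real.rpow_le_rpow (by positivity) (le_radEnergy j hw hh hle hr)
    (z := ((j : ℝ) + 1) / (j + 2)) (by positivity)
  rw [radEnergy_rpow j hw hr, pow_mul_radMean_rpow j hr.1 hX.le] at this
  exact le_of_mul_le_mul_left this (by positivity)

lemma hasDerivAt_sub_radSol (hw : Admissible w) (hh : ContinuousOn h (Ico 0 1))
    (hr : r ∈ Ioo (0 : ℝ) 1) :
    HasDerivAt (fun x => w x - radSol n k h x) (deriv w r - r * radSlope n h r) r :=
  (hw.hasDerivAt hr).sub (hasDerivAt_radSol hh hr)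

/-- The inequality between the derivatives is integrated from `0`, where both sides equal `w 0`.
Used together with `radSol_le`, it shows that a solution of the differential equation is the
`radSol` of its own source. -/
lemma le_radSol (hn : 1 ≤ n) (hw : Admissible w) (hh : ContinuousOn h (Ico 0 1))
    (hpos : ∀ s ∈ Ico (0 : ℝ) 1, 0 < h s)
    (hle : ∀ s ∈ Ioo (0 : ℝ) 1, radialOp (n + 1) w s ≤ h s) (hr : r ∈ Ico (0 : ℝ) 1) :
    w r ≤ radSol n (w 0) h r := by
  obtain ⟨j, rfl⟩ : ∃ j, n = j + 1 := ⟨n - 1, by omega⟩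
  have hanti := antitoneOn_of_deriv_nonpos (convex_Ico 0 1)
    (hw.continuousOn.sub (continuousOn_radSol (n := j + 1) (k := w 0) hh))
    (fun x hx => (hasDerivAt_sub_radSol hw hh
      (by rwa [interior_Ico] at hx)).differentiableAt.differentiableWithinAt)
    (fun x hx => by
      rw [interior_Ico] at hx
      refine (hasDerivAt_sub_radSol hw hh hx).deriv.trans_le ?_
      exact sub_nonpos.2 (deriv_le_mul_radSlope j hw hh hpos hle hx))
  have := hanti ⟨le_rfl, one_pos⟩ hr hr.1
  simp only [Pi.sub_apply, radSol_zero, sub_self] at this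
  linarith

lemma radSol_le (hn : 1 ≤ n) (hw : Admissible w) (hh : ContinuousOn h (Ico 0 1))
    (hpos : ∀ s ∈ Ico (0 : ℝ) 1, 0 < h s)
    (hle : ∀ s ∈ Ioo (0 : ℝ) 1, h s ≤ radialOp (n + 1) w s) (hr : r ∈ Ico (0 : ℝ) 1) :
    radSol n (w 0) h r ≤ w r := by
  obtain ⟨j, rfl⟩ : ∃ j, n = j + 1 := ⟨n - 1, by omega⟩
  have hmono := monotoneOn_of_deriv_nonneg (convex_Ico 0 1)
    (hw.continuousOn.sub (continuousOn_radSol (n := j + 1) (k := w 0) hh))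
    (fun x hx => (hasDerivAt_sub_radSol hw hh
      (by rwa [interior_Ico] at hx)).differentiableAt.differentiableWithinAt)
    (fun x hx => by
      rw [interior_Ico] at hx
      refine le_of_le_of_eq ?_ (hasDerivAt_sub_radSol hw hh hx).deriv.symm
      exact sub_nonneg.2 (mul_radSlope_le_deriv j hw hh hpos hle hx))
  have := hmono ⟨le_rfl, one_pos⟩ hr hr.1
  simp only [Pi.sub_apply, radSol_zero, sub_self] at this
  linarith

end Comparison

section FixedPoint

/-! ### Existence and uniqueness for the integral equation -/

variable {n : ℕ} {K f u v w w₁ w₂ : ℝ → ℝ} {k r t : ℝ}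

lemma BlowUp.CondF1.continuousOn (hf : CondF1 f) : ContinuousOn f (Ioi 0) :=
  hf.2.2.continuousOn

lemma continuousOn_source (hK : CondK K) (hf : CondF1 f) (hu : ContinuousOn u (Ico 0 1))
    (hpos : ∀ s ∈ Ico (0 : ℝ) 1, 0 < u s) : ContinuousOn (fun s => K s * f (u s)) (Ico 0 1) :=
  hK.1.mul (hf.continuousOn.comp hu hpos)

lemma source_pos (hK : CondK K) (hf : CondF1 f) (hpos : ∀ s ∈ Ico (0 : ℝ) 1, 0 < u s) :
    ∀ s ∈ Ico (0 : ℝ) 1, 0 < K s * f (u s) :=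
  fun s hs => mul_pos (hK.2 s hs) (hf.1 _ (hpos s hs))

lemma source_mono (hK : CondK K) (hf : CondF1 f) {s : ℝ} (hs : s ∈ Ico (0 : ℝ) 1)
    (hpos : 0 < u s) (hle : u s ≤ v s) : K s * f (u s) ≤ K s * f (v s) :=
  mul_le_mul_of_nonneg_left (hf.2.1 hpos (hpos.trans_le hle) hle) (hK.2 s hs).le

lemma radSol_add_const (n : ℕ) (k k' : ℝ) (h : ℝ → ℝ) (r : ℝ) :
    radSol n k h r = k - k' + radSol n k' h r := by
  simp only [radSol]; ring

/-- The integral operator is continuous along dominated pointwise limits. -/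
lemma tendsto_radMean_source (hK : CondK K) (hf : CondF1 f) {U : ℕ → ℝ → ℝ}
    (hUc : ∀ j, ContinuousOn (U j) (Ico 0 1)) (hUpos : ∀ j, ∀ s ∈ Ico (0 : ℝ) 1, 0 < U j s)
    (hw : ContinuousOn w (Ico 0 1)) (hUw : ∀ j, ∀ s ∈ Ico (0 : ℝ) 1, U j s ≤ w s)
    (hupos : ∀ s ∈ Ico (0 : ℝ) 1, 0 < u s)
    (hlim : ∀ s ∈ Ico (0 : ℝ) 1, Tendsto (fun j => U j s) atTop (𝓝 (u s)))
    (ht : t ∈ Ico (0 : ℝ) 1) :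
    Tendsto (fun j => radMean n (fun s => K s * f (U j s)) t) atTop
      (𝓝 (radMean n (fun s => K s * f (u s)) t)) := by
  have hwpos : ∀ s ∈ Ico (0 : ℝ) 1, 0 < w s := fun s hs => (hUpos 0 s hs).trans_le (hUw 0 s hs)
  refine Tendsto.const_mul _ (intervalIntegral.tendsto_integral_filter_of_dominated_convergence
    (fun θ => θ ^ n * (K (t * θ) * f (w (t * θ)))) ?_ ?_
    (intervalIntegrable_radMean (continuousOn_source hK hf hw hwpos) ht) ?_)
  · refine Eventually.of_forall fun j => ?_
    rw [uIoc_of_le zero_le_one]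
    exact (intervalIntegrable_radMean (continuousOn_source hK hf (hUc j) (hUpos j))
      ht).aestronglyMeasurable
  · refine Eventually.of_forall fun j => ae_of_all _ fun θ hθ => ?_
    rw [uIoc_of_le zero_le_one] at hθ
    have hm := mul_mem_Ico_of_mem_Icc ht ⟨hθ.1.le, hθ.2⟩
    have h1 := source_pos hK hf (hUpos j) _ hm
    have h2 := source_mono hK hf hm (hUpos j _ hm) (hUw j _ hm)
    have h3 := hθ.1
    rw [Real.norm_of_nonneg (by positivity)]
    gcongr
  · refine ae_of_all _ fun θ hθ => ?_
    rw [uIoc_of_le zero_le_one] at hθ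
    have hm := mul_mem_Ico_of_mem_Icc ht ⟨hθ.1.le, hθ.2⟩
    have hfc : ContinuousAt f (u (t * θ)) :=
      hf.continuousOn.continuousAt (Ioi_mem_nhds (hupos _ hm))
    exact ((hfc.tendsto.comp (hlim _ hm)).const_mul _).const_mul _

/-- Monotone iteration between a sub- and a super-solution. -/
lemma exists_fixedPoint (hn : 1 ≤ n) (hK : CondK K) (hf : CondF1 f)
    (h₁ : IsSub (n + 1) K f w₁) (h₂ : IsSuper (n + 1) K f w₂)
    (h₁₂ : ∀ s ∈ Ico (0 : ℝ) 1, w₁ s ≤ w₂ s) (hk : k ∈ Ioo (w₁ 0) (w₂ 0)) :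
    ∃ u : ℝ → ℝ, ContinuousOn u (Ico 0 1) ∧ (∀ s ∈ Ico (0 : ℝ) 1, w₁ s ≤ u s ∧ u s ≤ w₂ s) ∧
      ∀ r ∈ Ico (0 : ℝ) 1, u r = radSol n k (fun s => K s * f (u s)) r := by
  have hw₁c := h₁.1.continuousOn
  have hw₂c := h₂.1.continuousOn
  have hw₁p := h₁.1.2.2.2
  have hw₂p := h₂.1.2.2.2
  have hs₂c := continuousOn_source hK hf hw₂c hw₂p
  have hs₂p := source_pos hK hf hw₂p
  have h0 : (0 : ℝ) ∈ Ico (0 : ℝ) 1 := ⟨le_rfl, one_pos⟩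
  set T : (ℝ → ℝ) → ℝ → ℝ := fun u => radSol n k (fun s => K s * f (u s)) with hT
  have hTmono : ∀ u v : ℝ → ℝ, ContinuousOn u (Ico 0 1) → ContinuousOn v (Ico 0 1) →
      (∀ s ∈ Ico (0 : ℝ) 1, 0 < u s) → (∀ s ∈ Ico (0 : ℝ) 1, u s ≤ v s) →
      ∀ s ∈ Ico (0 : ℝ) 1, T u s ≤ T v s := by
    intro u v hu hv hp hle s hs
    exact radSol_mono (continuousOn_source hK hf hu hp)
      (continuousOn_source hK hf hv fun s hs => (hp s hs).trans_le (hle s hs))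
      (source_pos hK hf hp) (fun s hs => source_mono hK hf hs (hp s hs) (hle s hs)) hs
  -- Raising the initial value from `w₁ 0` to `k` only adds a positive constant; for `w₂` the
  -- constant is negative.
  have hT₁ : ∀ s ∈ Ico (0 : ℝ) 1, w₁ s ≤ T w₁ s := by
    intro s hs
    have := le_radSol hn h₁.1 (continuousOn_source hK hf hw₁c hw₁p) (source_pos hK hf hw₁p)
      h₁.2 hs
    simp only [hT]
    rw [radSol_add_const n k (w₁ 0)]
    linarith [hk.1]
  have hT₂ : ∀ s ∈ Ico (0 : ℝ) 1, T w₂ s ≤ w₂ s := by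
    intro s hs
    have := radSol_le hn h₂.1 hs₂c hs₂p h₂.2 hs
    simp only [hT]
    rw [radSol_add_const n k (w₂ 0)]
    linarith [hk.2]
  set U : ℕ → ℝ → ℝ := fun j => T^[j] w₁ with hU
  have hUs : ∀ j, U (j + 1) = T (U j) := fun j => Function.iterate_succ_apply' T j w₁
  have hinv : ∀ j, ContinuousOn (U j) (Ico 0 1) ∧ (∀ s ∈ Ico (0 : ℝ) 1, w₁ s ≤ U j s) ∧
      (∀ s ∈ Ico (0 : ℝ) 1, U j s ≤ w₂ s) ∧ ∀ s ∈ Ico (0 : ℝ) 1, U j s ≤ U (j + 1) s := by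
    intro j
    induction j with
    | zero => exact ⟨hw₁c, fun s _ => le_rfl, h₁₂, hT₁⟩
    | succ j ih =>
      obtain ⟨hc, hl, hu, hm⟩ := ih
      have hp : ∀ s ∈ Ico (0 : ℝ) 1, 0 < U j s := fun s hs => (hw₁p s hs).trans_le (hl s hs)
      have hc' : ContinuousOn (U (j + 1)) (Ico 0 1) := by
        rw [hUs]; exact continuousOn_radSol (continuousOn_source hK hf hc hp)
      refine ⟨hc', fun s hs => (hl s hs).trans (hm s hs), fun s hs => ?_, fun s hs => ?_⟩
      · rw [hUs]; exact (hTmono _ _ hc hw₂c hp hu s hs).trans (hT₂ s hs)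
      · have := hTmono _ _ hc hc' hp hm s hs
        rwa [← hUs, ← hUs] at this
  have hUp : ∀ j, ∀ s ∈ Ico (0 : ℝ) 1, 0 < U j s :=
    fun j s hs => (hw₁p s hs).trans_le ((hinv j).2.1 s hs)
  -- The iterates increase and stay below `w₂`, so they converge pointwise. The integrals pass to
  -- the limit with the integrand of `T w₂` as dominating function.
  set u : ℝ → ℝ := fun s => ⨆ j, U j s with hu
  have hlim : ∀ s ∈ Ico (0 : ℝ) 1, Tendsto (fun j => U j s) atTop (𝓝 (u s)) := fun s hs =>
    tendsto_atTop_ciSup (monotone_nat_of_le_succ fun j => (hinv j).2.2.2 s hs)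
      ⟨w₂ s, by rintro _ ⟨j, rfl⟩; exact (hinv j).2.2.1 s hs⟩
  have hul : ∀ s ∈ Ico (0 : ℝ) 1, w₁ s ≤ u s :=
    fun s hs => ge_of_tendsto' (hlim s hs) fun j => (hinv j).2.1 s hs
  have huu : ∀ s ∈ Ico (0 : ℝ) 1, u s ≤ w₂ s :=
    fun s hs => le_of_tendsto' (hlim s hs) fun j => (hinv j).2.2.1 s hs
  have hup : ∀ s ∈ Ico (0 : ℝ) 1, 0 < u s := fun s hs => (hw₁p s hs).trans_le (hul s hs)
  have hmean : ∀ s ∈ Ico (0 : ℝ) 1, Tendsto (fun j => radMean n (fun s => K s * f (U j s)) s)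
      atTop (𝓝 (radMean n (fun s => K s * f (u s)) s)) := fun s hs =>
    tendsto_radMean_source hK hf (fun j => (hinv j).1) hUp hw₂c (fun j => (hinv j).2.2.1)
      hup hlim hs
  have hint : ∀ s ∈ Ico (0 : ℝ) 1, Tendsto (fun j => s * radSlope n (fun s => K s * f (U j s)) s)
      atTop (𝓝 (s * radSlope n (fun s => K s * f (u s)) s)) := fun s hs =>
    (((hmean s hs).rpow_const (Or.inr (by positivity))).div_const _).const_mul _
  have hUsc : ∀ j, ContinuousOn (fun s => K s * f (U j s)) (Ico 0 1) :=
    fun j => continuousOn_source hK hf (hinv j).1 (hUp j)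
  have hbound : ∀ j, ∀ s ∈ Ico (0 : ℝ) 1, ‖s * radSlope n (fun s => K s * f (U j s)) s‖
      ≤ s * radSlope n (fun s => K s * f (w₂ s)) s := by
    intro j s hs
    have hp := radMean_pos (n := n) (hUsc j) (source_pos hK hf (hUp j)) hs
    have hp' := radSlope_pos hn (hUsc j) (source_pos hK hf (hUp j)) hs
    rw [Real.norm_of_nonneg (mul_nonneg hs.1 hp'.le)]
    exact mul_le_mul_of_nonneg_left (radSlope_le_radSlope hp.le (radMean_mono hs
      (intervalIntegrable_radMean (hUsc j) hs) (intervalIntegrable_radMean hs₂c hs)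
      fun x hx => source_mono hK hf ⟨hx.1, hx.2.trans_lt hs.2⟩
        (hUp j _ ⟨hx.1, hx.2.trans_lt hs.2⟩)
        ((hinv j).2.2.1 _ ⟨hx.1, hx.2.trans_lt hs.2⟩))) hs.1
  have hbi : ∀ r ∈ Ico (0 : ℝ) 1, IntervalIntegrable
      (fun s => s * radSlope n (fun s => K s * f (w₂ s)) s) volume 0 r := fun r hr =>
    intervalIntegrable_of_continuousOn_Ico (continuousOn_radSol_integrand hs₂c) h0 hr
  have hUm : ∀ r ∈ Ico (0 : ℝ) 1, ∀ j, AEStronglyMeasurable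
      (fun s => s * radSlope n (fun s => K s * f (U j s)) s) (volume.restrict (uIoc 0 r)) := by
    intro r hr j
    rw [uIoc_of_le hr.1]
    exact (intervalIntegrable_of_continuousOn_Ico
      (continuousOn_radSol_integrand (hUsc j)) h0 hr).aestronglyMeasurable
  have hmem : ∀ r ∈ Ico (0 : ℝ) 1, ∀ s ∈ uIoc 0 r, s ∈ Ico (0 : ℝ) 1 := by
    intro r hr s hs
    rw [uIoc_of_le hr.1] at hs
    exact ⟨hs.1.le, hs.2.trans_lt hr.2⟩
  have hfix : ∀ r ∈ Ico (0 : ℝ) 1, u r = T u r := by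
    intro r hr
    have hl : Tendsto (fun j => T (U j) r) atTop (𝓝 (T u r)) :=
      tendsto_const_nhds.add (intervalIntegral.tendsto_integral_filter_of_dominated_convergence
        _ (Eventually.of_forall (hUm r hr))
        (Eventually.of_forall fun j => ae_of_all _ fun s hs => hbound j s (hmem r hr s hs))
        (hbi r hr) (ae_of_all _ fun s hs => hint s (hmem r hr s hs)))
    have hl' : Tendsto (fun j => U (j + 1) r) atTop (𝓝 (u r)) :=
      (hlim r hr).comp (tendsto_add_atTop_nat 1)
    simp only [hUs] at hl'
    exact tendsto_nhds_unique hl' hl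
  refine ⟨u, ?_, fun s hs => ⟨hul s hs, huu s hs⟩, hfix⟩
  -- As a supremum, `u` need not be continuous; continuity is read off the fixed point equation,
  -- since `T u` is a primitive of a dominated measurable function.
  have hTc : ContinuousOn (T u) (Ico 0 1) := by
    refine continuousOn_const.add (continuousOn_primitive_Ico fun r hr => ?_)
    refine (hbi r hr).mono_fun' (aestronglyMeasurable_of_tendsto_ae atTop (hUm r hr) ?_) ?_
    · filter_upwards [ae_restrict_mem measurableSet_uIoc] with s hs
      exact hint s (hmem r hr s hs)
    · filter_upwards [ae_restrict_mem measurableSet_uIoc] with s hs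
      exact le_of_tendsto' (hint s (hmem r hr s hs)).norm
        fun j => hbound j s (hmem r hr s hs)
  exact hTc.congr hfix

/-- The mean value inequality away from zero: the derivative of `z^β`, with `β ≤ 1`, is largest at
the left end `c`. -/
lemma abs_rpow_sub_rpow_le {c β x y : ℝ} (hc : 0 < c) (hβ : 0 ≤ β) (hβ1 : β ≤ 1)
    (hx : c ≤ x) (hy : c ≤ y) : |x ^ β - y ^ β| ≤ β * c ^ (β - 1) * |x - y| := by
  have hpos : ∀ z ∈ Ici c, z ≠ 0 := fun z hz => (hc.trans_le hz).ne'
  have := (convex_Ici c).norm_image_sub_le_of_norm_deriv_le (f := fun z : ℝ => z ^ β)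
    (C := β * c ^ (β - 1)) (x := y) (y := x)
    (fun z hz => (Real.differentiableAt_rpow_const_of_ne β (hpos z hz)))
    (fun z hz => by
      rw [Real.deriv_rpow_const, Real.norm_eq_abs,
        abs_of_nonneg (mul_nonneg hβ (Real.rpow_nonneg (hc.le.trans hz) _))]
      exact mul_le_mul_of_nonneg_left
        (Real.rpow_le_rpow_of_nonpos hc hz (by linarith)) hβ) hy hx
  simpa [Real.norm_eq_abs] using this

lemma radMean_const (n : ℕ) (c t : ℝ) : radMean n (fun _ => c) t = c := by
  have : ((n : ℝ) + 1) ≠ 0 := by positivity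
  simp [radMean]
  field_simp

lemma abs_radMean_sub_le {h₁ h₂ : ℝ → ℝ} {C : ℝ} (h₁c : ContinuousOn h₁ (Ico 0 1))
    (h₂c : ContinuousOn h₂ (Ico 0 1)) (ht : t ∈ Ico (0 : ℝ) 1)
    (hle : ∀ s ∈ Icc (0 : ℝ) t, |h₁ s - h₂ s| ≤ C) :
    |radMean n h₁ t - radMean n h₂ t| ≤ C := by
  have key : ∀ g₁ g₂ : ℝ → ℝ, ContinuousOn g₁ (Ico 0 1) → ContinuousOn g₂ (Ico 0 1) →
      (∀ s ∈ Icc (0 : ℝ) t, g₁ s ≤ g₂ s + C) → radMean n g₁ t ≤ radMean n g₂ t + C := by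
    intro g₁ g₂ c₁ c₂ hle
    have h := radMean_mono (n := n) (h₁ := g₁) (h₂ := fun s => g₂ s + C) ht
      (intervalIntegrable_radMean c₁ ht)
      (intervalIntegrable_radMean (c₂.add continuousOn_const) ht) hle
    have hadd : radMean n (fun s => g₂ s + C) t = radMean n g₂ t + C := by
      conv_rhs => rw [← radMean_const n C t]
      rw [radMean, radMean, radMean, ← mul_add, ← intervalIntegral.integral_add
        (intervalIntegrable_radMean c₂ ht)
        (intervalIntegrable_radMean (h := fun _ => C) continuousOn_const ht)]
      simp only [mul_add]
    rwa [hadd] at h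
  rw [abs_sub_le_iff]
  constructor
  · linarith [key h₁ h₂ h₁c h₂c fun s hs => by linarith [(abs_sub_le_iff.1 (hle s hs)).1]]
  · linarith [key h₂ h₁ h₂c h₁c fun s hs => by linarith [(abs_sub_le_iff.1 (hle s hs)).2]]

/-- Uniqueness for the integral equation. -/
lemma fixedPoint_unique (hn : 1 ≤ n) (hK : CondK K) (hf : CondF1 f)
    (hu : ContinuousOn u (Ico 0 1)) (hv : ContinuousOn v (Ico 0 1))
    (hup : ∀ s ∈ Ico (0 : ℝ) 1, 0 < u s) (hvp : ∀ s ∈ Ico (0 : ℝ) 1, 0 < v s)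
    (hue : ∀ r ∈ Ico (0 : ℝ) 1, u r = radSol n k (fun s => K s * f (u s)) r)
    (hve : ∀ r ∈ Ico (0 : ℝ) 1, v r = radSol n k (fun s => K s * f (v s)) r) :
    EqOn u v (Ico 0 1) := by
  intro R hR
  have h0 : (0 : ℝ) ∈ Ico (0 : ℝ) 1 := ⟨le_rfl, one_pos⟩
  have hsub : Icc 0 R ⊆ Ico (0 : ℝ) 1 := fun x hx => ⟨hx.1, hx.2.trans_lt hR.2⟩
  have hne : (Icc 0 R).Nonempty := ⟨0, le_rfl, hR.1⟩
  have huc := continuousOn_source hK hf hu hup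
  have hvc := continuousOn_source hK hf hv hvp
  obtain ⟨Λ, hΛ⟩ := LocallyLipschitzOn.exists_lipschitzOnWith_of_compact
    (s := u '' Icc 0 R ∪ v '' Icc 0 R) (f := f)
    ((isCompact_Icc.image_of_continuousOn (hu.mono hsub)).union
      (isCompact_Icc.image_of_continuousOn (hv.mono hsub)))
    (hf.2.2.mono (union_subset (by rintro _ ⟨x, hx, rfl⟩; exact hup x (hsub hx))
      (by rintro _ ⟨x, hx, rfl⟩; exact hvp x (hsub hx))))
  obtain ⟨B, hB⟩ := isCompact_Icc.exists_bound_of_continuousOn (hK.1.mono hsub)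
  have hB0 : 0 ≤ B := (norm_nonneg _).trans (hB 0 ⟨le_rfl, hR.1⟩)
  obtain ⟨x₁, hx₁, hm₁⟩ := isCompact_Icc.exists_isMinOn hne (huc.mono hsub)
  obtain ⟨x₂, hx₂, hm₂⟩ := isCompact_Icc.exists_isMinOn hne (hvc.mono hsub)
  -- A positive lower bound of both sources on `[0,R]`, hence of both means; there the power `β < 1`
  -- is Lipschitz.
  set c₀ := min (K x₁ * f (u x₁)) (K x₂ * f (v x₂)) with hc₀
  have hc₀p : 0 < c₀ := lt_min (source_pos hK hf hup _ (hsub hx₁))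
    (source_pos hK hf hvp _ (hsub hx₂))
  set β : ℝ := (n : ℝ) / (n + 1) with hβ
  -- `C - 1` is the Lipschitz constant of the passage from the solution to its slope; the added `1`
  -- makes `C` positive.
  set C : ℝ := β * c₀ ^ (β - 1) * (B * Λ) / n + 1 with hC
  have hβ0 : 0 ≤ β := by positivity
  have hβ1 : β ≤ 1 := by rw [hβ, div_le_one (by positivity)]; linarith
  have hCp : 0 < C := by positivity
  -- The distance of `u` and `v` is measured in the sup norm with weight `exp(-2Cs)`. Integrating `C
  -- exp(2Ct)` gains a factor `1/2`, so the integral operator is a contraction and `D ≤ D/2`.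
  obtain ⟨x, hx, hmax⟩ := isCompact_Icc.exists_isMaxOn hne
    (f := fun s => |u s - v s| * Real.exp (-(2 * C) * s))
    (((hu.mono hsub).sub (hv.mono hsub)).abs.mul (by fun_prop))
  set D := |u x - v x| * Real.exp (-(2 * C) * x) with hD
  have hD0 : 0 ≤ D := by positivity
  have hdiff : ∀ s ∈ Icc 0 R, |u s - v s| ≤ D * Real.exp (2 * C * s) := by
    intro s hs
    have : |u s - v s| * Real.exp (-(2 * C) * s) ≤ D := hmax hs
    calc |u s - v s| = |u s - v s| * Real.exp (-(2 * C) * s) * Real.exp (2 * C * s) := by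
          rw [mul_assoc, ← Real.exp_add]; simp
      _ ≤ _ := by gcongr
  have hsrc : ∀ s ∈ Icc 0 R, |K s * f (u s) - K s * f (v s)| ≤ B * Λ * |u s - v s| := by
    intro s hs
    rw [← mul_sub, abs_mul, mul_assoc]
    have h1 := hΛ.dist_le_mul (u s) (Or.inl ⟨s, hs, rfl⟩) (v s) (Or.inr ⟨s, hs, rfl⟩)
    rw [Real.dist_eq, Real.dist_eq] at h1
    exact mul_le_mul (hB s hs) h1 (abs_nonneg _) hB0
  have hslope : ∀ t ∈ Icc 0 R, |radSlope n (fun s => K s * f (u s)) t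
      - radSlope n (fun s => K s * f (v s)) t| ≤ C * (D * Real.exp (2 * C * t)) := by
    intro t ht
    have ht' := hsub ht
    have hmean : |radMean n (fun s => K s * f (u s)) t - radMean n (fun s => K s * f (v s)) t|
        ≤ B * Λ * (D * Real.exp (2 * C * t)) := by
      refine abs_radMean_sub_le huc hvc ht' fun s hs => ?_
      have hs' : s ∈ Icc 0 R := ⟨hs.1, hs.2.trans ht.2⟩
      refine (hsrc s hs').trans ?_
      have h1 : Real.exp (2 * C * s) ≤ Real.exp (2 * C * t) :=
        Real.exp_le_exp.2 (mul_le_mul_of_nonneg_left hs.2 (by positivity))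
      have := (hdiff s hs').trans (mul_le_mul_of_nonneg_left h1 hD0)
      gcongr
    have hlow : ∀ g : ℝ → ℝ, ContinuousOn g (Ico 0 1) → (∀ s ∈ Icc 0 R, c₀ ≤ g s) →
        c₀ ≤ radMean n g t := by
      intro g hg hge
      have h := radMean_mono (n := n) (h₁ := fun _ => c₀) (h₂ := g) ht'
        (intervalIntegrable_radMean continuousOn_const ht') (intervalIntegrable_radMean hg ht')
        fun s hs => hge s ⟨hs.1, hs.2.trans ht.2⟩
      rwa [radMean_const] at h
    have h1 := hlow _ huc fun s hs => (min_le_left _ _).trans (hm₁ hs)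
    have h2 := hlow _ hvc fun s hs => (min_le_right _ _).trans (hm₂ hs)
    have h3 := abs_rpow_sub_rpow_le hc₀p hβ0 hβ1 h1 h2
    have hnp : (0 : ℝ) < n := by positivity
    rw [radSlope, radSlope, ← sub_div, abs_div, abs_of_pos hnp]
    calc _ ≤ β * c₀ ^ (β - 1) * (B * Λ * (D * Real.exp (2 * C * t))) / n := by
          gcongr
          exact h3.trans (by gcongr)
      _ = (C - 1) * (D * Real.exp (2 * C * t)) := by rw [hC]; ring
      _ ≤ _ := by gcongr; linarith
  have hx' := hsub hx
  have hI : ∀ g : ℝ → ℝ, ContinuousOn g (Ico 0 1) →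
      IntervalIntegrable (fun t => t * radSlope n g t) volume 0 x := fun g hg =>
    intervalIntegrable_of_continuousOn_Ico (continuousOn_radSol_integrand hg) h0 hx'
  have hfin : |u x - v x| ≤ D * Real.exp (2 * C * x) / 2 := by
    rw [hue x hx', hve x hx', radSol, radSol, add_sub_add_left_eq_sub,
      ← intervalIntegral.integral_sub (hI _ huc) (hI _ hvc)]
    have hle := intervalIntegral.norm_integral_le_of_norm_le (μ := volume) (a := 0) (b := x)
      (f := fun t => t * radSlope n (fun s => K s * f (u s)) t
        - t * radSlope n (fun s => K s * f (v s)) t)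
      (g := fun t => C * (D * Real.exp (2 * C * t))) hx.1
      (ae_of_all _ fun t ht => by
        have ht' : t ∈ Icc 0 R := ⟨ht.1.le, ht.2.trans hx.2⟩
        rw [← mul_sub, norm_mul, Real.norm_of_nonneg ht.1.le, Real.norm_eq_abs]
        exact (mul_le_of_le_one_left (abs_nonneg _) (hsub ht').2.le).trans (hslope t ht'))
      (Continuous.intervalIntegrable (by fun_prop) _ _)
    refine hle.trans ?_
    have hd : ∀ t ∈ uIcc 0 x, HasDerivAt (fun t => D * Real.exp (2 * C * t) / 2)
        (C * (D * Real.exp (2 * C * t))) t := by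
      intro t _
      have h1 : HasDerivAt (fun t : ℝ => 2 * C * t) (2 * C) t := by
        simpa using (hasDerivAt_id' t).const_mul (2 * C)
      exact ((h1.exp.const_mul D).div_const 2).congr_deriv (by ring)
    rw [intervalIntegral.integral_eq_sub_of_hasDerivAt hd
      (Continuous.intervalIntegrable (by fun_prop) _ _)]
    simp only [mul_zero, Real.exp_zero, mul_one]
    linarith
  have hDle : D ≤ D / 2 := by
    calc D ≤ D * Real.exp (2 * C * x) / 2 * Real.exp (-(2 * C) * x) :=
          mul_le_mul_of_nonneg_right hfin (Real.exp_pos _).le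
      _ = D / 2 * (Real.exp (2 * C * x) * Real.exp (-(2 * C) * x)) := by ring
      _ = D / 2 := by rw [← Real.exp_add]; simp
  have hDz : D = 0 := by linarith
  have := hdiff R ⟨hR.1, le_rfl⟩
  rw [hDz, zero_mul] at this
  exact sub_eq_zero.1 (abs_nonpos_iff.1 this)

end FixedPoint

section RadialSmooth

/-! ### Smoothness of radial functions -/

open Asymptotics

/-- `u` is a radial profile on `[0,1)` with `u'(r) = r b(r)` and `b` of class `C¹` on `(0,1)`,
regular at the origin. -/
structure RadialProfile (u b b' : ℝ → ℝ) : Prop where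
  cont_slope : ContinuousOn b (Ico 0 1)
  hasDerivAt : ∀ r ∈ Ioo (0 : ℝ) 1, HasDerivAt u (r * b r) r
  cont_zero : ContinuousWithinAt u (Ico 0 1) 0
  hasDerivAt_slope : ∀ r ∈ Ioo (0 : ℝ) 1, HasDerivAt b (b' r) r
  cont_deriv : ContinuousOn b' (Ioo 0 1)
  tendsto_zero : Tendsto (fun r => r * b' r) (𝓝[>] 0) (𝓝 0)

variable {u b b' : ℝ → ℝ} {E : Type*} [NormedAddCommGroup E] {x : E}

lemma tendsto_norm_nhdsWithin_Ici : Tendsto (fun x : E => ‖x‖) (𝓝 0) (𝓝[≥] 0) :=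
  tendsto_nhdsWithin_iff.2 ⟨by simpa using (continuous_norm (E := E)).tendsto 0,
    Eventually.of_forall fun x => norm_nonneg x⟩

lemma norm_mem_Ioo (hx0 : x ≠ 0) (hx : x ∈ Metric.ball (0 : E) 1) : ‖x‖ ∈ Ioo (0 : ℝ) 1 :=
  ⟨norm_pos_iff.2 hx0, by simpa using hx⟩

lemma norm_mem_Ico (hx : x ∈ Metric.ball (0 : E) 1) : ‖x‖ ∈ Ico (0 : ℝ) 1 :=
  ⟨norm_nonneg x, by simpa using hx⟩

variable [InnerProductSpace ℝ E]

/-- The real inner product as a continuous bilinear map. -/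
noncomputable def realInnerCLM (E : Type*) [NormedAddCommGroup E] [InnerProductSpace ℝ E] :
    E →L[ℝ] E →L[ℝ] ℝ := innerSL ℝ

lemma realInnerCLM_apply (x : E) : realInnerCLM E x = innerSL ℝ x := rfl

lemma hasFDerivAt_norm_of_ne_zero (hx : x ≠ 0) :
    HasFDerivAt (fun x : E => ‖x‖) ((1 / ‖x‖) • (innerSL ℝ x)) x := by
  have hn : ‖x‖ ≠ 0 := norm_ne_zero_iff.2 hx
  have h := (hasStrictFDerivAt_norm_sq x).hasFDerivAt.sqrt (pow_ne_zero 2 hn)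
  simp only [Real.sqrt_sq (norm_nonneg _)] at h
  convert! h using 1
  ext y
  simp
  field_simp

namespace RadialProfile

/-- The norm is not differentiable at the origin, but `u'(r) = r b(r)` tends to `0` there, so `u`
has one-sided derivative `0` and `u ‖x‖ - u 0` is `o(‖x‖)`. -/
lemma hasFDerivAt_comp_norm (h : RadialProfile u b b') (hx : x ∈ Metric.ball (0 : E) 1) :
    HasFDerivAt (fun x : E => u ‖x‖) (b ‖x‖ • innerSL ℝ x) x := by
  rcases eq_or_ne x 0 with rfl | hx0
  · have h0 : (0 : ℝ) ∈ Ico (0 : ℝ) 1 := ⟨le_rfl, one_pos⟩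
    have hIoo : Ioo (0 : ℝ) 1 ∈ 𝓝[>] 0 := Ioo_mem_nhdsGT one_pos
    have hd : HasDerivWithinAt u 0 (Ici 0) 0 := by
      refine hasDerivWithinAt_Ici_of_tendsto_deriv (s := Ioo 0 1)
        (fun r hr => (h.hasDerivAt r hr).differentiableAt.differentiableWithinAt)
        (h.cont_zero.mono Ioo_subset_Ico_self) hIoo ?_
      have hb : Tendsto (fun r => r * b r) (𝓝[>] 0) (𝓝 0) := by
        have h1 := ((continuousOn_id.mul h.cont_slope) 0 h0).mono Ioo_subset_Ico_self
        have h2 : Tendsto (fun r => r * b r) (𝓝[Ioo 0 1] 0) (𝓝 (0 * b 0)) := h1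
        rwa [zero_mul, nhdsWithin_Ioo_eq_nhdsGT one_pos] at h2
      refine hb.congr' ?_
      filter_upwards [hIoo] with r hr using (h.hasDerivAt r hr).deriv.symm
    rw [hasFDerivAt_iff_isLittleO_nhds_zero]
    have h2 := (hasDerivWithinAt_iff_isLittleO.1 hd).comp_tendsto
      (tendsto_norm_nhdsWithin_Ici (E := E))
    simp only [Function.comp_def, smul_zero, sub_zero] at h2
    simpa using h2.of_norm_right
  · have h1 := (h.hasDerivAt _ (norm_mem_Ioo hx0 hx)).comp_hasFDerivAt x
      (hasFDerivAt_norm_of_ne_zero hx0)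
    convert! h1 using 1
    have hn : ‖x‖ ≠ 0 := norm_ne_zero_iff.2 hx0
    ext y
    simp
    field_simp

/-- The second derivative of `x ↦ u ‖x‖`. -/
noncomputable def secondDeriv (b b' : ℝ → ℝ) (x : E) : E →L[ℝ] E →L[ℝ] ℝ :=
  b ‖x‖ • (realInnerCLM E)
    + (b' ‖x‖ / ‖x‖) • (innerSL ℝ x).smulRight (innerSL ℝ x)

-- At the origin only continuity of `b` is needed: `(b ‖x‖ - b 0) x` is `o(‖x‖)`. Elsewhere it is
-- the product and chain rule.
set_option synthInstance.maxHeartbeats 200000 in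
lemma hasFDerivAt_gradient (h : RadialProfile u b b') (hx : x ∈ Metric.ball (0 : E) 1) :
    HasFDerivAt (fun x : E => b ‖x‖ • (realInnerCLM E) x)
      (secondDeriv b b' x) x := by
  rcases eq_or_ne x 0 with rfl | hx0
  · have hS : secondDeriv b b' (0 : E) = b 0 • (realInnerCLM E) := by
      ext y z
      simp [secondDeriv]
    rw [hS, hasFDerivAt_iff_isLittleO_nhds_zero]
    have hb : (fun x : E => b ‖x‖ - b 0) =o[𝓝 0] (fun _ => (1 : ℝ)) := by
      rw [isLittleO_one_iff]
      have h1 : ContinuousWithinAt b (Ici 0) 0 :=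
        (h.cont_slope 0 ⟨le_rfl, one_pos⟩).mono_of_mem_nhdsWithin (Ico_mem_nhdsGE one_pos)
      have h2 := h1.tendsto.comp (tendsto_norm_nhdsWithin_Ici (E := E))
      simpa using h2.sub_const (b 0)
    have h3 := hb.smul_isBigO ((realInnerCLM E).isBigO_id (𝓝 0))
    simpa [sub_smul] using h3
  · have h1 := (h.hasDerivAt_slope _ (norm_mem_Ioo hx0 hx)).comp_hasFDerivAt x
      (hasFDerivAt_norm_of_ne_zero hx0)
    have h2 := h1.smul (realInnerCLM E).hasFDerivAt
    refine h2.congr_fderiv ?_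
    ext y z
    simp [secondDeriv, realInnerCLM_apply]
    ring

lemma continuousOn_add_of_normed {X F : Type*} [TopologicalSpace X] [NormedAddCommGroup F]
    {f g : X → F} {s : Set X} (hf : ContinuousOn f s) (hg : ContinuousOn g s) :
    ContinuousOn (fun x => f x + g x) s := hf.add hg

lemma continuousAt_smul_of_tendsto_norm {X F : Type*} [TopologicalSpace X]
    [NormedAddCommGroup F] [NormedSpace ℝ F] {c : X → ℝ} {A : X → F} {x : X} (hc : c x = 0)
    (h : Tendsto (fun y => ‖c y‖ * ‖A y‖) (𝓝 x) (𝓝 0)) :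
    ContinuousAt (fun y => c y • A y) x := by
  rw [ContinuousAt, hc, zero_smul, tendsto_zero_iff_norm_tendsto_zero]
  simpa only [norm_smul] using h

/-- The rank-one term has norm `|r b'(r)|` with `r = ‖x‖`, so it tends to zero at the origin by
`tendsto_zero` although `b'` itself may be unbounded. -/
lemma continuousOn_secondDeriv (h : RadialProfile u b b') :
    ContinuousOn (secondDeriv (E := E) b b') (Metric.ball 0 1) := by
  have hb : ContinuousOn (fun x : E => b ‖x‖) (Metric.ball 0 1) :=
    h.cont_slope.comp continuous_norm.continuousOn fun x hx => norm_mem_Ico hx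
  have hb2 : ContinuousOn (fun x : E => b ‖x‖ • realInnerCLM E) (Metric.ball 0 1) :=
    hb.smul continuousOn_const
  refine continuousOn_add_of_normed (F := E →L[ℝ] E →L[ℝ] ℝ) hb2 fun x hx => ContinuousAt.continuousWithinAt ?_
  rcases eq_or_ne x 0 with rfl | hx0
  · refine continuousAt_smul_of_tendsto_norm (F := E →L[ℝ] E →L[ℝ] ℝ) (by simp) ?_
    have h1 : ContinuousWithinAt (fun r => r * b' r) (Ici 0) 0 := by
      rw [← continuousWithinAt_Ioi_iff_Ici, ContinuousWithinAt, zero_mul]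
      exact h.tendsto_zero
    have h2 := (h1.tendsto.comp (tendsto_norm_nhdsWithin_Ici (E := E))).norm
    simp only [zero_mul, norm_zero] at h2
    refine h2.congr fun y => ?_
    rw [ContinuousLinearMap.norm_smulRight_apply, innerSL_apply_norm]
    rcases eq_or_ne y 0 with rfl | hy
    · simp
    · have hn : ‖y‖ ≠ 0 := norm_ne_zero_iff.2 hy
      simp only [Function.comp_apply, norm_mul, norm_div, norm_norm]
      field_simp
  · have hx' := norm_mem_Ioo hx0 hx
    have h1 : ContinuousAt (fun x : E => b' ‖x‖) x :=
      ContinuousAt.comp (f := fun x : E => ‖x‖)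
        (h.cont_deriv.continuousAt (Ioo_mem_nhds hx'.1 hx'.2)) continuous_norm.continuousAt
    have h2 : ContinuousAt (fun x : E => ContinuousLinearMap.smulRight (innerSL ℝ x)
        (innerSL ℝ x)) x := by
      have : Continuous fun x : E => ContinuousLinearMap.smulRightL ℝ E (E →L[ℝ] ℝ)
          ((realInnerCLM E) x) ((realInnerCLM E) x) := by
        fun_prop
      exact this.continuousAt
    exact (h1.div continuous_norm.continuousAt hx'.1.ne').smul h2

lemma fderiv_comp_norm (h : RadialProfile u b b') (hx : x ∈ Metric.ball (0 : E) 1) :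
    fderiv ℝ (fun x : E => u ‖x‖) x = b ‖x‖ • (realInnerCLM E) x :=
  (h.hasFDerivAt_comp_norm hx).fderiv

lemma hasFDerivAt_fderiv (h : RadialProfile u b b') (hx : x ∈ Metric.ball (0 : E) 1) :
    HasFDerivAt (fderiv ℝ (fun x : E => u ‖x‖)) (secondDeriv b b' x) x :=
  (h.hasFDerivAt_gradient hx).congr_of_eventuallyEq (by
    filter_upwards [Metric.isOpen_ball.mem_nhds hx] with y hy using h.fderiv_comp_norm hy)

lemma contDiffOn_comp_norm (h : RadialProfile u b b') :
    ContDiffOn ℝ 2 (fun x : E => u ‖x‖) (Metric.ball 0 1) := by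
  have h1 : ContDiffOn ℝ 1 (fderiv ℝ (fun x : E => u ‖x‖)) (Metric.ball 0 1) := by
    rw [← zero_add (1 : WithTop ℕ∞), contDiffOn_succ_iff_fderiv_of_isOpen Metric.isOpen_ball]
    refine ⟨fun x hx => (h.hasFDerivAt_fderiv hx).differentiableAt.differentiableWithinAt,
      by simp, contDiffOn_zero.2 ?_⟩
    exact h.continuousOn_secondDeriv.congr fun x hx => (h.hasFDerivAt_fderiv hx).fderiv
  rw [← one_add_one_eq_two, contDiffOn_succ_iff_fderiv_of_isOpen Metric.isOpen_ball]
  exact ⟨fun x hx => (h.hasFDerivAt_comp_norm hx).differentiableAt.differentiableWithinAt,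
    by simp, h1⟩

/-- The one-dimensional case of `contDiffOn_comp_norm`: `r ↦ u |r|` is `C²` on `(-1,1)` and agrees
with `u` on `[0,1)`. -/
lemma contDiffOn_Ico (h : RadialProfile u b b') : ContDiffOn ℝ 2 u (Ico 0 1) := by
  refine (h.contDiffOn_comp_norm (E := ℝ)).mono (fun r hr => ?_) |>.congr fun r hr => ?_
  · simpa [abs_of_nonneg hr.1] using hr.2
  · rw [Real.norm_of_nonneg hr.1]

lemma derivWithin_zero (h : RadialProfile u b b') : derivWithin u (Ico 0 1) 0 = 0 := by
  have h1 := (h.hasFDerivAt_comp_norm (x := (0 : ℝ)) (by simp)).hasDerivAt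
  have h2 : HasDerivWithinAt u 0 (Ico 0 1) 0 := by
    refine (h1.hasDerivWithinAt (s := Ico 0 1)).congr_deriv (by simp) |>.congr
      (fun r hr => by rw [Real.norm_of_nonneg hr.1]) (by simp)
  exact h2.derivWithin (uniqueDiffOn_Ico 0 1 0 ⟨le_rfl, one_pos⟩)

lemma iteratedFDeriv_two (h : RadialProfile u b b') (hx : x ∈ Metric.ball (0 : E) 1) (y z : E) :
    iteratedFDeriv ℝ 2 (fun x : E => u ‖x‖) x ![y, z]
      = b ‖x‖ * inner ℝ y z + b' ‖x‖ / ‖x‖ * (inner ℝ x y * inner ℝ x z) := by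
  rw [iteratedFDeriv_two_apply, (h.hasFDerivAt_fderiv hx).fderiv]
  simp [secondDeriv, realInnerCLM_apply]

end RadialProfile

end RadialSmooth

section MongeAmpere

/-! ### The matrix `Δz I - D²z` of a radial function -/

variable {u b b' : ℝ → ℝ} {n : ℕ}

/-- The determinant formula for a rank-one perturbation: eigenvalue `lam` on the orthogonal
complement of `x`, and `lam - c |x|²` along `x`. -/
lemma det_smul_one_sub_vecMulVec {lam c : ℝ} (hlam : lam ≠ 0) (x : Fin (n + 1) → ℝ) :
    (lam • (1 : Matrix (Fin (n + 1)) (Fin (n + 1)) ℝ) - c • Matrix.vecMulVec x x).det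
      = lam ^ n * (lam - c * (x ⬝ᵥ x)) := by
  have h : lam • (1 : Matrix (Fin (n + 1)) (Fin (n + 1)) ℝ) - c • Matrix.vecMulVec x x
      = lam • (1 + Matrix.replicateCol Unit (-(c / lam) • x) * Matrix.replicateRow Unit x) := by
    rw [← Matrix.vecMulVec_eq, Matrix.smul_vecMulVec, smul_add, smul_smul, sub_eq_add_neg,
      ← neg_smul]
    congr 2
    field_simp
  rw [h, Matrix.det_smul, Matrix.det_one_add_replicateCol_mul_replicateRow, dotProduct_smul,
    Fintype.card_fin, smul_eq_mul]
  field_simp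
  ring

/-- The quadratic form is `lam |y|² - c (x·y)²`. For `c ≤ 0` it is clearly positive; for `c > 0`
Cauchy–Schwarz bounds it below by `(lam - c |x|²) |y|²`. -/
lemma posDef_smul_one_sub_vecMulVec {lam c : ℝ} (hlam : 0 < lam) (x : Fin n → ℝ)
    (hc : 0 < lam - c * (x ⬝ᵥ x)) :
    (lam • (1 : Matrix (Fin n) (Fin n) ℝ) - c • Matrix.vecMulVec x x).PosDef := by
  rw [Matrix.posDef_iff_dotProduct_mulVec]
  constructor
  · ext i j
    simp [Matrix.vecMulVec_apply, Matrix.one_apply, eq_comm, mul_comm]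
  · intro y hy
    have hyy : 0 < y ⬝ᵥ y := by
      simpa using Matrix.dotProduct_star_self_pos_iff.2 hy
    have hq : star y ⬝ᵥ (lam • (1 : Matrix (Fin n) (Fin n) ℝ)
        - c • Matrix.vecMulVec x x).mulVec y = lam * (y ⬝ᵥ y) - c * (x ⬝ᵥ y) ^ 2 := by
      rw [Matrix.sub_mulVec, Matrix.smul_mulVec, Matrix.smul_mulVec, Matrix.one_mulVec,
        Matrix.vecMulVec_mulVec, star_trivial, dotProduct_sub, dotProduct_smul, dotProduct_smul]
      simp only [smul_eq_mul, op_smul_eq_smul, dotProduct_smul]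
      rw [dotProduct_comm y x]; ring
    have hcs : (x ⬝ᵥ y) ^ 2 ≤ (x ⬝ᵥ x) * (y ⬝ᵥ y) := by
      simp only [dotProduct, ← pow_two]
      exact Finset.sum_mul_sq_le_sq_mul_sq _ _ _
    rw [hq]
    rcases le_or_gt c 0 with h0 | h0
    · nlinarith [mul_pos hlam hyy, mul_nonneg (neg_nonneg.2 h0) (sq_nonneg (x ⬝ᵥ y))]
    · nlinarith [mul_pos hc hyy, mul_le_mul_of_nonneg_left hcs h0.le]

/-- The Hessian is `b I + (b'/r) x xᵀ`, with trace `(n+1) b + r b'`. At the origin the quotient by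
`‖x‖ = 0` is multiplied by a vanishing matrix. -/
lemma maMatrix_comp_norm (h : RadialProfile u b b') {x : EuclideanSpace ℝ (Fin (n + 1))}
    (hx : x ∈ unitBall (n + 1)) :
    maMatrix (fun x => u ‖x‖) x
      = (n * b ‖x‖ + ‖x‖ * b' ‖x‖) • (1 : Matrix (Fin (n + 1)) (Fin (n + 1)) ℝ)
        - (b' ‖x‖ / ‖x‖) • Matrix.vecMulVec x.ofLp x.ofLp := by
  have hlap : (Δ (fun x : EuclideanSpace ℝ (Fin (n + 1)) => u ‖x‖)) x
      = (n + 1) * b ‖x‖ + ‖x‖ * b' ‖x‖ := by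
    rw [InnerProductSpace.laplacian_eq_iteratedFDeriv_orthonormalBasis _
      (EuclideanSpace.basisFun (Fin (n + 1)) ℝ)]
    simp only [h.iteratedFDeriv_two hx, EuclideanSpace.basisFun_apply]
    simp only [EuclideanSpace.inner_single_right, Finset.sum_add_distrib, ← Finset.mul_sum]
    have h2 : ∑ i, x i * x i = ‖x‖ ^ 2 := by
      rw [EuclideanSpace.norm_sq_eq]
      simp [pow_two]
    simp only [conj_trivial, one_mul, h2]
    rcases eq_or_ne ‖x‖ 0 with h0 | h0
    · simp [h0]; ring
    · simp; field_simp
  ext i j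
  rw [maMatrix, hlap]
  simp only [hessian, Matrix.sub_apply, Matrix.smul_apply, Matrix.of_apply, smul_eq_mul,
    h.iteratedFDeriv_two hx, Matrix.vecMulVec_apply, EuclideanSpace.inner_single_right,
    conj_trivial, one_mul]
  rcases eq_or_ne i j with rfl | hij
  · simp; ring
  · simp [hij, hij.symm]

lemma dotProduct_self_eq_norm_sq (x : EuclideanSpace ℝ (Fin n)) :
    x.ofLp ⬝ᵥ x.ofLp = ‖x‖ ^ 2 := by
  rw [EuclideanSpace.norm_sq_eq]
  simp [dotProduct, pow_two]

lemma maMatrix_posDef (h : RadialProfile u b b') (hn : 1 ≤ n)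
    {x : EuclideanSpace ℝ (Fin (n + 1))} (hx : x ∈ unitBall (n + 1)) (hb : 0 < b ‖x‖)
    (hlam : 0 < n * b ‖x‖ + ‖x‖ * b' ‖x‖) : (maMatrix (fun x => u ‖x‖) x).PosDef := by
  rw [maMatrix_comp_norm h hx]
  refine posDef_smul_one_sub_vecMulVec hlam _ ?_
  rw [dotProduct_self_eq_norm_sq]
  have : b' ‖x‖ / ‖x‖ * ‖x‖ ^ 2 = ‖x‖ * b' ‖x‖ := by
    rcases eq_or_ne ‖x‖ 0 with h0 | h0
    · simp [h0]
    · field_simp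
  rw [this, add_sub_cancel_right]
  positivity

lemma maMatrix_det (h : RadialProfile u b b')
    {x : EuclideanSpace ℝ (Fin (n + 1))} (hx : x ∈ unitBall (n + 1))
    (hlam : 0 < n * b ‖x‖ + ‖x‖ * b' ‖x‖) :
    (maMatrix (fun x => u ‖x‖) x).det
      = (n * b ‖x‖ + ‖x‖ * b' ‖x‖) ^ n * (n * b ‖x‖) := by
  rw [maMatrix_comp_norm h hx, det_smul_one_sub_vecMulVec hlam.ne', dotProduct_self_eq_norm_sq]
  have : b' ‖x‖ / ‖x‖ * ‖x‖ ^ 2 = ‖x‖ * b' ‖x‖ := by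
    rcases eq_or_ne ‖x‖ 0 with h0 | h0
    · simp [h0]
    · field_simp
  rw [this, add_sub_cancel_right]

end MongeAmpere

section Solutions

/-! ### Solutions of the boundary blow-up problem between two barriers -/

variable {n : ℕ} {K f h u w₁ w₂ : ℝ → ℝ} {k r : ℝ}

/-- The factor `r` removes the division in `radSlopeDeriv`; at `r = 0` the right side vanishes as
well, so the identity includes the origin. -/
lemma mul_radSlopeDeriv (hX : radMean n h 0 = h 0) (r : ℝ) :
    r * radSlopeDeriv n h r
      = radMean n h r ^ ((n : ℝ) / (n + 1) - 1) * (h r - radMean n h r) := by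
  rcases eq_or_ne r 0 with rfl | hr
  · simp [hX]
  · rw [radSlopeDeriv]; field_simp

lemma radialProfile_radSol (hn : 1 ≤ n) (hh : ContinuousOn h (Ico 0 1))
    (hpos : ∀ s ∈ Ico (0 : ℝ) 1, 0 < h s) :
    RadialProfile (radSol n k h) (radSlope n h) (radSlopeDeriv n h) where
  cont_slope := continuousOn_radSlope hh
  hasDerivAt r hr := hasDerivAt_radSol hh hr
  cont_zero := continuousOn_radSol hh 0 ⟨le_rfl, one_pos⟩
  hasDerivAt_slope r hr := hasDerivAt_radSlope hn hh hpos hr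
  cont_deriv := by
    have hX := (continuousOn_radMean (n := n) hh).mono Ioo_subset_Ico_self
    refine ((hX.rpow_const fun r hr => Or.inl ?_).mul
      ((hh.mono Ioo_subset_Ico_self).sub hX)).div continuousOn_id fun r hr => hr.1.ne'
    exact (radMean_pos hh hpos ⟨hr.1.le, hr.2⟩).ne'
  tendsto_zero := by
    have h0 : (0 : ℝ) ∈ Ico (0 : ℝ) 1 := ⟨le_rfl, one_pos⟩
    have hX := (continuousOn_radMean (n := n) hh) 0 h0
    have hc : ContinuousWithinAt
        (fun r => radMean n h r ^ ((n : ℝ) / (n + 1) - 1) * (h r - radMean n h r))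
        (Ico 0 1) 0 :=
      (hX.rpow_const (Or.inl (radMean_pos hh hpos h0).ne')).mul ((hh 0 h0).sub hX)
    have ht := (hc.mono Ioo_subset_Ico_self).tendsto
    rw [nhdsWithin_Ioo_eq_nhdsGT one_pos, radMean_zero, sub_self, mul_zero] at ht
    exact ht.congr fun r => (mul_radSlopeDeriv radMean_zero r).symm

lemma tangential_eigenvalue_radSol (hn : 1 ≤ n) (hh : ContinuousOn h (Ico 0 1))
    (hpos : ∀ s ∈ Ico (0 : ℝ) 1, 0 < h s) (hr : r ∈ Ico (0 : ℝ) 1) :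
    n * radSlope n h r + r * radSlopeDeriv n h r
      = radMean n h r ^ ((n : ℝ) / (n + 1) - 1) * h r := by
  have hn0 : (n : ℝ) ≠ 0 := by positivity
  rw [mul_radSlopeDeriv radMean_zero, radSlope, mul_div_cancel₀ _ hn0,
    radOp_algebra (radMean_pos hh hpos hr)]

lemma det_radSol (hn : 1 ≤ n) (hh : ContinuousOn h (Ico 0 1))
    (hpos : ∀ s ∈ Ico (0 : ℝ) 1, 0 < h s) (hr : r ∈ Ico (0 : ℝ) 1) :
    (n * radSlope n h r + r * radSlopeDeriv n h r) ^ n * (n * radSlope n h r) = h r ^ n := by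
  have hn0 : (n : ℝ) ≠ 0 := by positivity
  have hX := radMean_pos (n := n) hh hpos hr
  rw [tangential_eigenvalue_radSol hn hh hpos hr, radSlope, mul_div_cancel₀ _ hn0, mul_pow,
    ← Real.rpow_natCast (radMean n h r ^ _), ← Real.rpow_mul hX.le, mul_right_comm,
    ← Real.rpow_add hX]
  -- The powers of the mean from the `n` equal eigenvalues and from the remaining one cancel,
  -- leaving `h r ^ n`.
  have : ((n : ℝ) / (n + 1) - 1) * n + n / (n + 1) = 0 := by
    have : (n : ℝ) + 1 ≠ 0 := by positivity
    field_simp; ring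
  rw [this, Real.rpow_zero, one_mul]

lemma norm_gt_of_infDist_frontier_lt {δ : ℝ} {x : EuclideanSpace ℝ (Fin (n + 1))}
    (hx : Metric.infDist x (frontier (unitBall (n + 1))) < δ) : 1 - δ < ‖x‖ := by
  rw [unitBall, frontier_ball _ one_ne_zero, Metric.infDist_lt_iff
    ⟨EuclideanSpace.single 0 1, by simp⟩] at hx
  obtain ⟨y, hy, hxy⟩ := hx
  have h1 : ‖y‖ = 1 := by simpa using hy
  have h2 := norm_sub_norm_le y x
  rw [dist_comm, dist_eq_norm] at hxy
  linarith

/-- Between a sub- and a super-solution, every initial value yields a unique solution of the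
initial value problem, which is a radial solution of the boundary blow-up problem. -/
lemma exists_unique_solution (hn : 1 ≤ n) (hK : CondK K) (hf : CondF1 f)
    (h₁ : IsSub (n + 1) K f w₁) (h₂ : IsSuper (n + 1) K f w₂)
    (h₁₂ : ∀ s ∈ Ico (0 : ℝ) 1, w₁ s ≤ w₂ s)
    (hblow : ∀ M : ℝ, ∃ δ > 0, ∀ r ∈ Ico (0 : ℝ) 1, 1 - δ < r → M < w₁ r)
    (hk : k ∈ Ioo (w₁ 0) (w₂ 0)) :
    ∃ u : ℝ → ℝ, SolvesIVP (n + 1) K f k u ∧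
      (∀ v : ℝ → ℝ, SolvesIVP (n + 1) K f k v → EqOn v u (Ico 0 1)) ∧
      (∀ r ∈ Ico (0 : ℝ) 1, w₁ r < u r ∧ u r < w₂ r) ∧
      IsRadialConvexSolution (n + 1) K f (fun x => u ‖x‖) := by
  obtain ⟨u₀, hc₀, hb₀, hfix⟩ := exists_fixedPoint hn hK hf h₁ h₂ h₁₂ hk
  have hw₁p := h₁.1.2.2.2
  have hu₀p : ∀ s ∈ Ico (0 : ℝ) 1, 0 < u₀ s := fun s hs => (hw₁p s hs).trans_le (hb₀ s hs).1
  set h : ℝ → ℝ := fun s => K s * f (u₀ s) with hh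
  have hhc : ContinuousOn h (Ico 0 1) := continuousOn_source hK hf hc₀ hu₀p
  have hhp : ∀ s ∈ Ico (0 : ℝ) 1, 0 < h s := source_pos hK hf hu₀p
  set u := radSol n k h with hu
  have huh : ∀ s ∈ Ico (0 : ℝ) 1, K s * f (u s) = h s := fun s hs => by
    simp only [hh]; rw [hfix s hs]
  -- Strictness comes from the initial values: the gap `u - w₁` is at least `k - w₁ 0` everywhere.
  have hlow : ∀ r ∈ Ico (0 : ℝ) 1, w₁ r < u r := by
    intro r hr
    have hs := continuousOn_source hK hf h₁.1.continuousOn hw₁p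
    have hp := source_pos hK hf hw₁p
    have e1 := le_radSol hn h₁.1 hs hp h₁.2 hr
    have e2 := radSol_mono (n := n) (k := w₁ 0) hs hhc hp
      (fun s hs => source_mono hK hf hs (hw₁p s hs) (hb₀ s hs).1) hr
    rw [hu, radSol_add_const n k (w₁ 0)]
    linarith [hk.1]
  have hupp : ∀ r ∈ Ico (0 : ℝ) 1, u r < w₂ r := by
    intro r hr
    have hw₂p := h₂.1.2.2.2
    have hs := continuousOn_source hK hf h₂.1.continuousOn hw₂p
    have hp := source_pos hK hf hw₂p
    have e1 := radSol_le hn h₂.1 hs hp h₂.2 hr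
    have e2 := radSol_mono (n := n) (k := w₂ 0) hhc hs hhp
      (fun s hs => source_mono hK hf hs (hu₀p s hs) (hb₀ s hs).2) hr
    rw [hu, radSol_add_const n k (w₂ 0)]
    linarith [hk.2]
  have hup : ∀ r ∈ Ico (0 : ℝ) 1, 0 < u r := fun r hr => (hw₁p r hr).trans (hlow r hr)
  have hprof := radialProfile_radSol (k := k) hn hhc hhp
  have hslope : ∀ r ∈ Ico (0 : ℝ) 1, 0 < radSlope n h r := fun r hr =>
    radSlope_pos hn hhc hhp hr
  have hlam : ∀ r ∈ Ico (0 : ℝ) 1, 0 < n * radSlope n h r + r * radSlopeDeriv n h r := by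
    intro r hr
    rw [tangential_eigenvalue_radSol hn hhc hhp hr]
    exact mul_pos (Real.rpow_pos_of_pos (radMean_pos hhc hhp hr) _) (hhp r hr)
  refine ⟨u, ⟨⟨hprof.contDiffOn_Ico, hprof.derivWithin_zero, fun r hr => ?_, hup⟩, radSol_zero,
    fun r hr => ?_⟩, fun v hv => ?_, fun r hr => ⟨hlow r hr, hupp r hr⟩, ?_⟩
  · rw [(hasDerivAt_radSol hhc hr).deriv]
    exact mul_nonneg hr.1.le (hslope r ⟨hr.1.le, hr.2⟩).le
  · rw [radialOp_radSol hn hhc hhp hr, huh r ⟨hr.1.le, hr.2⟩]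
  · have hvp := hv.1.2.2.2
    have hs := continuousOn_source hK hf hv.1.continuousOn hvp
    have hp := source_pos hK hf hvp
    refine fixedPoint_unique (k := k) hn hK hf hv.1.continuousOn (continuousOn_radSol hhc) hvp hup
      (fun r hr => ?_) (fun r hr => ?_)
    · rw [← hv.2.1]
      exact le_antisymm (le_radSol hn hv.1 hs hp (fun s hs => (hv.2.2 s hs).le) hr)
        (radSol_le hn hv.1 hs hp (fun s hs => (hv.2.2 s hs).ge) hr)
    -- `h` was built from `u₀` and is known to agree with `K f(u)` on `[0,1)` only, so `radSol` is
    -- compared in both directions.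
    · have huc : ContinuousOn (fun s => K s * f (u s)) (Ico 0 1) := hhc.congr huh
      refine le_antisymm ?_ ?_
      · exact radSol_mono hhc huc hhp (fun s hs => (huh s hs).ge) hr
      · exact radSol_mono huc hhc (source_pos hK hf hup) (fun s hs => (huh s hs).le) hr
  · refine ⟨hprof.contDiffOn_comp_norm, fun x hx => hup _ (norm_mem_Ico hx),
      ⟨u, fun x _ => rfl⟩, fun x hx => ?_, fun x hx => ?_, fun M => ?_⟩
    · exact maMatrix_posDef hprof hn hx (hslope _ (norm_mem_Ico hx)) (hlam _ (norm_mem_Ico hx))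
    · have hx' := norm_mem_Ico hx
      rw [maMatrix_det hprof hx (hlam _ hx'), det_radSol hn hhc hhp hx', huh _ hx']
      push_cast
      rw [add_sub_cancel_right, one_div, Real.pow_rpow_inv_natCast (hhp _ hx').le (by omega)]
    · obtain ⟨δ, hδ, hM⟩ := hblow M
      exact ⟨δ, hδ, fun x hx hd => (hM _ (norm_mem_Ico hx)
        (norm_gt_of_infDist_frontier_lt hd)).trans (hlow _ (norm_mem_Ico hx))⟩

/-- The value at the centre of the ball recovers `k`, so an interval of initial values injects into
the set of solutions. -/
lemma radialConvexSolutions_infinite {N : ℕ} {a b : ℝ} (hab : a < b)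
    (hsol : ∀ k ∈ Ioo a b, ∃ u : ℝ → ℝ, u 0 = k ∧ IsRadialConvexSolution N K f (fun x => u ‖x‖)) :
    (radialConvexSolutions N K f).Infinite := by
  choose! u hu0 hu using hsol
  refine infinite_of_injOn_mapsTo
    (f := fun k => (unitBall N).domRestrict (fun x => u k ‖x‖)) (s := Ioo a b)
    (fun k hk l hl hkl => ?_) (fun k hk => ⟨_, hu k hk, rfl⟩) (Ioo_infinite hab)
  have := congr_fun hkl ⟨0, by simp [unitBall]⟩
  simpa [hu0 k hk, hu0 l hl] using this

end Solutions

section KellerOsserman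

/-! ### The function `G` and its inverse -/

variable {n : ℕ} {f : ℝ → ℝ} {a s t τ : ℝ}

lemma intervalIntegrable_of_continuousOn_Ioi {g : ℝ → ℝ} (hg : ContinuousOn g (Ioi 0))
    (hs : 0 < s) (ht : 0 < t) : IntervalIntegrable g volume s t :=
  (hg.mono (ordConnected_Ioi.uIcc_subset hs ht)).intervalIntegrable

lemma hasStrictDerivAt_primitive_Ioi {g : ℝ → ℝ} (hg : ContinuousOn g (Ioi 0))
    (hs : 0 < s) (ht : 0 < t) : HasStrictDerivAt (fun t => ∫ x in s..t, g x) (g t) t :=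
  intervalIntegral.integral_hasStrictDerivAt_right
    (intervalIntegrable_of_continuousOn_Ioi hg hs ht)
    (hg.stronglyMeasurableAtFilter isOpen_Ioi t ht) (hg.continuousAt (Ioi_mem_nhds ht))

/-- No condition is imposed on `f` at `0`, but monotonicity bounds it by `f τ` on `(0,τ]`. -/
lemma BlowUp.CondF1.intervalIntegrable (hf : CondF1 f) (hτ : 0 < τ) :
    IntervalIntegrable f volume 0 τ := by
  rw [intervalIntegrable_iff_integrableOn_Ioc_of_le hτ.le]
  refine Integrable.mono' (g := fun _ => f τ) (integrable_const _)
    ((hf.continuousOn.mono fun x hx => hx.1).aestronglyMeasurable measurableSet_Ioc) ?_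
  filter_upwards [ae_restrict_mem measurableSet_Ioc] with x hx
  rw [Real.norm_of_nonneg (hf.1 x hx.1).le]
  exact hf.2.1 hx.1 hτ hx.2

lemma hasDerivAt_primF (hf : CondF1 f) (hτ : 0 < τ) : HasDerivAt (primF f) (f τ) τ :=
  intervalIntegral.integral_hasDerivAt_right (hf.intervalIntegrable hτ)
    (hf.continuousOn.stronglyMeasurableAtFilter isOpen_Ioi τ hτ)
    (hf.continuousOn.continuousAt (Ioi_mem_nhds hτ))

lemma primF_pos (hf : CondF1 f) (hτ : 0 < τ) : 0 < primF f τ :=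
  intervalIntegral.intervalIntegral_pos_of_pos_on (hf.intervalIntegrable hτ)
    (fun x hx => hf.1 x hx.1) hτ

/-- `(2N-1)/(N-1) F(τ)` for `N = n + 1`. -/
noncomputable def scaledF (n : ℕ) (f : ℝ → ℝ) (τ : ℝ) : ℝ := (2 * (n : ℝ) + 1) / n * primF f τ

lemma scaledF_pos (hn : 1 ≤ n) (hf : CondF1 f) (hτ : 0 < τ) : 0 < scaledF n f τ :=
  mul_pos (by positivity) (primF_pos hf hτ)

lemma hasDerivAt_scaledF (hf : CondF1 f) (hτ : 0 < τ) :
    HasDerivAt (scaledF n f) ((2 * (n : ℝ) + 1) / n * f τ) τ :=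
  (hasDerivAt_primF hf hτ).const_mul _

lemma hasDerivAt_scaledF_rpow (hn : 1 ≤ n) (hf : CondF1 f) (hτ : 0 < τ) (e : ℝ) :
    HasDerivAt (fun x => scaledF n f x ^ e)
      ((2 * (n : ℝ) + 1) / n * f τ * e * scaledF n f τ ^ (e - 1)) τ :=
  (hasDerivAt_scaledF hf hτ).rpow_const (Or.inl (scaledF_pos hn hf hτ).ne')

lemma continuousOn_scaledF_rpow (hn : 1 ≤ n) (hf : CondF1 f) (e : ℝ) :
    ContinuousOn (fun x => scaledF n f x ^ e) (Ioi 0) :=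
  fun _ hx => (hasDerivAt_scaledF_rpow hn hf hx e).continuousAt.continuousWithinAt

lemma exponent_gamma (n : ℕ) :
    (((n + 1 : ℕ) : ℝ) - 1) / (2 * ((n + 1 : ℕ) : ℝ) - 1) = (n : ℝ) / (2 * n + 1) := by
  push_cast; congr 1 <;> ring

lemma funG_succ (n : ℕ) (f : ℝ → ℝ) (a t : ℝ) :
    funG (n + 1) f a t = ∫ τ in a..t, scaledF n f τ ^ (-((n : ℝ) / (2 * n + 1))) := by
  have h2 : (2 * ((n + 1 : ℕ) : ℝ) - 1) / (((n + 1 : ℕ) : ℝ) - 1) = (2 * (n : ℝ) + 1) / n := by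
    push_cast; congr 1 <;> ring
  simp only [funG, scaledF, exponent_gamma, h2]

lemma hasStrictDerivAt_funG (hn : 1 ≤ n) (hf : CondF1 f) (ha : 0 < a) (ht : 0 < t) :
    HasStrictDerivAt (funG (n + 1) f a) (scaledF n f t ^ (-((n : ℝ) / (2 * n + 1)))) t := by
  have := hasStrictDerivAt_primitive_Ioi
    (continuousOn_scaledF_rpow hn hf (-((n : ℝ) / (2 * n + 1)))) ha ht
  simpa only [← funG_succ] using this

lemma hasDerivAt_funG (hn : 1 ≤ n) (hf : CondF1 f) (ha : 0 < a) (ht : 0 < t) :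
    HasDerivAt (funG (n + 1) f a) (scaledF n f t ^ (-((n : ℝ) / (2 * n + 1)))) t :=
  (hasStrictDerivAt_funG hn hf ha ht).hasDerivAt

lemma continuousOn_funG (hn : 1 ≤ n) (hf : CondF1 f) (ha : 0 < a) :
    ContinuousOn (funG (n + 1) f a) (Ioi 0) :=
  fun _ hx => (hasDerivAt_funG hn hf ha hx).continuousAt.continuousWithinAt

lemma funG_self (N : ℕ) (f : ℝ → ℝ) (a : ℝ) : funG N f a a = 0 := by simp [funG]

lemma strictMonoOn_funG (hn : 1 ≤ n) (hf : CondF1 f) (ha : 0 < a) :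
    StrictMonoOn (funG (n + 1) f a) (Ioi 0) :=
  strictMonoOn_of_deriv_pos (convex_Ioi 0) (continuousOn_funG hn hf ha) fun x hx => by
    rw [interior_Ioi] at hx
    rw [(hasDerivAt_funG hn hf ha hx).deriv]
    exact Real.rpow_pos_of_pos (scaledF_pos hn hf hx) _

/-- The integral in `CondF2` differs from `G` by a positive constant factor and a change of base
point. -/
lemma tendsto_funG (hn : 1 ≤ n) (hf : CondF1 f) (hf2 : CondF2 (n + 1) f) (ha : 0 < a) :
    Tendsto (funG (n + 1) f a) atTop atTop := by
  obtain ⟨b, hb, hlim⟩ := hf2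
  simp only [exponent_gamma] at hlim
  set e : ℝ := -((n : ℝ) / (2 * n + 1))
  have hc : 0 < ((2 * (n : ℝ) + 1) / n) ^ e := by positivity
  have h1 := tendsto_atTop_add_const_left atTop (∫ τ in a..b, scaledF n f τ ^ e)
    (hlim.const_mul_atTop hc)
  refine h1.congr' ?_
  filter_upwards [eventually_ge_atTop b] with t ht
  have ht0 : 0 < t := hb.trans_le ht
  have hcont := continuousOn_scaledF_rpow hn hf e
  rw [funG_succ, ← intervalIntegral.integral_add_adjacent_intervals
    (intervalIntegrable_of_continuousOn_Ioi hcont ha hb)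
    (intervalIntegrable_of_continuousOn_Ioi hcont hb ht0), ← intervalIntegral.integral_const_mul]
  congr 1
  refine intervalIntegral.integral_congr fun τ hτ => ?_
  have hτ0 : 0 < τ := ordConnected_Ioi.uIcc_subset hb ht0 hτ
  simp only [scaledF]
  rw [Real.mul_rpow (by positivity) (primF_pos hf hτ0).le]

lemma exists_funG_eq (hn : 1 ≤ n) (hf : CondF1 f) (hf2 : CondF2 (n + 1) f) (ha : 0 < a)
    (hs : 0 ≤ s) : ∃ t ∈ Ici a, funG (n + 1) f a t = s := by
  obtain ⟨T, hT, hsT⟩ := ((eventually_ge_atTop a).and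
    ((tendsto_funG hn hf hf2 ha).eventually_ge_atTop s)).exists
  obtain ⟨t, ht, hts⟩ := intermediate_value_Icc hT
    ((continuousOn_funG hn hf ha).mono fun x hx => ha.trans_le hx.1)
    (show s ∈ Icc (funG (n + 1) f a a) (funG (n + 1) f a T) from ⟨by rwa [funG_self], hsT⟩)
  exact ⟨t, ht.1, hts⟩

lemma le_fung (hn : 1 ≤ n) (hf : CondF1 f) (hf2 : CondF2 (n + 1) f) (ha : 0 < a)
    (hs : 0 ≤ s) : a ≤ fung (n + 1) f a s :=
  Function.invFunOn_mem (exists_funG_eq hn hf hf2 ha hs)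

lemma fung_pos (hn : 1 ≤ n) (hf : CondF1 f) (hf2 : CondF2 (n + 1) f) (ha : 0 < a)
    (hs : 0 ≤ s) : 0 < fung (n + 1) f a s := ha.trans_le (le_fung hn hf hf2 ha hs)

lemma funG_fung (hn : 1 ≤ n) (hf : CondF1 f) (hf2 : CondF2 (n + 1) f) (ha : 0 < a)
    (hs : 0 ≤ s) : funG (n + 1) f a (fung (n + 1) f a s) = s :=
  Function.invFunOn_eq (exists_funG_eq hn hf hf2 ha hs)

lemma fung_funG (hn : 1 ≤ n) (hf : CondF1 f) (ha : 0 < a) (ht : a ≤ t) :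
    fung (n + 1) f a (funG (n + 1) f a t) = t := by
  refine (((strictMonoOn_funG hn hf ha).mono fun x hx =>
    ha.trans_le hx).injOn.leftInvOn_invFunOn) (show t ∈ Ici a from ht)

lemma lt_fung (hn : 1 ≤ n) (hf : CondF1 f) (hf2 : CondF2 (n + 1) f) (ha : 0 < a)
    (hs : 0 < s) : a < fung (n + 1) f a s := by
  refine (le_fung hn hf hf2 ha hs.le).lt_of_ne fun h => hs.ne ?_
  rw [← funG_fung hn hf hf2 ha hs.le, ← h, funG_self]

lemma strictMonoOn_fung (hn : 1 ≤ n) (hf : CondF1 f) (hf2 : CondF2 (n + 1) f) (ha : 0 < a) :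
    StrictMonoOn (fung (n + 1) f a) (Ici 0) := by
  intro s hs t ht hst
  rwa [← (strictMonoOn_funG hn hf ha).lt_iff_lt (fung_pos hn hf hf2 ha hs)
    (fung_pos hn hf hf2 ha ht), funG_fung hn hf hf2 ha hs, funG_fung hn hf hf2 ha ht]

lemma tendsto_fung (hn : 1 ≤ n) (hf : CondF1 f) (hf2 : CondF2 (n + 1) f) (ha : 0 < a) :
    Tendsto (fung (n + 1) f a) atTop atTop := by
  refine tendsto_atTop.2 fun M => ?_
  have hM : a ≤ max M a := le_max_right _ _
  have h0 : 0 ≤ funG (n + 1) f a (max M a) := by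
    rw [← funG_self (n + 1) f a]
    exact (strictMonoOn_funG hn hf ha).monotoneOn ha (ha.trans_le hM) hM
  filter_upwards [eventually_ge_atTop (funG (n + 1) f a (max M a))] with s hs
  have := (strictMonoOn_fung hn hf hf2 ha).monotoneOn h0 (h0.trans hs) hs
  rw [fung_funG hn hf ha hM] at this
  exact (le_max_left _ _).trans this

/-- The condition `0 < s` puts `g(s)` strictly above `a`, so that `g` inverts `G` on a whole
neighbourhood of it. -/
lemma hasDerivAt_fung (hn : 1 ≤ n) (hf : CondF1 f) (hf2 : CondF2 (n + 1) f) (ha : 0 < a)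
    (hs : 0 < s) :
    HasDerivAt (fung (n + 1) f a)
      (scaledF n f (fung (n + 1) f a s) ^ ((n : ℝ) / (2 * n + 1))) s := by
  have hat := lt_fung hn hf hf2 ha hs
  have ht := ha.trans hat
  have hpos := scaledF_pos hn hf ht
  have h := (hasStrictDerivAt_funG hn hf ha ht).to_local_left_inverse
    (Real.rpow_pos_of_pos hpos _).ne' (g := fung (n + 1) f a) (by
      filter_upwards [lt_mem_nhds hat] with x hx using fung_funG hn hf ha hx.le)
  rw [funG_fung hn hf hf2 ha hs.le, Real.rpow_neg hpos.le, inv_inv] at h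
  exact h.hasDerivAt

/-- The normalisation of `scaledF` makes the numerical constant `(2n+1)/n · n/(2n+1)` equal to `1`.
-/
lemma hasDerivAt_deriv_fung (hn : 1 ≤ n) (hf : CondF1 f) (hf2 : CondF2 (n + 1) f) (ha : 0 < a)
    (hs : 0 < s) :
    HasDerivAt (fun s => scaledF n f (fung (n + 1) f a s) ^ ((n : ℝ) / (2 * n + 1)))
      (scaledF n f (fung (n + 1) f a s) ^ (2 * ((n : ℝ) / (2 * n + 1)) - 1)
        * f (fung (n + 1) f a s)) s := by
  have ht := fung_pos hn hf hf2 ha hs.le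
  have hpos := scaledF_pos hn hf ht
  refine ((hasDerivAt_scaledF_rpow hn hf ht ((n : ℝ) / (2 * n + 1))).comp s
    (hasDerivAt_fung hn hf hf2 ha hs)).congr_deriv ?_
  rw [show 2 * ((n : ℝ) / (2 * n + 1)) - 1
    = ((n : ℝ) / (2 * n + 1) - 1) + (n : ℝ) / (2 * n + 1) by ring, Real.rpow_add hpos]
  have : (n : ℝ) ≠ 0 := by positivity
  field_simp

/-- A function with two explicit continuous derivatives on an open set is `C²` there. -/
lemma contDiffOn_two_of_hasDerivAt {u u' u'' : ℝ → ℝ} {S : Set ℝ} (hS : IsOpen S)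
    (h1 : ∀ x ∈ S, HasDerivAt u (u' x) x) (h2 : ∀ x ∈ S, HasDerivAt u' (u'' x) x)
    (h3 : ContinuousOn u'' S) : ContDiffOn ℝ 2 u S := by
  have hu' : ContDiffOn ℝ 1 u' S := by
    rw [← zero_add (1 : WithTop ℕ∞), contDiffOn_succ_iff_deriv_of_isOpen hS]
    exact ⟨fun x hx => (h2 x hx).differentiableAt.differentiableWithinAt, by simp,
      contDiffOn_zero.2 (h3.congr fun x hx => (h2 x hx).deriv)⟩
  rw [← one_add_one_eq_two, contDiffOn_succ_iff_deriv_of_isOpen hS]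
  exact ⟨fun x hx => (h1 x hx).differentiableAt.differentiableWithinAt, by simp,
    hu'.congr fun x hx => (h1 x hx).deriv⟩

/-- With `σ = (n+1)/(2n+1)` the derivative of `scaledF^σ` is `(n+1)/n · f · G'`. Freezing `f` at
`τ`, where it is largest on `[a,τ]`, and integrating gives the bound. It is an upper bound for
`1/H`. -/
lemma scaledF_rpow_sigma_le (hn : 1 ≤ n) (hf : CondF1 f) (ha : 0 < a) (hτ : a ≤ τ) :
    scaledF n f τ ^ (((n : ℝ) + 1) / (2 * n + 1))
      ≤ scaledF n f a ^ (((n : ℝ) + 1) / (2 * n + 1))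
        + ((n : ℝ) + 1) / n * (f τ * funG (n + 1) f a τ) := by
  have hn0 : (n : ℝ) ≠ 0 := by positivity
  have hd : ∀ x, 0 < x → HasDerivAt
      (fun x => scaledF n f x ^ (((n : ℝ) + 1) / (2 * n + 1))
        - ((n : ℝ) + 1) / n * (f τ * funG (n + 1) f a x))
      (((n : ℝ) + 1) / n * ((f x - f τ) * scaledF n f x ^ (-((n : ℝ) / (2 * n + 1))))) x := by
    intro x hx
    refine ((hasDerivAt_scaledF_rpow hn hf hx _).sub
      (((hasDerivAt_funG hn hf ha hx).const_mul (f τ)).const_mul _)).congr_deriv ?_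
    rw [show ((n : ℝ) + 1) / (2 * n + 1) - 1 = -((n : ℝ) / (2 * n + 1)) by field_simp; ring]
    field_simp
  have hsub : ∀ x ∈ Icc a τ, 0 < x := fun x hx => ha.trans_le hx.1
  have hanti := antitoneOn_of_deriv_nonpos (convex_Icc a τ)
    (fun x hx => (hd x (hsub x hx)).continuousAt.continuousWithinAt)
    (fun x hx => (hd x (hsub x (interior_subset hx))).differentiableAt.differentiableWithinAt)
    (fun x hx => by
      have hx' := interior_subset hx
      have hx0 := hsub x hx'
      rw [(hd x hx0).deriv]
      refine mul_nonpos_of_nonneg_of_nonpos (by positivity)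
        (mul_nonpos_of_nonpos_of_nonneg (sub_nonpos.2 (hf.2.1 hx0 (ha.trans_le hτ) hx'.2))
          (Real.rpow_nonneg (scaledF_pos hn hf hx0).le _)))
  have := hanti (left_mem_Icc.2 hτ) (right_mem_Icc.2 hτ) hτ
  simp only [funG_self, mul_zero, sub_zero] at this
  linarith

/-- At `τ = g(s)` one has `G(τ) = s`, so the right side becomes the reciprocal of `recipH`. -/
lemma funH_succ (hn : 1 ≤ n) (hf : CondF1 f) (ha : 0 < a) (hτ : 0 < τ) :
    funH (n + 1) f a τ = funG (n + 1) f a τ * f τ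
      / scaledF n f τ ^ (((n : ℝ) + 1) / (2 * n + 1)) := by
  have hpos := scaledF_pos hn hf hτ
  have hn0 : (n : ℝ) ≠ 0 := by positivity
  have he : deriv (funG (n + 1) f a) =ᶠ[𝓝 τ]
      fun x => scaledF n f x ^ (-((n : ℝ) / (2 * n + 1))) := by
    filter_upwards [lt_mem_nhds hτ] with x hx using (hasDerivAt_funG hn hf ha hx).deriv
  rw [funH, he.deriv_eq, (hasDerivAt_scaledF_rpow hn hf hτ _).deriv, he.eq_of_nhds,
    ← Real.rpow_natCast, ← Real.rpow_mul hpos.le]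
  have e1 : scaledF n f τ ^ (-((n : ℝ) / (2 * n + 1)) - 1)
      = scaledF n f τ ^ (-((n : ℝ) / (2 * n + 1)) * ((2 : ℕ) : ℝ))
        / scaledF n f τ ^ (((n : ℝ) + 1) / (2 * n + 1)) := by
    rw [← Real.rpow_sub hpos]
    congr 1
    push_cast; field_simp; ring
  rw [e1]
  have h1 : 0 < scaledF n f τ ^ (-((n : ℝ) / (2 * n + 1)) * ((2 : ℕ) : ℝ)) := by positivity
  have h2 : 0 < scaledF n f τ ^ (((n : ℝ) + 1) / (2 * n + 1)) := by positivity
  generalize scaledF n f τ ^ (-((n : ℝ) / (2 * n + 1)) * ((2 : ℕ) : ℝ)) = x at *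
  generalize scaledF n f τ ^ (((n : ℝ) + 1) / (2 * n + 1)) = y at *
  field_simp

end KellerOsserman

section Weight

/-! ### The function `φ` of a weight -/

/-- A continuous positive nonincreasing weight on `(0,∞)`. -/
structure IsWeight (q : ℝ → ℝ) : Prop where
  cont : ContinuousOn q (Ioi 0)
  pos : ∀ t, 0 < t → 0 < q t
  anti : AntitoneOn q (Ioi 0)

variable {n : ℕ} {p q q₁ q₂ : ℝ → ℝ} {s t τ : ℝ}

lemma BlowUp.ClassP.isWeight {N : ℕ} (hp : ClassP N p) : IsWeight p where
  cont := hp.1.continuousOn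
  pos := hp.2.1
  anti := antitoneOn_of_deriv_nonpos (convex_Ioi 0) hp.1.continuousOn
    ((hp.1.differentiableOn (by norm_num)).mono interior_subset)
    fun x hx => (hp.2.2.1 x (interior_subset hx)).le

lemma IsWeight.comp_two_mul (hq : IsWeight q) : IsWeight fun t => q (2 * t) where
  cont := hq.cont.comp (by fun_prop) fun t (ht : 0 < t) => show 0 < 2 * t by positivity
  pos t ht := hq.pos _ (by positivity)
  anti s hs t ht hst := hq.anti (show 0 < 2 * s from mul_pos two_pos hs)
    (show 0 < 2 * t from mul_pos two_pos ht) (by linarith)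

lemma hasDerivAt_integral_left_Ioi {g : ℝ → ℝ} (hg : ContinuousOn g (Ioi 0))
    (ht : 0 < t) : HasDerivAt (fun t => ∫ x in t..1, g x) (-g t) t := by
  have h := (hasStrictDerivAt_primitive_Ioi hg one_pos ht).hasDerivAt.neg
  exact h.congr_of_eventuallyEq
    (Eventually.of_forall fun x => intervalIntegral.integral_symm 1 x)

namespace IsWeight

lemma hasDerivAt_funP (hq : IsWeight q) (ht : 0 < t) : HasDerivAt (funP q) (-q t) t :=
  hasDerivAt_integral_left_Ioi hq.cont ht

lemma funP_pos (hq : IsWeight q) (ht : t ∈ Ioo (0 : ℝ) 1) : 0 < funP q t :=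
  intervalIntegral.intervalIntegral_pos_of_pos_on
    (intervalIntegrable_of_continuousOn_Ioi hq.cont ht.1 one_pos)
    (fun x hx => hq.pos x (ht.1.trans hx.1)) ht.2

lemma funP_nonneg (hq : IsWeight q) (ht : t ∈ Ioc (0 : ℝ) 1) : 0 ≤ funP q t :=
  intervalIntegral.integral_nonneg ht.2 fun x hx => (hq.pos x (ht.1.trans_le hx.1)).le

lemma funP_le (hq : IsWeight q) (ht : t ∈ Ioc (0 : ℝ) 1) : funP q t ≤ q t := by
  have h := intervalIntegral.integral_mono_on (μ := volume) (f := q) (g := fun _ => q t) ht.2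
    (intervalIntegrable_of_continuousOn_Ioi hq.cont ht.1 one_pos) (by simp)
    fun x hx => hq.anti ht.1 (ht.1.trans_le hx.1) hx.1
  rw [intervalIntegral.integral_const, smul_eq_mul] at h
  have := hq.pos t ht.1
  exact h.trans (mul_le_of_le_one_left this.le (by linarith [ht.1]))

lemma funP_anti (hq : IsWeight q) (hs : 0 < s) (hst : s ≤ t) : funP q t ≤ funP q s := by
  have ht := hs.trans_le hst
  rw [funP, funP, ← intervalIntegral.integral_add_adjacent_intervals
    (intervalIntegrable_of_continuousOn_Ioi hq.cont hs ht)
    (intervalIntegrable_of_continuousOn_Ioi hq.cont ht one_pos)]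
  have : 0 ≤ ∫ x in s..t, q x :=
    intervalIntegral.integral_nonneg hst fun x hx => (hq.pos x (hs.trans_le hx.1)).le
  linarith

lemma funP_mono (h₁ : IsWeight q₁) (h₂ : IsWeight q₂) (hle : ∀ t, 0 < t → q₁ t ≤ q₂ t)
    (ht : t ∈ Ioc (0 : ℝ) 1) : funP q₁ t ≤ funP q₂ t :=
  intervalIntegral.integral_mono_on ht.2
    (intervalIntegrable_of_continuousOn_Ioi h₁.cont ht.1 one_pos)
    (intervalIntegrable_of_continuousOn_Ioi h₂.cont ht.1 one_pos)
    fun x hx => hle x (ht.1.trans_le hx.1)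

end IsWeight

/-- `N/(N-1) P` for `N = n + 1`. -/
noncomputable def scaledP (n : ℕ) (q : ℝ → ℝ) (t : ℝ) : ℝ := ((n : ℝ) + 1) / n * funP q t

lemma funPhi_succ (n : ℕ) (q : ℝ → ℝ) (t : ℝ) :
    funPhi (n + 1) q t = ∫ τ in t..1, scaledP n q τ ^ ((n : ℝ) / (n + 1)) := by
  simp only [funPhi, scaledP]
  push_cast
  simp only [add_sub_cancel_right]

namespace IsWeight

lemma scaledP_pos (hn : 1 ≤ n) (hq : IsWeight q) (ht : t ∈ Ioo (0 : ℝ) 1) :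
    0 < scaledP n q t := mul_pos (by positivity) (hq.funP_pos ht)

lemma scaledP_nonneg (hq : IsWeight q) (ht : t ∈ Ioc (0 : ℝ) 1) :
    0 ≤ scaledP n q t := mul_nonneg (by positivity) (hq.funP_nonneg ht)

lemma hasDerivAt_scaledP (hq : IsWeight q) (ht : 0 < t) :
    HasDerivAt (scaledP n q) (((n : ℝ) + 1) / n * -q t) t :=
  (hq.hasDerivAt_funP ht).const_mul _

lemma continuousOn_scaledP_rpow (hq : IsWeight q) :
    ContinuousOn (fun t => scaledP n q t ^ ((n : ℝ) / (n + 1))) (Ioi 0) :=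
  ContinuousOn.rpow_const
    (fun _ hx => (hq.hasDerivAt_scaledP hx).continuousAt.continuousWithinAt)
    fun _ _ => Or.inr (by positivity)

lemma hasDerivAt_funPhi (hq : IsWeight q) (ht : 0 < t) :
    HasDerivAt (funPhi (n + 1) q) (-scaledP n q t ^ ((n : ℝ) / (n + 1))) t := by
  have := hasDerivAt_integral_left_Ioi (hq.continuousOn_scaledP_rpow (n := n)) ht
  simpa only [← funPhi_succ] using this

lemma hasDerivAt_scaledP_rpow (hn : 1 ≤ n) (hq : IsWeight q) (ht : t ∈ Ioo (0 : ℝ) 1) :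
    HasDerivAt (fun t => scaledP n q t ^ ((n : ℝ) / (n + 1)))
      (-(scaledP n q t ^ ((n : ℝ) / (n + 1) - 1) * q t)) t := by
  have hn0 : (n : ℝ) ≠ 0 := by positivity
  refine ((hq.hasDerivAt_scaledP ht.1).rpow_const
    (Or.inl (hq.scaledP_pos hn ht).ne')).congr_deriv ?_
  field_simp

lemma funPhi_pos (hn : 1 ≤ n) (hq : IsWeight q) (ht : t ∈ Ioo (0 : ℝ) 1) :
    0 < funPhi (n + 1) q t := by
  rw [funPhi_succ]
  exact intervalIntegral.intervalIntegral_pos_of_pos_on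
    (intervalIntegrable_of_continuousOn_Ioi hq.continuousOn_scaledP_rpow ht.1 one_pos)
    (fun x hx => Real.rpow_pos_of_pos (hq.scaledP_pos hn ⟨ht.1.trans hx.1, hx.2⟩) _) ht.2

lemma funPhi_anti (hq : IsWeight q) (hs : 0 < s) (hst : s ≤ t) (ht1 : t ≤ 1) :
    funPhi (n + 1) q t ≤ funPhi (n + 1) q s := by
  have ht := hs.trans_le hst
  have hc := hq.continuousOn_scaledP_rpow (n := n)
  rw [funPhi_succ, funPhi_succ, ← intervalIntegral.integral_add_adjacent_intervals
    (intervalIntegrable_of_continuousOn_Ioi hc hs ht)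
    (intervalIntegrable_of_continuousOn_Ioi hc ht one_pos)]
  have : 0 ≤ ∫ x in s..t, scaledP n q x ^ ((n : ℝ) / (n + 1)) :=
    intervalIntegral.integral_nonneg hst fun x hx => Real.rpow_nonneg
      (hq.scaledP_nonneg ⟨hs.trans_le hx.1, hx.2.trans ht1⟩) _
  linarith

lemma funPhi_mono (h₁ : IsWeight q₁) (h₂ : IsWeight q₂) (hle : ∀ t, 0 < t → q₁ t ≤ q₂ t)
    (ht : t ∈ Ioc (0 : ℝ) 1) : funPhi (n + 1) q₁ t ≤ funPhi (n + 1) q₂ t := by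
  rw [funPhi_succ, funPhi_succ]
  refine intervalIntegral.integral_mono_on ht.2
    (intervalIntegrable_of_continuousOn_Ioi h₁.continuousOn_scaledP_rpow ht.1 one_pos)
    (intervalIntegrable_of_continuousOn_Ioi h₂.continuousOn_scaledP_rpow ht.1 one_pos)
    fun x hx => ?_
  have hx' : x ∈ Ioc (0 : ℝ) 1 := ⟨ht.1.trans_le hx.1, hx.2⟩
  refine Real.rpow_le_rpow (h₁.scaledP_nonneg hx') ?_ (by positivity)
  exact mul_le_mul_of_nonneg_left (funP_mono h₁ h₂ hle hx') (by positivity)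

/-- `(φ')² ≤ C φ φ''` in terms of `P`. -/
lemma scaledP_rpow_le (hn : 1 ≤ n) (hq : IsWeight q) (ht : t ∈ Ioo (0 : ℝ) 1) :
    scaledP n q t ^ ((2 * (n : ℝ) + 1) / (n + 1))
      ≤ (2 * (n : ℝ) + 1) / n * (q t * funPhi (n + 1) q t) := by
  have hn0 : (n : ℝ) ≠ 0 := by positivity
  have he : 1 ≤ (2 * (n : ℝ) + 1) / (n + 1) := by
    rw [le_div_iff₀ (by positivity)]; linarith [(by positivity : (0 : ℝ) ≤ n)]
  -- The weight is frozen at `t`, where it is largest on `[t,1]`. The resulting difference is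
  -- nonincreasing in `x` and vanishes at `x = 1`, hence is nonnegative at `x = t`.
  have hd : ∀ x, 0 < x → HasDerivAt
      (fun x => (2 * (n : ℝ) + 1) / n * (q t * funPhi (n + 1) q x)
        - scaledP n q x ^ ((2 * (n : ℝ) + 1) / (n + 1)))
      ((2 * (n : ℝ) + 1) / n * ((q x - q t) * scaledP n q x ^ ((n : ℝ) / (n + 1)))) x := by
    intro x hx
    refine ((((hq.hasDerivAt_funPhi hx).const_mul (q t)).const_mul _).sub
      ((hq.hasDerivAt_scaledP hx).rpow_const (Or.inr he))).congr_deriv ?_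
    rw [show (2 * (n : ℝ) + 1) / (n + 1) - 1 = (n : ℝ) / (n + 1) by field_simp; ring]
    field_simp
    ring
  have hanti := antitoneOn_of_deriv_nonpos (convex_Icc t 1)
    (fun x hx => (hd x (ht.1.trans_le hx.1)).continuousAt.continuousWithinAt)
    (fun x hx => (hd x (ht.1.trans_le
      (interior_subset hx).1)).differentiableAt.differentiableWithinAt)
    (fun x hx => by
      have hx' := interior_subset hx
      have hx0 := ht.1.trans_le hx'.1
      rw [(hd x hx0).deriv]
      exact mul_nonpos_of_nonneg_of_nonpos (by positivity)
        (mul_nonpos_of_nonpos_of_nonneg (sub_nonpos.2 (hq.anti ht.1 hx0 hx'.1))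
          (Real.rpow_nonneg (hq.scaledP_nonneg ⟨hx0, hx'.2⟩) _)))
  have := hanti (left_mem_Icc.2 ht.2.le) (right_mem_Icc.2 ht.2.le) ht.2.le
  have h1 : scaledP n q 1 = 0 := by simp [scaledP, funP]
  have h2 : funPhi (n + 1) q 1 = 0 := by simp [funPhi]
  simp only [h1, h2, mul_zero, Real.zero_rpow (by positivity : (2 * (n : ℝ) + 1) / (n + 1) ≠ 0),
    sub_zero] at this
  linarith

lemma scaledP_le (hq : IsWeight q) (ht : t ∈ Ioc (0 : ℝ) 1) :
    scaledP n q t ≤ ((n : ℝ) + 1) / n * q t :=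
  mul_le_mul_of_nonneg_left (hq.funP_le ht) (by positivity)

end IsWeight

/-- Rescaling gives half the integral of `q` from `2t` to `2`; the part beyond `1` is dropped. -/
lemma half_funP_le (hq : IsWeight q) (ht : t ∈ Ioc (0 : ℝ) (1 / 2)) :
    1 / 2 * funP q (2 * t) ≤ funP (fun t => q (2 * t)) t := by
  have ht2 : 0 < 2 * t := mul_pos two_pos ht.1
  have h : funP (fun t => q (2 * t)) t = 1 / 2 * ∫ x in (2 * t)..2, q x := by
    rw [funP, intervalIntegral.integral_comp_mul_left q two_ne_zero]
    simp
  rw [h, funP, ← intervalIntegral.integral_add_adjacent_intervals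
    (intervalIntegrable_of_continuousOn_Ioi hq.cont ht2 one_pos)
    (intervalIntegrable_of_continuousOn_Ioi hq.cont one_pos two_pos)]
  have : 0 ≤ ∫ x in (1 : ℝ)..2, q x := intervalIntegral.integral_nonneg one_le_two
    fun x hx => (hq.pos x (one_pos.trans_le hx.1)).le
  linarith

/-- For `p ∈ 𝒫_∞` the function `φ` of the weight `p(2·)` blows up at the origin. -/
lemma tendsto_funPhi_two_mul (hn : 1 ≤ n) (hp : ClassP (n + 1) p) :
    Tendsto (funPhi (n + 1) fun t => p (2 * t)) (𝓝[>] 0) atTop := by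
  have hq := hp.isWeight
  have hq₂ := hq.comp_two_mul
  have hlim := hp.2.2.2.2
  have he : (((n + 1 : ℕ) : ℝ) - 1) / ((n + 1 : ℕ) : ℝ) = (n : ℝ) / (n + 1) := by
    push_cast; rw [add_sub_cancel_right]
  simp only [he] at hlim
  set β : ℝ := (n : ℝ) / (n + 1) with hβ
  have hβ0 : 0 ≤ β := by positivity
  -- `C` joins the factor in `scaledP` to the `1/2` of `half_funP_le`; the other `1/2` below is the
  -- Jacobian of `τ ↦ 2τ`.
  set C : ℝ := ((n : ℝ) + 1) / n * (1 / 2) with hC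
  have hC0 : 0 < C := by positivity
  have htwo : Tendsto (fun t : ℝ => 2 * t) (𝓝[>] 0) (𝓝[>] 0) := by
    refine tendsto_nhdsWithin_iff.2 ⟨?_, ?_⟩
    · have : Tendsto (fun t : ℝ => 2 * t) (𝓝 0) (𝓝 (2 * 0)) :=
        (continuous_const.mul continuous_id).tendsto 0
      rw [mul_zero] at this
      exact this.mono_left nhdsWithin_le_nhds
    · filter_upwards [self_mem_nhdsWithin] with t (ht : 0 < t) using mul_pos two_pos ht
  have h1 := (hlim.comp htwo).const_mul_atTop (by positivity : 0 < C ^ β * (1 / 2))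
  refine tendsto_atTop_mono' _ ?_ h1
  filter_upwards [Ioo_mem_nhdsGT (show (0 : ℝ) < 1 / 2 by norm_num)] with t ht
  have ht2 : 0 < 2 * t := mul_pos two_pos ht.1
  have hhalf : (0 : ℝ) < 1 / 2 := by norm_num
  have hPc : ContinuousOn (fun τ => funP p τ ^ β) (Ioi 0) := ContinuousOn.rpow_const
    (fun x hx => (hq.hasDerivAt_funP hx).continuousAt.continuousWithinAt) fun _ _ => Or.inr hβ0
  have hQc := hq₂.continuousOn_scaledP_rpow (n := n)
  have hPc2 : ContinuousOn (fun τ => C ^ β * funP p (2 * τ) ^ β) (Ioi 0) :=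
    continuousOn_const.mul (hPc.comp (by fun_prop) fun x (hx : 0 < x) =>
      show 0 < 2 * x by positivity)
  have e1 : C ^ β * (1 / 2) * ((fun δ => ∫ τ in δ..1, funP p τ ^ β) ∘ fun t => 2 * t) t
      = ∫ τ in t..(1 / 2), C ^ β * funP p (2 * τ) ^ β := by
    rw [intervalIntegral.integral_const_mul,
      intervalIntegral.integral_comp_mul_left (fun τ => funP p τ ^ β) two_ne_zero]
    simp; ring
  have e2 : ∫ τ in t..(1 / 2), C ^ β * funP p (2 * τ) ^ β
      ≤ ∫ τ in t..(1 / 2), scaledP n (fun t => p (2 * t)) τ ^ β := by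
    refine intervalIntegral.integral_mono_on ht.2.le
      (intervalIntegrable_of_continuousOn_Ioi hPc2 ht.1 hhalf)
      (intervalIntegrable_of_continuousOn_Ioi hQc ht.1 hhalf) fun x hx => ?_
    have hx' : x ∈ Ioc (0 : ℝ) (1 / 2) := ⟨ht.1.trans_le hx.1, hx.2⟩
    have hP0 : 0 ≤ funP p (2 * x) :=
      hq.funP_nonneg ⟨mul_pos two_pos hx'.1, by linarith [hx'.2]⟩
    rw [← Real.mul_rpow hC0.le hP0]
    refine Real.rpow_le_rpow (mul_nonneg hC0.le hP0) ?_ hβ0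
    rw [hC, mul_assoc, scaledP]
    exact mul_le_mul_of_nonneg_left (half_funP_le hq hx') (by positivity)
  have e3 : 0 ≤ ∫ τ in (1 / 2 : ℝ)..1, scaledP n (fun t => p (2 * t)) τ ^ β :=
    intervalIntegral.integral_nonneg (by norm_num) fun x hx => Real.rpow_nonneg
      (hq₂.scaledP_nonneg ⟨hhalf.trans_le hx.1, hx.2⟩) _
  rw [e1, funPhi_succ, ← intervalIntegral.integral_add_adjacent_intervals
    (intervalIntegrable_of_continuousOn_Ioi hQc ht.1 hhalf)
    (intervalIntegrable_of_continuousOn_Ioi hQc hhalf one_pos)]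
  linarith

end Weight

section Barrier

/-! ### The barriers -/

variable {n : ℕ} {f q q₁ q₂ : ℝ → ℝ} {a k k₁ k₂ r : ℝ}

/-- The argument `k φ((1-r²)/2)^{N/(2N-1)}` of `g` in the barrier. -/
noncomputable def barrierArg (n : ℕ) (q : ℝ → ℝ) (k r : ℝ) : ℝ :=
  k * funPhi (n + 1) q ((1 - r ^ 2) / 2) ^ (((n : ℝ) + 1) / (2 * n + 1))

/-- The derivative of `barrierArg`, divided by `r`. -/
noncomputable def barrierSlope (n : ℕ) (q : ℝ → ℝ) (k r : ℝ) : ℝ :=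
  k * (((n : ℝ) + 1) / (2 * n + 1))
    * funPhi (n + 1) q ((1 - r ^ 2) / 2) ^ (((n : ℝ) + 1) / (2 * n + 1) - 1)
    * scaledP n q ((1 - r ^ 2) / 2) ^ ((n : ℝ) / (n + 1))

/-- The derivative of `barrierSlope`, divided by `r`. -/
noncomputable def barrierCurv (n : ℕ) (q : ℝ → ℝ) (k r : ℝ) : ℝ :=
  k * (((n : ℝ) + 1) / (2 * n + 1))
    * ((((n : ℝ) + 1) / (2 * n + 1) - 1)
        * funPhi (n + 1) q ((1 - r ^ 2) / 2) ^ (((n : ℝ) + 1) / (2 * n + 1) - 1 - 1)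
        * (scaledP n q ((1 - r ^ 2) / 2) ^ ((n : ℝ) / (n + 1))) ^ 2
      + funPhi (n + 1) q ((1 - r ^ 2) / 2) ^ (((n : ℝ) + 1) / (2 * n + 1) - 1)
        * (scaledP n q ((1 - r ^ 2) / 2) ^ ((n : ℝ) / (n + 1) - 1) * q ((1 - r ^ 2) / 2)))

lemma barrier_succ (n : ℕ) (f : ℝ → ℝ) (a : ℝ) (q : ℝ → ℝ) (k r : ℝ) :
    barrier (n + 1) f a q k r = fung (n + 1) f a (barrierArg n q k r) := by
  have h : ((n + 1 : ℕ) : ℝ) / (2 * ((n + 1 : ℕ) : ℝ) - 1) = ((n : ℝ) + 1) / (2 * n + 1) := by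
    push_cast; congr 1; ring
  rw [barrier, barrierArg, h]

/-- The barriers depend on `r²` only. Working on `(-1,1)` makes `r = 0` an interior point and gives
regularity there without a separate argument. -/
lemma depth_mem (hr : r ∈ Ioo (-1 : ℝ) 1) : (1 - r ^ 2) / 2 ∈ Ioo (0 : ℝ) 1 := by
  constructor <;> nlinarith [hr.1, hr.2, sq_nonneg r]

lemma depth_le_half (r : ℝ) : (1 - r ^ 2) / 2 ≤ 1 / 2 := by nlinarith [sq_nonneg r]

lemma hasDerivAt_depth (r : ℝ) : HasDerivAt (fun r : ℝ => (1 - r ^ 2) / 2) (-r) r :=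
  (((hasDerivAt_pow 2 r).const_sub 1).div_const 2).congr_deriv (by simp; ring)

lemma barrierArg_pos (hn : 1 ≤ n) (hq : IsWeight q) (hk : 0 < k) (hr : r ∈ Ioo (-1 : ℝ) 1) :
    0 < barrierArg n q k r :=
  mul_pos hk (Real.rpow_pos_of_pos (hq.funPhi_pos hn (depth_mem hr)) _)

lemma barrierSlope_pos (hn : 1 ≤ n) (hq : IsWeight q) (hk : 0 < k) (hr : r ∈ Ioo (-1 : ℝ) 1) :
    0 < barrierSlope n q k r := by
  have h1 := hq.funPhi_pos hn (depth_mem hr)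
  have h2 := hq.scaledP_pos hn (depth_mem hr)
  unfold barrierSlope
  positivity

lemma hasDerivAt_barrierArg (hn : 1 ≤ n) (hq : IsWeight q) (hr : r ∈ Ioo (-1 : ℝ) 1) :
    HasDerivAt (barrierArg n q k) (r * barrierSlope n q k r) r := by
  have ht := depth_mem hr
  have h1 := ((hq.hasDerivAt_funPhi (n := n) ht.1).comp r (hasDerivAt_depth r)).rpow_const
    (p := ((n : ℝ) + 1) / (2 * n + 1)) (Or.inl (hq.funPhi_pos hn ht).ne')
  refine (h1.const_mul k).congr_deriv ?_
  simp only [Function.comp_apply, barrierSlope]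
  ring

lemma hasDerivAt_barrierSlope (hn : 1 ≤ n) (hq : IsWeight q) (hr : r ∈ Ioo (-1 : ℝ) 1) :
    HasDerivAt (barrierSlope n q k) (r * barrierCurv n q k r) r := by
  have ht := depth_mem hr
  have h1 := ((hq.hasDerivAt_funPhi (n := n) ht.1).comp r (hasDerivAt_depth r)).rpow_const
    (p := ((n : ℝ) + 1) / (2 * n + 1) - 1) (Or.inl (hq.funPhi_pos hn ht).ne')
  have h2 := (hq.hasDerivAt_scaledP_rpow hn ht).comp r (hasDerivAt_depth r)
  refine ((h1.const_mul (k * (((n : ℝ) + 1) / (2 * n + 1)))).mul h2).congr_deriv ?_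
  simp only [Function.comp_apply, barrierCurv]
  ring

lemma continuousOn_barrierSlope (hn : 1 ≤ n) (hq : IsWeight q) :
    ContinuousOn (barrierSlope n q k) (Ioo (-1) 1) :=
  fun _ hr => (hasDerivAt_barrierSlope hn hq hr).continuousAt.continuousWithinAt

lemma continuousOn_barrierCurv (hn : 1 ≤ n) (hq : IsWeight q) :
    ContinuousOn (barrierCurv n q k) (Ioo (-1) 1) := by
  have hd : ContinuousOn (fun r : ℝ => (1 - r ^ 2) / 2) (Ioo (-1) 1) := by fun_prop
  have h_funPhi : ContinuousOn (funPhi (n + 1) q) (Ioi 0) :=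
    fun t ht => (hq.hasDerivAt_funPhi ht).continuousAt.continuousWithinAt
  have h_scaledP : ContinuousOn (scaledP n q) (Ioi 0) :=
    fun t ht => (hq.hasDerivAt_scaledP ht).continuousAt.continuousWithinAt
  have hφ : ContinuousOn (fun r : ℝ => funPhi (n + 1) q ((1 - r ^ 2) / 2)) (Ioo (-1) 1) :=
    h_funPhi.comp hd fun r hr => (depth_mem hr).1
  have hP : ContinuousOn (fun r : ℝ => scaledP n q ((1 - r ^ 2) / 2)) (Ioo (-1) 1) :=
    h_scaledP.comp hd fun r hr => (depth_mem hr).1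
  have hφ0 : ∀ r ∈ Ioo (-1 : ℝ) 1, funPhi (n + 1) q ((1 - r ^ 2) / 2) ≠ 0 :=
    fun r hr => (hq.funPhi_pos hn (depth_mem hr)).ne'
  have hP0 : ∀ r ∈ Ioo (-1 : ℝ) 1, scaledP n q ((1 - r ^ 2) / 2) ≠ 0 :=
    fun r hr => (hq.scaledP_pos hn (depth_mem hr)).ne'
  have hqc : ContinuousOn (fun r : ℝ => q ((1 - r ^ 2) / 2)) (Ioo (-1) 1) :=
    hq.cont.comp hd fun r hr => (depth_mem hr).1
  exact continuousOn_const.mul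
    (((continuousOn_const.mul (hφ.rpow_const fun r hr => Or.inl (hφ0 r hr))).mul
      ((hP.rpow_const fun r hr => Or.inl (hP0 r hr)).pow 2)).add
    ((hφ.rpow_const fun r hr => Or.inl (hφ0 r hr)).mul
      ((hP.rpow_const fun r hr => Or.inl (hP0 r hr)).mul hqc)))

/-- The derivative of the barrier. -/
noncomputable def barrierDeriv (n : ℕ) (f : ℝ → ℝ) (a : ℝ) (q : ℝ → ℝ) (k r : ℝ) : ℝ :=
  scaledF n f (barrier (n + 1) f a q k r) ^ ((n : ℝ) / (2 * n + 1))
    * (r * barrierSlope n q k r)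

/-- The second derivative of the barrier. -/
noncomputable def barrierDeriv₂ (n : ℕ) (f : ℝ → ℝ) (a : ℝ) (q : ℝ → ℝ) (k r : ℝ) : ℝ :=
  scaledF n f (barrier (n + 1) f a q k r) ^ (2 * ((n : ℝ) / (2 * n + 1)) - 1)
      * f (barrier (n + 1) f a q k r) * (r * barrierSlope n q k r) ^ 2
    + scaledF n f (barrier (n + 1) f a q k r) ^ ((n : ℝ) / (2 * n + 1))
      * (barrierSlope n q k r + r ^ 2 * barrierCurv n q k r)

lemma le_barrier (hn : 1 ≤ n) (hf : CondF1 f) (hf2 : CondF2 (n + 1) f) (ha : 0 < a)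
    (hq : IsWeight q) (hk : 0 < k) (hr : r ∈ Ioo (-1 : ℝ) 1) :
    a ≤ barrier (n + 1) f a q k r := by
  rw [barrier_succ]
  exact le_fung hn hf hf2 ha (barrierArg_pos hn hq hk hr).le

lemma barrier_pos (hn : 1 ≤ n) (hf : CondF1 f) (hf2 : CondF2 (n + 1) f) (ha : 0 < a)
    (hq : IsWeight q) (hk : 0 < k) (hr : r ∈ Ioo (-1 : ℝ) 1) :
    0 < barrier (n + 1) f a q k r := ha.trans_le (le_barrier hn hf hf2 ha hq hk hr)

lemma hasDerivAt_barrier (hn : 1 ≤ n) (hf : CondF1 f) (hf2 : CondF2 (n + 1) f) (ha : 0 < a)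
    (hq : IsWeight q) (hk : 0 < k) (hr : r ∈ Ioo (-1 : ℝ) 1) :
    HasDerivAt (barrier (n + 1) f a q k) (barrierDeriv n f a q k r) r := by
  have h := (hasDerivAt_fung hn hf hf2 ha (barrierArg_pos hn hq hk hr)).comp r
    (hasDerivAt_barrierArg hn hq hr)
  rw [← barrier_succ] at h
  exact h.congr_of_eventuallyEq (Eventually.of_forall fun x => barrier_succ n f a q k x)

lemma hasDerivAt_barrierDeriv (hn : 1 ≤ n) (hf : CondF1 f) (hf2 : CondF2 (n + 1) f)
    (ha : 0 < a) (hq : IsWeight q) (hk : 0 < k) (hr : r ∈ Ioo (-1 : ℝ) 1) :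
    HasDerivAt (barrierDeriv n f a q k) (barrierDeriv₂ n f a q k r) r := by
  have h1 := (hasDerivAt_deriv_fung hn hf hf2 ha (barrierArg_pos hn hq hk hr)).comp r
    (hasDerivAt_barrierArg hn hq hr)
  rw [← barrier_succ] at h1
  have h2 := (hasDerivAt_id' r).mul (hasDerivAt_barrierSlope (k := k) hn hq hr)
  have h3 := h1.mul h2
  refine (h3.congr_of_eventuallyEq (Eventually.of_forall fun x => ?_)).congr_deriv ?_
  · simp only [barrierDeriv, Pi.mul_apply, Function.comp_apply, barrier_succ]
  · simp only [barrierDeriv₂, Pi.mul_apply, Function.comp_apply, barrier_succ]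
    ring

lemma contDiffOn_barrier (hn : 1 ≤ n) (hf : CondF1 f) (hf2 : CondF2 (n + 1) f)
    (ha : 0 < a) (hq : IsWeight q) (hk : 0 < k) :
    ContDiffOn ℝ 2 (barrier (n + 1) f a q k) (Ioo (-1) 1) := by
  refine contDiffOn_two_of_hasDerivAt isOpen_Ioo
    (fun r hr => hasDerivAt_barrier hn hf hf2 ha hq hk hr)
    (fun r hr => hasDerivAt_barrierDeriv hn hf hf2 ha hq hk hr) ?_
  have hw : ContinuousOn (barrier (n + 1) f a q k) (Ioo (-1) 1) := fun r hr =>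
    (hasDerivAt_barrier hn hf hf2 ha hq hk hr).continuousAt.continuousWithinAt
  have hwp : MapsTo (barrier (n + 1) f a q k) (Ioo (-1) 1) (Ioi 0) := fun r hr =>
    barrier_pos hn hf hf2 ha hq hk hr
  have hF : ∀ e : ℝ, ContinuousOn (fun r => scaledF n f (barrier (n + 1) f a q k r) ^ e)
      (Ioo (-1) 1) := fun e => (continuousOn_scaledF_rpow hn hf e).comp hw hwp
  have hS := continuousOn_barrierSlope (k := k) hn hq
  exact (((hF _).mul (hf.continuousOn.comp hw hwp)).mul ((continuousOn_id.mul hS).pow 2)).add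
    ((hF _).mul (hS.add ((continuousOn_pow 2).mul (continuousOn_barrierCurv hn hq))))

lemma admissible_barrier (hn : 1 ≤ n) (hf : CondF1 f) (hf2 : CondF2 (n + 1) f)
    (ha : 0 < a) (hq : IsWeight q) (hk : 0 < k) : Admissible (barrier (n + 1) f a q k) := by
  have hsub : Ico (0 : ℝ) 1 ⊆ Ioo (-1) 1 := fun r hr => ⟨by linarith [hr.1], hr.2⟩
  refine ⟨(contDiffOn_barrier hn hf hf2 ha hq hk).mono hsub, ?_, fun r hr => ?_, fun r hr =>
    barrier_pos hn hf hf2 ha hq hk (hsub hr)⟩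
  · have h0 : (0 : ℝ) ∈ Ico (0 : ℝ) 1 := ⟨le_rfl, one_pos⟩
    rw [(hasDerivAt_barrier hn hf hf2 ha hq hk (hsub h0)).hasDerivWithinAt.derivWithin
      (uniqueDiffOn_Ico 0 1 0 h0)]
    simp [barrierDeriv]
  · have hr' := hsub ⟨hr.1.le, hr.2⟩
    rw [(hasDerivAt_barrier hn hf hf2 ha hq hk hr').deriv]
    have h1 := barrierSlope_pos hn hq hk hr'
    have h2 := scaledF_pos hn hf (barrier_pos hn hf hf2 ha hq hk hr')
    have h3 := hr.1
    unfold barrierDeriv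
    positivity

/-- The reciprocal of `H` at `g(s)`. -/
noncomputable def recipH (n : ℕ) (f : ℝ → ℝ) (a s : ℝ) : ℝ :=
  scaledF n f (fung (n + 1) f a s) ^ (((n : ℝ) + 1) / (2 * n + 1))
    / (s * f (fung (n + 1) f a s))

/-- The bracket in the radial operator of the barrier:
`r² Y (σ - (1-σ) ρ) + ρ (n Z + r²)` with `Y = (φ')²/(φ φ'')`, `Z = -φ'/φ''`, `ρ = 1/H`. -/
noncomputable def barrierFactor (n : ℕ) (q : ℝ → ℝ) (r rho : ℝ) : ℝ :=
  r ^ 2 * (scaledP n q ((1 - r ^ 2) / 2) ^ ((2 * (n : ℝ) + 1) / (n + 1))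
      / (funPhi (n + 1) q ((1 - r ^ 2) / 2) * q ((1 - r ^ 2) / 2)))
    * (((n : ℝ) + 1) / (2 * n + 1) - (n : ℝ) / (2 * n + 1) * rho)
  + rho * (n * (scaledP n q ((1 - r ^ 2) / 2) / q ((1 - r ^ 2) / 2)) + r ^ 2)

/-- The constant in the radial operator of the barrier. -/
noncomputable def barrierConst (n : ℕ) : ℝ :=
  (n * (((n : ℝ) + 1) / (2 * n + 1))) ^ (1 / (n : ℝ)) * (((n : ℝ) + 1) / (2 * n + 1))

lemma barrierConst_pos (hn : 1 ≤ n) : 0 < barrierConst n := by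
  have : (0 : ℝ) < n := by positivity
  unfold barrierConst
  positivity

lemma rpow_eq_root_pow {x : ℝ} (hx : 0 < x) {d e : ℝ} (m : ℕ) (h : e = 1 / d * m) :
    x ^ e = (x ^ (1 / d)) ^ m := by
  rw [h, Real.rpow_mul hx.le, Real.rpow_natCast]

lemma rpow_eq_inv_root_pow {x : ℝ} (hx : 0 < x) {d e : ℝ} (m : ℕ) (h : e = -(1 / d * m)) :
    x ^ e = ((x ^ (1 / d)) ^ m)⁻¹ := by
  rw [h, Real.rpow_neg hx.le, Real.rpow_mul hx.le, Real.rpow_natCast]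

/-- The radial operator of a barrier in closed form. -/
lemma radialOp_barrier (hn : 1 ≤ n) (hf : CondF1 f) (hf2 : CondF2 (n + 1) f)
    (ha : 0 < a) (hq : IsWeight q) (hk : 0 < k) (hr : r ∈ Ioo (0 : ℝ) 1) :
    radialOp (n + 1) (barrier (n + 1) f a q k) r
      = barrierConst n * (k ^ (1 / (n : ℝ)) * k ^ 2) * q ((1 - r ^ 2) / 2)
        * f (barrier (n + 1) f a q k r)
        * barrierFactor n q r (recipH n f a (barrierArg n q k r)) := by
  have hr' : r ∈ Ioo (-1 : ℝ) 1 := ⟨by linarith [hr.1], hr.2⟩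
  have hr0 : r ≠ 0 := hr.1.ne'
  have hn0 : (n : ℝ) ≠ 0 := by positivity
  have hnp : (0 : ℝ) < n := by positivity
  have hn1 : (n : ℝ) + 1 ≠ 0 := by positivity
  have hn2 : 2 * (n : ℝ) + 1 ≠ 0 := by positivity
  have ht := depth_mem hr'
  have d1 : deriv (barrier (n + 1) f a q k) r = barrierDeriv n f a q k r :=
    (hasDerivAt_barrier hn hf hf2 ha hq hk hr').deriv
  have d2 : deriv (deriv (barrier (n + 1) f a q k)) r = barrierDeriv₂ n f a q k r := by
    have he : deriv (barrier (n + 1) f a q k) =ᶠ[𝓝 r] barrierDeriv n f a q k := by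
      filter_upwards [Ioo_mem_nhds hr'.1 hr'.2] with x hx using
        (hasDerivAt_barrier hn hf hf2 ha hq hk hx).deriv
    exact ((hasDerivAt_barrierDeriv hn hf hf2 ha hq hk hr').congr_of_eventuallyEq he).deriv
  have hy := barrier_pos hn hf hf2 ha hq hk hr'
  have hA := scaledF_pos hn hf hy
  have hfy := hf.1 _ hy
  have hφ := hq.funPhi_pos hn ht
  have hP := hq.scaledP_pos hn ht
  have hqt := hq.pos _ ht.1
  rw [radialOp, d1, d2, barrierDeriv, barrierDeriv₂, barrierSlope, barrierCurv, recipH,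
    ← barrier_succ, barrierFactor, barrierArg, barrierConst]
  have c1 : ((n + 1 : ℕ) : ℝ) - 1 = n := by push_cast; ring
  have c2 : ((n + 1 : ℕ) : ℝ) - 2 = n - 1 := by push_cast; ring
  rw [c1, c2]
  generalize scaledF n f (barrier (n + 1) f a q k r) = A at *
  generalize f (barrier (n + 1) f a q k r) = F at *
  generalize funPhi (n + 1) q ((1 - r ^ 2) / 2) = φ at *
  generalize scaledP n q ((1 - r ^ 2) / 2) = P at *
  generalize q ((1 - r ^ 2) / 2) = Q at *
  -- Every power of `A`, `φ`, `P` that occurs is an integer power of one of these roots, so the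
  -- claim becomes a rational identity once the `n`-th root in `hroot` is extracted.
  set e := A ^ (1 / (2 * (n : ℝ) + 1)) with he
  set v := φ ^ (1 / (2 * (n : ℝ) + 1)) with hv
  set x := P ^ (1 / ((n : ℝ) + 1)) with hx
  have hep : 0 < e := by positivity
  have hvp : 0 < v := by positivity
  have hxp : 0 < x := by positivity
  have a1 : A ^ ((n : ℝ) / (2 * n + 1)) = e ^ n :=
    rpow_eq_root_pow hA n (by field_simp)
  have a2 : A ^ (2 * ((n : ℝ) / (2 * n + 1)) - 1) = (e ^ 1)⁻¹ :=
    rpow_eq_inv_root_pow hA 1 (by field_simp; push_cast; ring)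
  have a3 : A ^ (((n : ℝ) + 1) / (2 * n + 1)) = e ^ (n + 1) :=
    rpow_eq_root_pow hA (n + 1) (by push_cast; field_simp)
  have v1 : φ ^ (((n : ℝ) + 1) / (2 * n + 1)) = v ^ (n + 1) :=
    rpow_eq_root_pow hφ (n + 1) (by push_cast; field_simp)
  have v2 : φ ^ (((n : ℝ) + 1) / (2 * n + 1) - 1) = (v ^ n)⁻¹ :=
    rpow_eq_inv_root_pow hφ n (by field_simp; ring)
  have v3 : φ ^ (((n : ℝ) + 1) / (2 * n + 1) - 1 - 1) = (v ^ (3 * n + 1))⁻¹ :=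
    rpow_eq_inv_root_pow hφ (3 * n + 1) (by push_cast; field_simp; ring)
  have v4 : φ = v ^ (2 * n + 1) := by
    rw [hv, ← rpow_eq_root_pow hφ (2 * n + 1) (e := 1) (by push_cast; field_simp), Real.rpow_one]
  have x1 : P ^ ((n : ℝ) / (n + 1)) = x ^ n := rpow_eq_root_pow hP n (by field_simp)
  have x2 : P ^ ((n : ℝ) / (n + 1) - 1) = (x ^ 1)⁻¹ :=
    rpow_eq_inv_root_pow hP 1 (by field_simp; push_cast; ring)
  have x3 : P ^ ((2 * (n : ℝ) + 1) / (n + 1)) = x ^ (2 * n + 1) :=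
    rpow_eq_root_pow hP (2 * n + 1) (by push_cast; field_simp)
  have x4 : P = x ^ (n + 1) := by
    rw [hx, ← rpow_eq_root_pow hP (n + 1) (e := 1) (by push_cast; field_simp), Real.rpow_one]
  rw [a1, a2, a3, v1, v2, v3, x1, x2, x3]
  have hroot : ((n : ℝ) / r * (e ^ n * (r * (k * (((n : ℝ) + 1) / (2 * n + 1)) * (v ^ n)⁻¹ * x ^ n))))
        ^ (1 / (n : ℝ))
      = (n * (((n : ℝ) + 1) / (2 * n + 1))) ^ (1 / (n : ℝ)) * k ^ (1 / (n : ℝ)) * (e * v⁻¹ * x) := by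
    have e1 : (n : ℝ) / r * (e ^ n * (r * (k * (((n : ℝ) + 1) / (2 * n + 1)) * (v ^ n)⁻¹ * x ^ n)))
        = n * (((n : ℝ) + 1) / (2 * n + 1)) * k * (e * v⁻¹ * x) ^ n := by
      rw [mul_pow, mul_pow, inv_pow]; field_simp
    rw [e1, Real.mul_rpow (by positivity) (by positivity),
      Real.mul_rpow (by positivity) (by positivity), one_div,
      Real.pow_rpow_inv_natCast (by positivity) (by omega)]
  rw [hroot]
  generalize ((n : ℝ) * (((n : ℝ) + 1) / (2 * n + 1))) ^ (1 / (n : ℝ)) = C₁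
  generalize k ^ (1 / (n : ℝ)) = C₂
  rw [v4, x4]
  clear_value e v x
  have p1 : v ^ (3 * n + 1) = v ^ n * v ^ n * v ^ n * v := by ring
  have p2 : v ^ (2 * n + 1) = v ^ n * v ^ n * v := by ring
  have p3 : x ^ (2 * n + 1) = x ^ n * x ^ n * x := by ring
  rw [p1, p2, p3, pow_succ e n, pow_succ v n, pow_succ x n, pow_one, pow_one]
  have hvn : v ^ n ≠ 0 := by positivity
  have hxn : x ^ n ≠ 0 := by positivity
  have hen : e ^ n ≠ 0 := by positivity
  generalize v ^ n = V at *
  generalize x ^ n = X at *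
  generalize e ^ n = E at *
  field_simp
  ring

end Barrier

section BarrierEstimates

/-! ### Estimates of the barriers -/

variable {n : ℕ} {K f p q q₁ q₂ : ℝ → ℝ} {a k k₁ k₂ r s rho eta C : ℝ}

lemma recipH_pos (hn : 1 ≤ n) (hf : CondF1 f) (hf2 : CondF2 (n + 1) f) (ha : 0 < a)
    (hs : 0 < s) : 0 < recipH n f a s := by
  have hy := fung_pos hn hf hf2 ha hs.le
  have h1 := scaledF_pos hn hf hy
  have h2 := hf.1 _ hy
  unfold recipH
  positivity

/-- This is `scaledF_rpow_sigma_le` at `τ = g(s)`, divided by `s f(g(s))`. The remainder is `O(1/s)`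
because `f(g(s)) ≥ f(a)`. -/
lemma recipH_le (hn : 1 ≤ n) (hf : CondF1 f) (hf2 : CondF2 (n + 1) f) (ha : 0 < a)
    (hs : 0 < s) : recipH n f a s ≤ ((n : ℝ) + 1) / n
      + scaledF n f a ^ (((n : ℝ) + 1) / (2 * n + 1)) / (s * f a) := by
  have hay := le_fung hn hf hf2 ha hs.le
  have hy := ha.trans_le hay
  have h := scaledF_rpow_sigma_le hn hf ha hay
  have hfa := hf.1 a ha
  have hfy := hf.1 _ hy
  have hle := hf.2.1 ha hy hay
  have h0 : 0 ≤ scaledF n f a ^ (((n : ℝ) + 1) / (2 * n + 1)) :=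
    Real.rpow_nonneg (scaledF_pos hn hf ha).le _
  rw [funG_fung hn hf hf2 ha hs.le] at h
  rw [recipH, div_le_iff₀ (by positivity)]
  refine h.trans ?_
  rw [add_mul, add_comm, mul_comm s (f (fung (n + 1) f a s))]
  refine add_le_add le_rfl ?_
  rw [div_mul_eq_mul_div, le_div_iff₀ (by positivity)]
  refine mul_le_mul_of_nonneg_left ?_ h0
  rw [mul_comm s]
  exact mul_le_mul_of_nonneg_right hle hs.le

/-- If `H` has a finite limit then its reciprocal stays away from zero. -/
lemma exists_le_recipH (hn : 1 ≤ n) (hf : CondF1 f) (hf2 : CondF2 (n + 1) f) (ha : 0 < a)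
    (hH : ∃ Hinf : ℝ, Tendsto (funH (n + 1) f a) atTop (𝓝 Hinf)) :
    ∃ m > 0, ∀ᶠ s in atTop, m ≤ recipH n f a s := by
  obtain ⟨L, hL⟩ := hH
  refine ⟨(|L| + 1)⁻¹, by positivity, ?_⟩
  have h1 := (hL.comp (tendsto_fung hn hf hf2 ha)).eventually_lt_const
    (show L < |L| + 1 by linarith [le_abs_self L])
  filter_upwards [h1, eventually_gt_atTop 0] with s hs hs0
  have hy := fung_pos hn hf hf2 ha hs0.le
  rw [Function.comp_apply, funH_succ hn hf ha hy, funG_fung hn hf hf2 ha hs0.le] at hs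
  have h2 := recipH_pos hn hf hf2 ha hs0
  rw [inv_le_comm₀ (by positivity) h2, recipH, inv_div]
  exact hs.le

lemma scaledP_ratio_mem (hn : 1 ≤ n) (hq : IsWeight q) {t : ℝ} (ht : t ∈ Ioo (0 : ℝ) 1) :
    scaledP n q t / q t ∈ Icc 0 (((n : ℝ) + 1) / n) := by
  have h1 := hq.pos t ht.1
  refine ⟨(div_pos (hq.scaledP_pos hn ht) h1).le, ?_⟩
  rw [div_le_iff₀ h1]
  exact hq.scaledP_le ⟨ht.1, ht.2.le⟩

lemma scaledP_rpow_ratio_mem (hn : 1 ≤ n) (hq : IsWeight q) {t : ℝ} (ht : t ∈ Ioo (0 : ℝ) 1) :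
    scaledP n q t ^ ((2 * (n : ℝ) + 1) / (n + 1)) / (funPhi (n + 1) q t * q t)
      ∈ Icc 0 ((2 * (n : ℝ) + 1) / n) := by
  have h1 := hq.pos t ht.1
  have h2 := hq.funPhi_pos hn ht
  have h3 := hq.scaledP_pos hn ht
  refine ⟨by positivity, ?_⟩
  rw [div_le_iff₀ (by positivity), mul_comm (funPhi (n + 1) q t)]
  exact hq.scaledP_rpow_le hn ht

lemma barrierFactor_le (hn : 1 ≤ n) (hq : IsWeight q) (hr : r ∈ Ioo (0 : ℝ) 1)
    (hrho : 0 ≤ rho) : barrierFactor n q r rho ≤ ((n : ℝ) + 1) / n + rho * (n + 2) := by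
  have ht := depth_mem ⟨by linarith [hr.1], hr.2⟩
  have hY := scaledP_rpow_ratio_mem hn hq ht
  have hZ := scaledP_ratio_mem hn hq ht
  have hnp : (0 : ℝ) < n := by positivity
  have hr2 : r ^ 2 ≤ 1 := pow_le_one₀ hr.1.le hr.2.le
  rw [barrierFactor]
  generalize scaledP n q ((1 - r ^ 2) / 2) ^ ((2 * (n : ℝ) + 1) / (n + 1))
      / (funPhi (n + 1) q ((1 - r ^ 2) / 2) * q ((1 - r ^ 2) / 2)) = Y at *
  generalize scaledP n q ((1 - r ^ 2) / 2) / q ((1 - r ^ 2) / 2) = Z at *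
  have e1 : r ^ 2 * Y ≤ (2 * (n : ℝ) + 1) / n :=
    (mul_le_of_le_one_left hY.1 hr2).trans hY.2
  have e2 : r ^ 2 * Y * (((n : ℝ) + 1) / (2 * n + 1) - (n : ℝ) / (2 * n + 1) * rho)
      ≤ (2 * (n : ℝ) + 1) / n * (((n : ℝ) + 1) / (2 * n + 1)) := by
    calc _ ≤ r ^ 2 * Y * (((n : ℝ) + 1) / (2 * n + 1)) := by
          refine mul_le_mul_of_nonneg_left ?_ (mul_nonneg (sq_nonneg r) hY.1)
          have : 0 ≤ (n : ℝ) / (2 * n + 1) * rho := by positivity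
          linarith
      _ ≤ _ := mul_le_mul_of_nonneg_right e1 (by positivity)
  have e3 : (2 * (n : ℝ) + 1) / n * (((n : ℝ) + 1) / (2 * n + 1)) = ((n : ℝ) + 1) / n := by
    field_simp
  have e4 : (n : ℝ) * Z ≤ n + 1 := by
    calc (n : ℝ) * Z ≤ n * (((n : ℝ) + 1) / n) := mul_le_mul_of_nonneg_left hZ.2 hnp.le
      _ = n + 1 := by field_simp
  have e5 : rho * (n * Z + r ^ 2) ≤ rho * (n + 2) :=
    mul_le_mul_of_nonneg_left (by linarith) hrho
  linarith

/-- The value `ρ = (n+1)/n` is exactly where `σ - (1-σ) ρ` vanishes, `σ = (n+1)/(2n+1)`. So the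
first term loses at most `r² eta`, which half of `m r²` in the second absorbs. -/
lemma le_barrierFactor (hn : 1 ≤ n) (hq : IsWeight q) (hr : r ∈ Ioo (0 : ℝ) 1) {m : ℝ}
    (hrho : m ≤ rho) (hrho' : rho ≤ ((n : ℝ) + 1) / n + eta) (heta0 : 0 ≤ eta)
    (heta : eta ≤ m / 2) :
    m * (n * (scaledP n q ((1 - r ^ 2) / 2) / q ((1 - r ^ 2) / 2)) + r ^ 2 / 2)
      ≤ barrierFactor n q r rho := by
  have ht := depth_mem ⟨by linarith [hr.1], hr.2⟩
  have hY := scaledP_rpow_ratio_mem hn hq ht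
  have hZ := scaledP_ratio_mem hn hq ht
  have hnp : (0 : ℝ) < n := by positivity
  rw [barrierFactor]
  generalize scaledP n q ((1 - r ^ 2) / 2) ^ ((2 * (n : ℝ) + 1) / (n + 1))
      / (funPhi (n + 1) q ((1 - r ^ 2) / 2) * q ((1 - r ^ 2) / 2)) = Y at *
  generalize scaledP n q ((1 - r ^ 2) / 2) / q ((1 - r ^ 2) / 2) = Z at *
  have e1 : -((n : ℝ) / (2 * n + 1) * eta)
      ≤ ((n : ℝ) + 1) / (2 * n + 1) - (n : ℝ) / (2 * n + 1) * rho := by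
    have h1 : (n : ℝ) / (2 * n + 1) * rho
        ≤ (n : ℝ) / (2 * n + 1) * (((n : ℝ) + 1) / n + eta) :=
      mul_le_mul_of_nonneg_left hrho' (by positivity)
    have h2 : (n : ℝ) / (2 * n + 1) * (((n : ℝ) + 1) / n + eta)
        = ((n : ℝ) + 1) / (2 * n + 1) + (n : ℝ) / (2 * n + 1) * eta := by field_simp
    linarith
  have e2 : -(r ^ 2 * eta)
      ≤ r ^ 2 * Y * (((n : ℝ) + 1) / (2 * n + 1) - (n : ℝ) / (2 * n + 1) * rho) := by
    have h1 := mul_le_mul_of_nonneg_left e1 (mul_nonneg (sq_nonneg r) hY.1)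
    refine le_trans ?_ h1
    have h2 : r ^ 2 * Y * ((n : ℝ) / (2 * n + 1) * eta)
        ≤ r ^ 2 * ((2 * (n : ℝ) + 1) / n) * ((n : ℝ) / (2 * n + 1) * eta) :=
      mul_le_mul_of_nonneg_right (mul_le_mul_of_nonneg_left hY.2 (sq_nonneg r)) (by positivity)
    have h3 : r ^ 2 * ((2 * (n : ℝ) + 1) / n) * ((n : ℝ) / (2 * n + 1) * eta)
        = r ^ 2 * eta := by field_simp
    linarith
  have e3 : m * (n * Z + r ^ 2) ≤ rho * (n * Z + r ^ 2) :=
    mul_le_mul_of_nonneg_right hrho (add_nonneg (mul_nonneg hnp.le hZ.1) (sq_nonneg r))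
  have e4 : r ^ 2 * eta ≤ r ^ 2 * (m / 2) := mul_le_mul_of_nonneg_left heta (sq_nonneg r)
  nlinarith

/-- The ratio `P/q` may tend to zero as `r → 1`, but there `r²/2` is bounded below; for `r < 1/2`
the ratio is. The constants are `(1/2)²/2 = 1/8` and `(1 - 1/4)/2 = 3/8`. -/
lemma exists_pos_le_ratio (hn : 1 ≤ n) (hq : IsWeight q) :
    ∃ z > 0, ∀ r ∈ Ioo (0 : ℝ) 1,
      z ≤ n * (scaledP n q ((1 - r ^ 2) / 2) / q ((1 - r ^ 2) / 2)) + r ^ 2 / 2 := by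
  have hnp : (0 : ℝ) < n := by positivity
  have h38 : (0 : ℝ) < 3 / 8 := by norm_num
  have hP := hq.scaledP_pos hn (t := 1 / 2) ⟨by norm_num, by norm_num⟩
  have hq38 := hq.pos _ h38
  refine ⟨min (1 / 8) (n * (scaledP n q (1 / 2) / q (3 / 8))), by positivity, fun r hr => ?_⟩
  have ht := depth_mem ⟨by linarith [hr.1], hr.2⟩
  have hZ := scaledP_ratio_mem hn hq ht
  rcases le_or_gt (1 / 2) r with h | h
  · refine (min_le_left _ _).trans ?_
    nlinarith [mul_nonneg hnp.le hZ.1]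
  · refine (min_le_right _ _).trans ?_
    have h1 : (3 / 8 : ℝ) ≤ (1 - r ^ 2) / 2 := by nlinarith [hr.1]
    have h2 : scaledP n q (1 / 2) ≤ scaledP n q ((1 - r ^ 2) / 2) :=
      mul_le_mul_of_nonneg_left (hq.funP_anti ht.1 (depth_le_half r)) (by positivity)
    have h3 : q ((1 - r ^ 2) / 2) ≤ q (3 / 8) := hq.anti h38 ht.1 h1
    have h4 : scaledP n q (1 / 2) / q (3 / 8)
        ≤ scaledP n q ((1 - r ^ 2) / 2) / q ((1 - r ^ 2) / 2) :=
      div_le_div₀ (hP.le.trans h2) h2 (hq.pos _ ht.1) h3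
    have h5 := mul_le_mul_of_nonneg_left h4 hnp.le
    linarith [sq_nonneg r]

lemma le_barrierArg (hn : 1 ≤ n) (hq : IsWeight q) (hk : 0 < k) (hr : r ∈ Ioo (-1 : ℝ) 1) :
    k * funPhi (n + 1) q (1 / 2) ^ (((n : ℝ) + 1) / (2 * n + 1)) ≤ barrierArg n q k r := by
  refine mul_le_mul_of_nonneg_left (Real.rpow_le_rpow
    (hq.funPhi_pos hn ⟨by norm_num, by norm_num⟩).le ?_ (by positivity)) hk.le
  exact hq.funPhi_anti (depth_mem hr).1 (depth_le_half r) (by norm_num)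

/-- Barriers with a small factor are sub-solutions. -/
lemma exists_isSub_barrier (hn : 1 ≤ n) (hf : CondF1 f) (hf2 : CondF2 (n + 1) f)
    (ha : 0 < a) (hq : IsWeight q) (hC : 0 < C)
    (hqK : ∀ r ∈ Ioo (0 : ℝ) 1, q ((1 - r ^ 2) / 2) ≤ C * K r) :
    ∃ k₁ > 0, IsSub (n + 1) K f (barrier (n + 1) f a q k₁) := by
  have hnp : (0 : ℝ) < n := by positivity
  have hc := barrierConst_pos hn
  have hfa := hf.1 a ha
  have hΦ : 0 < funPhi (n + 1) q (1 / 2) ^ (((n : ℝ) + 1) / (2 * n + 1)) :=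
    Real.rpow_pos_of_pos (hq.funPhi_pos hn ⟨by norm_num, by norm_num⟩) _
  set Φ := funPhi (n + 1) q (1 / 2) ^ (((n : ℝ) + 1) / (2 * n + 1)) with hΦdef
  have hh : 0 < scaledF n f a ^ (((n : ℝ) + 1) / (2 * n + 1)) :=
    Real.rpow_pos_of_pos (scaledF_pos hn hf ha) _
  set D := scaledF n f a ^ (((n : ℝ) + 1) / (2 * n + 1)) / (Φ * f a) with hD
  have hD0 : 0 < D := by positivity
  set E := ((n : ℝ) + 1) / n + (((n : ℝ) + 1) / n + D) * (n + 2) with hE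
  have hE0 : 0 < E := by positivity
  -- The bound for `recipH` contains `D/k`, so `k²` times the bracket is at most `k E` when `k ≤ 1`.
  -- The second entry then makes the total constant at most `1`.
  set k := min 1 (1 / (barrierConst n * E * C)) with hkdef
  have hk : 0 < k := lt_min one_pos (by positivity)
  have hk1 : k ≤ 1 := min_le_left _ _
  have hkE : barrierConst n * E * C * k ≤ 1 := by
    have := min_le_right 1 (1 / (barrierConst n * E * C))
    rwa [← hkdef, le_div_iff₀ (by positivity), mul_comm] at this
  refine ⟨k, hk, admissible_barrier hn hf hf2 ha hq hk, fun r hr => ?_⟩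
  have hr' : r ∈ Ioo (-1 : ℝ) 1 := ⟨by linarith [hr.1], hr.2⟩
  have ht := depth_mem hr'
  have hs := barrierArg_pos hn hq hk hr'
  have hrho0 := recipH_pos hn hf hf2 ha hs
  have hrho := recipH_le hn hf hf2 ha hs
  have hfw := hf.1 _ (barrier_pos hn hf hf2 ha hq hk hr')
  have hqt := hq.pos _ ht.1
  rw [radialOp_barrier hn hf hf2 ha hq hk hr]
  have h1 : scaledF n f a ^ (((n : ℝ) + 1) / (2 * n + 1)) / (barrierArg n q k r * f a)
      ≤ D / k := by
    rw [hD, div_div]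
    refine div_le_div_of_nonneg_left hh.le (by positivity) ?_
    have := mul_le_mul_of_nonneg_right (le_barrierArg hn hq hk hr') hfa.le
    rw [← hΦdef] at this
    linarith
  have h2 := barrierFactor_le hn hq hr hrho0.le
  have h3 : barrierFactor n q r (recipH n f a (barrierArg n q k r))
      ≤ ((n : ℝ) + 1) / n + (((n : ℝ) + 1) / n + D / k) * (n + 2) :=
    h2.trans (add_le_add le_rfl (mul_le_mul_of_nonneg_right
      (hrho.trans (add_le_add le_rfl h1)) (by positivity)))
  have h4 : k ^ 2 * barrierFactor n q r (recipH n f a (barrierArg n q k r)) ≤ k * E := by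
    have e1 : k ^ 2 * (((n : ℝ) + 1) / n + (((n : ℝ) + 1) / n + D / k) * (n + 2))
        = k * (k * (((n : ℝ) + 1) / n + ((n : ℝ) + 1) / n * (n + 2)) + D * (n + 2)) := by
      field_simp
      ring
    have e2 : k * (((n : ℝ) + 1) / n + ((n : ℝ) + 1) / n * (n + 2))
        ≤ ((n : ℝ) + 1) / n + ((n : ℝ) + 1) / n * (n + 2) :=
      mul_le_of_le_one_left (by positivity) hk1
    refine (mul_le_mul_of_nonneg_left h3 (by positivity)).trans ?_
    rw [e1]
    refine mul_le_mul_of_nonneg_left ?_ hk.le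
    rw [hE]; linarith
  have h5 : k ^ (1 / (n : ℝ)) ≤ 1 := Real.rpow_le_one hk.le hk1 (by positivity)
  have h6 : 0 ≤ k ^ (1 / (n : ℝ)) := Real.rpow_nonneg hk.le _
  have hK0 : 0 ≤ K r := by
    have := hqt.le.trans (hqK r hr)
    exact nonneg_of_mul_nonneg_right this hC
  calc barrierConst n * (k ^ (1 / (n : ℝ)) * k ^ 2) * q ((1 - r ^ 2) / 2)
        * f (barrier (n + 1) f a q k r) * barrierFactor n q r (recipH n f a (barrierArg n q k r))
      = barrierConst n * k ^ (1 / (n : ℝ)) * q ((1 - r ^ 2) / 2)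
        * f (barrier (n + 1) f a q k r)
        * (k ^ 2 * barrierFactor n q r (recipH n f a (barrierArg n q k r))) := by ring
    _ ≤ barrierConst n * k ^ (1 / (n : ℝ)) * q ((1 - r ^ 2) / 2)
        * f (barrier (n + 1) f a q k r) * (k * E) :=
        mul_le_mul_of_nonneg_left h4 (by positivity)
    _ ≤ barrierConst n * 1 * (C * K r) * f (barrier (n + 1) f a q k r) * (k * E) := by
        have := hqK r hr
        gcongr
    _ = (barrierConst n * E * C * k) * (K r * f (barrier (n + 1) f a q k r)) := by ring
    _ ≤ K r * f (barrier (n + 1) f a q k r) :=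
        mul_le_of_le_one_left (mul_nonneg hK0 hfw.le) hkE

/-- Barriers with a large factor are super-solutions. -/
lemma eventually_isSuper_barrier (hn : 1 ≤ n) (hf : CondF1 f) (hf2 : CondF2 (n + 1) f)
    (ha : 0 < a) (hH : ∃ Hinf : ℝ, Tendsto (funH (n + 1) f a) atTop (𝓝 Hinf))
    (hq : IsWeight q)
    (hqK : ∀ r ∈ Ioo (0 : ℝ) 1, K r ≤ C * q ((1 - r ^ 2) / 2)) :
    ∀ᶠ k in atTop, IsSuper (n + 1) K f (barrier (n + 1) f a q k) := by
  have hnp : (0 : ℝ) < n := by positivity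
  have hc := barrierConst_pos hn
  have hfa := hf.1 a ha
  have hΦ : 0 < funPhi (n + 1) q (1 / 2) ^ (((n : ℝ) + 1) / (2 * n + 1)) :=
    Real.rpow_pos_of_pos (hq.funPhi_pos hn ⟨by norm_num, by norm_num⟩) _
  set Φ := funPhi (n + 1) q (1 / 2) ^ (((n : ℝ) + 1) / (2 * n + 1)) with hΦdef
  have hh : 0 < scaledF n f a ^ (((n : ℝ) + 1) / (2 * n + 1)) :=
    Real.rpow_pos_of_pos (scaledF_pos hn hf ha) _
  set h₀ := scaledF n f a ^ (((n : ℝ) + 1) / (2 * n + 1)) with hh₀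
  obtain ⟨m, hm, hrec⟩ := exists_le_recipH hn hf hf2 ha hH
  obtain ⟨s₀, hs₀⟩ := eventually_atTop.1 hrec
  obtain ⟨z, hz, hzr⟩ := exists_pos_le_ratio hn hq
  -- The argument of `g` is at least `k Φ`. The last two conditions force `recipH ≥ m` and a
  -- remainder of at most `m/2`; the second beats the constant `C`, using only `k^(2+1/n) ≥ k`.
  filter_upwards [eventually_ge_atTop 1, eventually_ge_atTop (C / (barrierConst n * (m * z))),
    eventually_ge_atTop (s₀ / Φ), eventually_ge_atTop (2 * h₀ / (m * f a * Φ))]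
    with k hk1 hkC hks hkh
  have hk : 0 < k := one_pos.trans_le hk1
  refine ⟨admissible_barrier hn hf hf2 ha hq hk, fun r hr => ?_⟩
  have hr' : r ∈ Ioo (-1 : ℝ) 1 := ⟨by linarith [hr.1], hr.2⟩
  have ht := depth_mem hr'
  have hs := barrierArg_pos hn hq hk hr'
  have hsk := le_barrierArg hn hq hk hr'
  rw [← hΦdef] at hsk
  have hrho0 := hs₀ _ (((div_le_iff₀ hΦ).1 hks).trans hsk)
  have hrho := recipH_le hn hf hf2 ha hs
  have hfw := hf.1 _ (barrier_pos hn hf hf2 ha hq hk hr')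
  have hqt := hq.pos _ ht.1
  have heta : h₀ / (barrierArg n q k r * f a) ≤ m / 2 := by
    rw [div_le_div_iff₀ (by positivity) two_pos]
    rw [div_le_iff₀ (by positivity)] at hkh
    have := mul_le_mul_of_nonneg_left hsk (by positivity : 0 ≤ m * f a)
    linarith
  have hfac := (mul_le_mul_of_nonneg_left (hzr r hr) hm.le).trans
    (le_barrierFactor hn hq hr hrho0 hrho (by positivity) heta)
  rw [radialOp_barrier hn hf hf2 ha hq hk hr]
  have h5 : 1 ≤ k ^ (1 / (n : ℝ)) := Real.one_le_rpow hk1 (by positivity)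
  have h6 : k ≤ k ^ 2 := by nlinarith
  have h7 : C ≤ barrierConst n * (m * z) * k := by
    rwa [div_le_iff₀ (by positivity), mul_comm] at hkC
  calc K r * f (barrier (n + 1) f a q k r)
      ≤ C * q ((1 - r ^ 2) / 2) * f (barrier (n + 1) f a q k r) :=
        mul_le_mul_of_nonneg_right (hqK r hr) hfw.le
    _ ≤ barrierConst n * (m * z) * k * q ((1 - r ^ 2) / 2) * f (barrier (n + 1) f a q k r) := by
        gcongr
    _ = barrierConst n * (1 * k) * q ((1 - r ^ 2) / 2) * f (barrier (n + 1) f a q k r)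
        * (m * z) := by ring
    _ ≤ _ := by gcongr

lemma barrierArg_le (h₁ : IsWeight q₁) (h₂ : IsWeight q₂) (hn : 1 ≤ n)
    (hle : ∀ t, 0 < t → q₁ t ≤ q₂ t) (hk : 0 < k₁) (hk₁₂ : k₁ ≤ k₂) (hr : r ∈ Ioo (-1 : ℝ) 1) :
    barrierArg n q₁ k₁ r ≤ barrierArg n q₂ k₂ r := by
  have ht := depth_mem hr
  have h0 := (h₁.funPhi_pos hn ht).le
  exact mul_le_mul hk₁₂ (Real.rpow_le_rpow h0
    (IsWeight.funPhi_mono h₁ h₂ hle ⟨ht.1, ht.2.le⟩) (by positivity))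
    (Real.rpow_nonneg h0 _) (hk.le.trans hk₁₂)

lemma barrierArg_lt (hn : 1 ≤ n) (h₁ : IsWeight q) (hk₁₂ : k₁ < k₂)
    (hr : r ∈ Ioo (-1 : ℝ) 1) : barrierArg n q k₁ r < barrierArg n q k₂ r :=
  mul_lt_mul_of_pos_right hk₁₂ (Real.rpow_pos_of_pos (h₁.funPhi_pos hn (depth_mem hr)) _)

lemma barrier_le_barrier (hn : 1 ≤ n) (hf : CondF1 f) (hf2 : CondF2 (n + 1) f) (ha : 0 < a)
    (h₁ : IsWeight q₁) (h₂ : IsWeight q₂) (hle : ∀ t, 0 < t → q₁ t ≤ q₂ t) (hk : 0 < k₁)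
    (hk₁₂ : k₁ ≤ k₂) (hr : r ∈ Ioo (-1 : ℝ) 1) :
    barrier (n + 1) f a q₁ k₁ r ≤ barrier (n + 1) f a q₂ k₂ r := by
  rw [barrier_succ, barrier_succ]
  have h := barrierArg_le h₁ h₂ hn hle hk hk₁₂ hr
  have h0 := (barrierArg_pos hn h₁ hk hr).le
  exact (strictMonoOn_fung hn hf hf2 ha).monotoneOn h0 (h0.trans h) h

lemma barrier_lt_barrier (hn : 1 ≤ n) (hf : CondF1 f) (hf2 : CondF2 (n + 1) f) (ha : 0 < a)
    (h₁ : IsWeight q₁) (h₂ : IsWeight q₂) (hle : ∀ t, 0 < t → q₁ t ≤ q₂ t) (hk : 0 < k₁)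
    (hk₁₂ : k₁ < k₂) (hr : r ∈ Ioo (-1 : ℝ) 1) :
    barrier (n + 1) f a q₁ k₁ r < barrier (n + 1) f a q₂ k₂ r := by
  rw [barrier_succ, barrier_succ]
  have h := (barrierArg_lt hn h₁ hk₁₂ hr).trans_le
    (barrierArg_le h₁ h₂ hn hle (hk.trans hk₁₂) le_rfl hr)
  have h0 := (barrierArg_pos hn h₁ hk hr).le
  exact strictMonoOn_fung hn hf hf2 ha h0 (h0.trans h.le) h

lemma tendsto_barrier (hn : 1 ≤ n) (hf : CondF1 f) (hf2 : CondF2 (n + 1) f) (ha : 0 < a)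
    (hk : 0 < k) (hφ : Tendsto (funPhi (n + 1) q) (𝓝[>] 0) atTop) :
    Tendsto (barrier (n + 1) f a q k) (𝓝[<] 1) atTop := by
  have hd : Tendsto (fun r : ℝ => (1 - r ^ 2) / 2) (𝓝[<] 1) (𝓝[>] 0) := by
    refine tendsto_nhdsWithin_iff.2 ⟨?_, ?_⟩
    · have : Tendsto (fun r : ℝ => (1 - r ^ 2) / 2) (𝓝 1) (𝓝 ((1 - 1 ^ 2) / 2)) :=
        Continuous.tendsto (by fun_prop) 1
      rw [one_pow, sub_self, zero_div] at this
      exact this.mono_left nhdsWithin_le_nhds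
    · filter_upwards [Ioo_mem_nhdsLT (show (-1 : ℝ) < 1 by norm_num)] with r hr
        using (depth_mem hr).1
  have h1 := (((tendsto_rpow_atTop (by positivity : 0 < ((n : ℝ) + 1) / (2 * n + 1))).comp
    (hφ.comp hd)).const_mul_atTop hk)
  exact ((tendsto_fung hn hf hf2 ha).comp h1).congr fun r => (barrier_succ n f a q k r).symm

lemma exists_barrier_gt {w : ℝ → ℝ} (hw : Tendsto w (𝓝[<] 1) atTop) (M : ℝ) :
    ∃ δ > 0, ∀ r ∈ Ico (0 : ℝ) 1, 1 - δ < r → M < w r := by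
  obtain ⟨l, hl, hlM⟩ := (mem_nhdsLT_iff_exists_Ioo_subset' (zero_lt_one (α := ℝ))).1
    (hw.eventually_gt_atTop M)
  refine ⟨1 - l, sub_pos.2 hl, fun r hr hlr => hlM ⟨?_, hr.2⟩⟩
  linarith

/-- The comparison of `K` with the weight extends from a neighbourhood of `1` to `[0,1)`. -/
lemma exists_weight_bounds (hK : CondK K) (hp : IsWeight p) {c d : ℝ} (hc : 0 < c)
    (hKp : ∀ᶠ r in 𝓝[<] (1 : ℝ), c * p (1 - r) ≤ K r ∧ K r ≤ d * p (1 - r)) :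
    ∃ C > 0, ∀ r ∈ Ico (0 : ℝ) 1, p (1 - r) ≤ C * K r ∧ K r ≤ C * p (1 - r) := by
  obtain ⟨l, hl, hlK⟩ := (mem_nhdsLT_iff_exists_Ioo_subset' (zero_lt_one (α := ℝ))).1 hKp
  have hl1 : l < 1 := hl
  have hsub : Icc 0 (max l 0) ⊆ Ico (0 : ℝ) 1 :=
    fun r hr => ⟨hr.1, hr.2.trans_lt (max_lt hl1 one_pos)⟩
  have hpc : ContinuousOn (fun r => p (1 - r)) (Icc 0 (max l 0)) :=
    hp.cont.comp (by fun_prop) fun r hr => sub_pos.2 (hsub hr).2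
  have hKc := hK.1.mono hsub
  have hpp : ∀ r ∈ Ico (0 : ℝ) 1, 0 < p (1 - r) := fun r hr => hp.pos _ (sub_pos.2 hr.2)
  -- Away from `1` both quotients of `K` and the weight are continuous on a compact interval, hence
  -- bounded.
  obtain ⟨C₁, hC₁⟩ := isCompact_Icc.exists_bound_of_continuousOn
    (hpc.div hKc fun r hr => (hK.2 r (hsub hr)).ne')
  obtain ⟨C₂, hC₂⟩ := isCompact_Icc.exists_bound_of_continuousOn
    (hKc.div hpc fun r hr => (hpp r (hsub hr)).ne')
  refine ⟨max (max |C₁| |C₂|) (max (1 / c) |d|),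
    lt_max_of_lt_right (lt_max_of_lt_left (by positivity)), fun r hr => ?_⟩
  have hKr := hK.2 r hr
  have hpr := hpp r hr
  set C := max (max |C₁| |C₂|) (max (1 / c) |d|)
  have hM₁ : |C₁| ≤ C := (le_max_left _ _).trans (le_max_left _ _)
  have hM₂ : |C₂| ≤ C := (le_max_right _ _).trans (le_max_left _ _)
  have hM₃ : 1 / c ≤ C := (le_max_left _ _).trans (le_max_right _ _)
  have hM₄ : |d| ≤ C := (le_max_right _ _).trans (le_max_right _ _)
  rcases le_or_gt r (max l 0) with h | h
  · have h1 := (le_abs_self _).trans ((hC₁ r ⟨hr.1, h⟩).trans ((le_abs_self _).trans hM₁))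
    have h2 := (le_abs_self _).trans ((hC₂ r ⟨hr.1, h⟩).trans ((le_abs_self _).trans hM₂))
    exact ⟨(div_le_iff₀ hKr).1 h1, (div_le_iff₀ hpr).1 h2⟩
  · obtain ⟨h1, h2⟩ := hlK ⟨(le_max_left _ _).trans_lt h, hr.2⟩
    constructor
    · calc p (1 - r) = 1 / c * (c * p (1 - r)) := by field_simp
        _ ≤ 1 / c * K r := mul_le_mul_of_nonneg_left h1 (by positivity)
        _ ≤ C * K r := mul_le_mul_of_nonneg_right hM₃ hKr.le
    · exact h2.trans (mul_le_mul_of_nonneg_right ((le_abs_self d).trans hM₄) hpr.le)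

end BarrierEstimates

/-! ### The main theorem: choice of weights and scales. -/

theorem mainTheorem1 (N : ℕ) (hN : 2 ≤ N) (K f : ℝ → ℝ)
    (hK : CondK K) (hf1 : CondF1 f) (hf2 : CondF2 N f)
    (p : ℝ → ℝ) (hp : ClassP N p) (c d : ℝ) (hc : 0 < c) (hd : 0 < d)
    (hKp : ∀ᶠ r in 𝓝[<] (1 : ℝ), c * p (1 - r) ≤ K r ∧ K r ≤ d * p (1 - r))
    (a : ℝ) (ha : 0 < a) (hH : ∃ Hinf : ℝ, Tendsto (funH N f a) atTop (𝓝 Hinf)) :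
    (radialConvexSolutions N K f).Infinite ∧
    ∃ ε > 0, ∃ M > 0, ∃ k₁ > 0, ∃ k₂ > 0, ∃ w₁ w₂ : ℝ → ℝ,
      w₁ = barrier N f a (fun t => ε * p (2 * t)) k₁ ∧
      w₂ = barrier N f a (fun t => M * p t) k₂ ∧
      IsSub N K f w₁ ∧ IsSuper N K f w₂ ∧ w₁ 0 < w₂ 0 ∧
      ∀ k ∈ Ioo (w₁ 0) (w₂ 0), ∃ u : ℝ → ℝ,
        SolvesIVP N K f k u ∧
        (∀ v : ℝ → ℝ, SolvesIVP N K f k v → EqOn v u (Ico 0 1)) ∧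
        (∀ r ∈ Ico (0 : ℝ) 1, w₁ r < u r ∧ u r < w₂ r) ∧
        IsRadialConvexSolution N K f (fun x => u ‖x‖) := by
  obtain ⟨n, rfl⟩ : ∃ n, N = n + 1 := ⟨N - 1, by omega⟩
  have hn : 1 ≤ n := by omega
  have hpw := hp.isWeight
  have hpw₂ := hpw.comp_two_mul
  obtain ⟨C, hC, hKC⟩ := exists_weight_bounds hK hpw hc hKp
  -- Since `2 · (1-r²)/2 = 1 - r² ≥ 1 - r`, the weight `p(2·)` lies below `p(1-r)` at this depth.
  obtain ⟨k₁, hk₁, hsub⟩ := exists_isSub_barrier (K := K) hn hf1 hf2 ha hpw₂ hC fun r hr => by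
    refine le_trans ?_ (hKC r ⟨hr.1.le, hr.2⟩).1
    refine hpw.anti (sub_pos.2 hr.2) ?_ ?_
    · exact mul_pos two_pos (depth_mem ⟨by linarith [hr.1], hr.2⟩).1
    · nlinarith [hr.1, hr.2]
  -- Here `(1-r²)/2 ≤ 1 - r`, so the weight `p` lies above `p(1-r)`. Being a super-solution holds
  -- for all large `k`, which leaves room for `k₁ < k₂`.
  obtain ⟨k₂, hk₁₂, hsuper⟩ := ((eventually_gt_atTop k₁).and
    (eventually_isSuper_barrier (K := K) hn hf1 hf2 ha hH hpw fun r hr => by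
      refine (hKC r ⟨hr.1.le, hr.2⟩).2.trans (mul_le_mul_of_nonneg_left ?_ hC.le)
      refine hpw.anti (depth_mem ⟨by linarith [hr.1], hr.2⟩).1 (sub_pos.2 hr.2) ?_
      nlinarith [hr.1, hr.2])).exists
  have hle : ∀ t, 0 < t → p (2 * t) ≤ p t := fun t ht =>
    hpw.anti ht (show 0 < 2 * t by positivity) (by linarith)
  have hmem : ∀ r ∈ Ico (0 : ℝ) 1, r ∈ Ioo (-1 : ℝ) 1 :=
    fun r hr => ⟨by linarith [hr.1], hr.2⟩
  have hlt : barrier (n + 1) f a (fun t => p (2 * t)) k₁ 0 < barrier (n + 1) f a p k₂ 0 :=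
    barrier_lt_barrier hn hf1 hf2 ha hpw₂ hpw hle hk₁ hk₁₂ (hmem 0 ⟨le_rfl, one_pos⟩)
  have hsol := fun k hk => exists_unique_solution (k := k) hn hK hf1 hsub hsuper
    (fun r hr => barrier_le_barrier hn hf1 hf2 ha hpw₂ hpw hle hk₁ hk₁₂.le (hmem r hr))
    (exists_barrier_gt (tendsto_barrier hn hf1 hf2 ha hk₁ (tendsto_funPhi_two_mul hn hp))) hk
  -- `ε = M = 1` suffices, because the constants comparing `K` with the weight are absorbed into
  -- `k₁` and `k₂`.
  refine ⟨radialConvexSolutions_infinite hlt fun k hk => ?_, 1, one_pos, 1, one_pos, k₁, hk₁,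
    k₂, hk₁.trans hk₁₂, _, _, by simp only [one_mul], by simp only [one_mul], hsub,
    hsuper, hlt, hsol⟩
  obtain ⟨u, hu, -, -, hz⟩ := hsol k hk
  exact ⟨u, hu.2.1, hz⟩
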